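/- Let $m\ge 2$, $n\ge 1$, $d\ge 0$ and $0<\bar a\le a$, $b>0$, $c>0$, $x_0\in\mathbb R^m$, $y_0\in\mathbb R^n$, $w_0\in\mathbb R^d$. Put $P_1=\{\|x-x_0\|_\infty\le a\}\subset\mathbb R^m$, $P_2=\{\|y-y_0\|_\infty\le b\}\subset\mathbb R^n$, $P_3=\{\|w-w_0\|_\infty\le c\}\subset\mathbb R^d$, $P=P_1\times P_2$, $V=\{x\in P_1: x_m=x_{0m},\ |x_l-x_{0l}|\le\bar a\ (l<m)\}$ and let $V_{int}$ be the same set with $<\bar a$. Let $\bar C_{il},\bar D_i:P\times P_3\to\mathbb R$ and $\bar I_i:V\times P_3\to\mathbb R$ ($1\le i\le n$, $1\le l\le m-1$) be Lipschitz (respectively $C^r$ for some integer $r\ge1$), with $\max_{V\times P_3}\|\bar I-y_0\|_\infty<b$. Consider $$\sum_{l=1}^{m-1}\bar C_{il}(x,y,w)\frac{\partial y_i}{\partial x_l}+\frac{\partial y_i}{\partial x_m}=\bar D_i(x,y,w),\qquad i=1,\dots,n.\tag{1}$$ A Lipschitz solution is a Lipschitz function that satisfies (1) at each (interior) point where it is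 differentiable. Let $M_I$ be an upper bound of $\|\bar I-y_0\|_\infty$ on $V\times P_3$; let $M_D,M_C$ be upper bounds of all $|\bar D_i|$, respectively all $|\bar C_{il}|$, and let $m_{C_l}\le \bar C_{il}\le M_{C_l}$ for all $i$, on $P\times P_3$; let $L_C,L_D,L_I$ be Lipschitz constants, for the 1-norm, of all $\bar C_{il}$, $\bar D_i$ on $P\times P_3$ and all $\bar I_i$ on $V\times P_3$. Put $c_1=nL_D-(m-1)L_C$ and let $\theta$ be the step function. Call $\alpha>0$ admissible if $$\alpha\, e^{\theta(c_1)c_1\alpha}\,n(m-1)L_C(L_I+1/n)<1,\quad \alpha\le a,\quad \alpha M_D\le b-M_I,\quad -\bar a+M_{C_l}\alpha\le\bar a+m_{C_l}\alpha\ \text{ for all } l.$$ Let $S_+$ be the set of $x\in P_1$ with $0\le x_m-x_{0m}\le\alpha$ and $-\bar a+M_{C_l}(x_m-x_{0m})\le x_l-x_{0l}\le\bar a+m_{C_l}(x_m-x_{0m})$ for all $l<m$, let $S_-$ be the set of $x\in P_1$ with $-\alpha\le x_m-x_{0m}\le0$ and $-\bar a+m_{C_l}(x_m-x_{0m})\le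 x_l-x_{0l}\le\bar a+M_{C_l}(x_m-x_{0m})$ for all $l<m$, and put $B=S_+\cup S_-$. Then such constants and an admissible $\alpha$ exist, and for every choice of such constants and every admissible $\alpha$: $V\subset B\subseteq P_1$, $B$ contains a neighbourhood of $V_{int}$, and there is a unique jointly Lipschitz (respectively jointly $C^r$) solution $\bar f:B\times P_3\to P_2$ of (1) with $\bar f(u,w)=\bar I(u,w)$ on $V\times P_3$. For each fixed $w\in P_3$, $\bar f(\cdot,w)$ is the unique Lipschitz (respectively $C^r$) solution $B\to P_2$ of (1) for this $w$ with initial values $\bar I(\cdot,w)$ on $V$. In both cases, for the 1-norm on $B\times P_3$, each $\bar f_i$ is Lipschitz with constant $L_f$ on $\{x_m=\text{const}\}$ (jointly in $x_1,\dots,x_{m-1},w$), and Lipschitz with constant $L_{Ufs}$ in $(x,w)$, where $$L_f=\frac{(L_I+1/n)e^{c_1\alpha}}{1-n(m-1)L_C\alpha(L_I+1/n)e^{\theta(c_1)c_1\alpha}}-\frac1n,\qquad L_{Ufs}=\max\{L_f,\ M_D+(m-1)L_fM_C\}.$$ -/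

import Mathlib

open Set Topology

noncomputable section

namespace ParamPDE

/-- Points `x = (x₁, …, x_{m-1}, x_m)` of `ℝ^m`, with `m = p + 1`, split as
`((x₁, …, x_p), x_m)`. The norm of this type is the maximum norm. -/
abbrev Pt (p : ℕ) : Type := (Fin p → ℝ) × ℝ

/-- The 1-norm on `ℝ^k`. -/
def l1 {k : ℕ} (v : Fin k → ℝ) : ℝ := ∑ j, |v j|

/-- The step function. -/
def step (s : ℝ) : ℝ := if 0 ≤ s then 1 else 0

/-- The raw data of the problem: centres and half-widths of the boxes, the coefficients
`C i l (x, y, w)`, `D i (x, y, w)` and the initial datum `I (v, w)`, where `v` are the first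
`m - 1` coordinates of a point of the initial hyperplane `x_m = x₀_m`. -/
structure System (p n d : ℕ) where
  x₀ : Pt p
  y₀ : Fin n → ℝ
  w₀ : Fin d → ℝ
  a : ℝ
  abar : ℝ
  b : ℝ
  c : ℝ
  C : Fin n → Fin p → Pt p × (Fin n → ℝ) × (Fin d → ℝ) → ℝ
  D : Fin n → Pt p × (Fin n → ℝ) × (Fin d → ℝ) → ℝ
  I : (Fin p → ℝ) × (Fin d → ℝ) → Fin n → ℝ

/-- The constants attached to a system: `MI` (initial datum), `MD`, `MC` (absolute bounds of the
coefficients), `mCl l ≤ C i l ≤ MCl l`, and the Lipschitz constants `LC`, `LD`, `LI`. -/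
structure Constants (p : ℕ) where
  MI : ℝ
  MD : ℝ
  MC : ℝ
  mCl : Fin p → ℝ
  MCl : Fin p → ℝ
  LC : ℝ
  LD : ℝ
  LI : ℝ

namespace System

variable {p n d : ℕ} (Q : System p n d)

/-- The box `P₁` of the independent variables `x`. -/
def P₁ : Set (Pt p) := Metric.closedBall Q.x₀ Q.a

/-- The box `P₂` of the values `y`. -/
def P₂ : Set (Fin n → ℝ) := Metric.closedBall Q.y₀ Q.b

/-- The box `P₃` of the parameters `w`. -/
def P₃ : Set (Fin d → ℝ) := Metric.closedBall Q.w₀ Q.c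

/-- `P × P₃ = P₁ × P₂ × P₃`, the domain of the coefficients. -/
def PP₃ : Set (Pt p × (Fin n → ℝ) × (Fin d → ℝ)) := Q.P₁ ×ˢ Q.P₂ ×ˢ Q.P₃

/-- The initial box, in the coordinates `x₁, …, x_{m-1}` of the hyperplane `x_m = x₀_m`. -/
def V : Set (Fin p → ℝ) := Metric.closedBall Q.x₀.1 Q.abar

/-- The point of the initial hyperplane with first coordinates `v`. -/
def onV (v : Fin p → ℝ) : Pt p := (v, Q.x₀.2)

/-- Lipschitz data. -/
def LipschitzData : Prop :=
  (∀ i l, ∃ K, LipschitzOnWith K (Q.C i l) Q.PP₃) ∧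
  (∀ i, ∃ K, LipschitzOnWith K (Q.D i) Q.PP₃) ∧
  ∃ K, LipschitzOnWith K Q.I (Q.V ×ˢ Q.P₃)

/-- Data of class `C^r`. -/
def ContDiffData (r : ℕ) : Prop :=
  (∀ i l, ContDiffOn ℝ r (Q.C i l) Q.PP₃) ∧
  (∀ i, ContDiffOn ℝ r (Q.D i) Q.PP₃) ∧
  ContDiffOn ℝ r Q.I (Q.V ×ˢ Q.P₃)

/-- The `i`-th equation at `(x, w)`, for the value `y ∈ ℝ^n` and the `x`-derivative
`A : ℝ^m → ℝ^n` of the unknown function: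
`∑_l C i l (x, y, w) ∂y_i/∂x_l + ∂y_i/∂x_m = D i (x, y, w)` for all `i`. -/
def EqnAt (x : Pt p) (w : Fin d → ℝ) (y : Fin n → ℝ) (A : Pt p →L[ℝ] (Fin n → ℝ)) : Prop :=
  ∀ i, (∑ l, Q.C i l (x, y, w) * A (Pi.single l 1, 0) i) + A (0, 1) i = Q.D i (x, y, w)

/-- `g : B → P₂` is a Lipschitz solution for the fixed parameter `w`: it is Lipschitz, takes the
initial values, and solves the equations wherever it is differentiable. -/
def IsLipschitzSolutionAt (w : Fin d → ℝ) (B : Set (Pt p)) (g : Pt p → Fin n → ℝ) : Prop :=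
  (∃ K, LipschitzOnWith K g B) ∧ MapsTo g B Q.P₂ ∧
  (∀ v ∈ Q.V, g (Q.onV v) = Q.I (v, w)) ∧
  ∀ x ∈ interior B, DifferentiableAt ℝ g x → Q.EqnAt x w (g x) (fderiv ℝ g x)

/-- `f : B × P₃ → P₂` is a Lipschitz solution: it is jointly Lipschitz, takes the initial values,
and solves the equations wherever it is (jointly) differentiable. The partial derivative in `x`
is the restriction of the derivative to `x`-directions. -/
def IsLipschitzSolution (B : Set (Pt p)) (f : Pt p × (Fin d → ℝ) → Fin n → ℝ) : Prop :=
  (∃ K, LipschitzOnWith K f (B ×ˢ Q.P₃)) ∧ MapsTo f (B ×ˢ Q.P₃) Q.P₂ ∧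
  (∀ v ∈ Q.V, ∀ w ∈ Q.P₃, f (Q.onV v, w) = Q.I (v, w)) ∧
  ∀ z ∈ interior (B ×ˢ Q.P₃), DifferentiableAt ℝ f z →
    Q.EqnAt z.1 z.2 (f z) ((fderiv ℝ f z).comp (ContinuousLinearMap.inl ℝ _ _))

/-- `g : B → P₂` is a `C^r` solution for the fixed parameter `w`. -/
def IsContDiffSolutionAt (r : ℕ) (w : Fin d → ℝ) (B : Set (Pt p)) (g : Pt p → Fin n → ℝ) : Prop :=
  ContDiffOn ℝ r g B ∧ MapsTo g B Q.P₂ ∧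
  (∀ v ∈ Q.V, g (Q.onV v) = Q.I (v, w)) ∧
  ∀ x ∈ B, Q.EqnAt x w (g x) (fderivWithin ℝ g B x)

/-- `f : B × P₃ → P₂` is a solution that is jointly `C^r`. -/
def IsContDiffSolution (r : ℕ) (B : Set (Pt p)) (f : Pt p × (Fin d → ℝ) → Fin n → ℝ) : Prop :=
  ContDiffOn ℝ r f (B ×ˢ Q.P₃) ∧ MapsTo f (B ×ˢ Q.P₃) Q.P₂ ∧
  (∀ v ∈ Q.V, ∀ w ∈ Q.P₃, f (Q.onV v, w) = Q.I (v, w)) ∧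
  ∀ x ∈ B, ∀ w ∈ Q.P₃, Q.EqnAt x w (f (x, w)) (fderivWithin ℝ (fun x' => f (x', w)) B x)

/-- `V ⊆ B ⊆ P₁`, and `B` contains a neighbourhood of the relative interior of `V`. -/
def IsDomain (B : Set (Pt p)) : Prop :=
  (∀ v ∈ Q.V, Q.onV v ∈ B) ∧ B ⊆ Q.P₁ ∧ ∀ v ∈ Metric.ball Q.x₀.1 Q.abar, B ∈ 𝓝 (Q.onV v)

/-- `K` consists of valid bounds and of valid Lipschitz constants, the latter for each component
and with respect to the 1-norm, of the data of `Q` on `P × P₃` and `V × P₃`. -/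
def IsConstants (K : Constants p) : Prop :=
  (∀ u ∈ Q.V ×ˢ Q.P₃, ‖Q.I u - Q.y₀‖ ≤ K.MI) ∧
  (∀ i, ∀ z ∈ Q.PP₃, |Q.D i z| ≤ K.MD) ∧
  (∀ i l, ∀ z ∈ Q.PP₃, |Q.C i l z| ≤ K.MC) ∧
  (∀ i l, ∀ z ∈ Q.PP₃, K.mCl l ≤ Q.C i l z ∧ Q.C i l z ≤ K.MCl l) ∧
  (∀ i l, ∀ x ∈ Q.P₁, ∀ y ∈ Q.P₂, ∀ w ∈ Q.P₃, ∀ x' ∈ Q.P₁, ∀ y' ∈ Q.P₂, ∀ w' ∈ Q.P₃,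
    |Q.C i l (x, y, w) - Q.C i l (x', y', w')| ≤
      K.LC * (l1 (x.1 - x'.1) + |x.2 - x'.2| + l1 (y - y') + l1 (w - w'))) ∧
  (∀ i, ∀ x ∈ Q.P₁, ∀ y ∈ Q.P₂, ∀ w ∈ Q.P₃, ∀ x' ∈ Q.P₁, ∀ y' ∈ Q.P₂, ∀ w' ∈ Q.P₃,
    |Q.D i (x, y, w) - Q.D i (x', y', w')| ≤
      K.LD * (l1 (x.1 - x'.1) + |x.2 - x'.2| + l1 (y - y') + l1 (w - w'))) ∧
  (∀ i, ∀ v ∈ Q.V, ∀ w ∈ Q.P₃, ∀ v' ∈ Q.V, ∀ w' ∈ Q.P₃,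
    |Q.I (v, w) i - Q.I (v', w') i| ≤ K.LI * (l1 (v - v') + l1 (w - w')))

end System

namespace Constants

variable {p : ℕ} (K : Constants p)

/-- `c₁ = n L_D - (m - 1) L_C`. -/
def c₁ (n : ℕ) : ℝ := n * K.LD - p * K.LC

/-- The Lipschitz constant along the hyperplanes `x_m = const`. -/
def Lf (n : ℕ) (α : ℝ) : ℝ :=
  (K.LI + 1 / n) * Real.exp (K.c₁ n * α) /
    (1 - n * p * K.LC * α * (K.LI + 1 / n) * Real.exp (step (K.c₁ n) * K.c₁ n * α)) - 1 / n

/-- The total Lipschitz constant. -/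
def LUfs (n : ℕ) (α : ℝ) : ℝ := max (K.Lf n α) (K.MD + K.Lf n α * p * K.MC)

end Constants

namespace System

variable {p n d : ℕ} (Q : System p n d)

/-- The height `α > 0` is admissible: the locality condition
`α < 1 / (exp (θ(c₁) c₁ α) n (m-1) L_C (L_I + 1/n))`, the condition `α ≤ min {a, (b - M_I) / M_D}`
(both without division, so that a vanishing denominator means no restriction), and the
condition that the intervals in the definition of the standard domains are nonempty. -/
def Admissible (K : Constants p) (α : ℝ) : Prop :=
  0 < α ∧
  α * (Real.exp (step (K.c₁ n) * K.c₁ n * α) * n * p * K.LC * (K.LI + 1 / n)) < 1 ∧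
  α ≤ Q.a ∧ α * K.MD ≤ Q.b - K.MI ∧
  ∀ l, -Q.abar + K.MCl l * α ≤ Q.abar + K.mCl l * α

/-- The standard domain above the initial hyperplane. -/
def Splus (K : Constants p) (α : ℝ) : Set (Pt p) :=
  {x | x ∈ Q.P₁ ∧ 0 ≤ x.2 - Q.x₀.2 ∧ x.2 - Q.x₀.2 ≤ α ∧
    ∀ l, -Q.abar + K.MCl l * (x.2 - Q.x₀.2) ≤ x.1 l - Q.x₀.1 l ∧
      x.1 l - Q.x₀.1 l ≤ Q.abar + K.mCl l * (x.2 - Q.x₀.2)}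

/-- The standard domain below the initial hyperplane. -/
def Sminus (K : Constants p) (α : ℝ) : Set (Pt p) :=
  {x | x ∈ Q.P₁ ∧ -α ≤ x.2 - Q.x₀.2 ∧ x.2 - Q.x₀.2 ≤ 0 ∧
    ∀ l, -Q.abar + K.mCl l * (x.2 - Q.x₀.2) ≤ x.1 l - Q.x₀.1 l ∧
      x.1 l - Q.x₀.1 l ≤ Q.abar + K.MCl l * (x.2 - Q.x₀.2)}

/-- The standard domain `S = S₊ ∪ S₋`. -/
def S (K : Constants p) (α : ℝ) : Set (Pt p) := Q.Splus K α ∪ Q.Sminus K α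

/-- On `B × P₃`, every component of `f` is Lipschitz for the 1-norm, with constant `L_f` along the
hyperplanes `x_m = const` (jointly in `w`), and with constant `L_Ufs` jointly in `(x, w)`. -/
def HasLipschitzConstants (K : Constants p) (α : ℝ) (B : Set (Pt p))
    (f : Pt p × (Fin d → ℝ) → Fin n → ℝ) : Prop :=
  (∀ i, ∀ x ∈ B, ∀ w ∈ Q.P₃, ∀ x' ∈ B, ∀ w' ∈ Q.P₃, x.2 = x'.2 →
    |f (x, w) i - f (x', w') i| ≤ K.Lf n α * (l1 (x.1 - x'.1) + l1 (w - w'))) ∧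
  (∀ i, ∀ x ∈ B, ∀ w ∈ Q.P₃, ∀ x' ∈ B, ∀ w' ∈ Q.P₃,
    |f (x, w) i - f (x', w') i| ≤
      K.LUfs n α * (l1 (x.1 - x'.1) + |x.2 - x'.2| + l1 (w - w')))

end System

end ParamPDE

end

namespace ParamPDE

open Filter

/-! ### General estimates -/

/-! The `i`-th equation says that `y_i` has derivative `D_i` along curves with velocity `(C_i, 1)`.
Each component has its own characteristics, and all of them are coupled through `y`. When the
parameters `w` are treated as space variables of velocity zero, the equations become a transport
system in the time `x_m - x₀_m` (`Transport`). A Lipschitz function solves it if and only if it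
takes the initial values at time `0` and is a fixed point of integration along its own
characteristics (`Transport.Integrates`). The proof works with this integral form.

The standard domain is convex, and moving a point towards the initial hyperplane with any velocity
in the box given by `m_Cl` and `M_Cl` keeps it in the domain. Hence characteristics run back to `V`
without leaving the domain (`System.back_mem_S`, `mem_of_back`, `exists_isChar`).

For existence, let `L(t)` be the Lipschitz constant allowed on the slice at time `t`. Integration
along characteristics preserves these bounds if `u = 1 + n L` solves the Riccati equation `u' = (c₁
+ Λ u) u` with `Λ = (m - 1) L_C`. Its explicit solution exists up to `α` by the locality condition,
and its bound is `L_f` (`exists_isLipschitzProfile`, `Transport.InClass.exists_integrates`). In the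
supremum norm weighted by `exp (-lam |t|)`, with `lam` large, integration contracts by the factor
`1/2`. This gives existence and uniqueness of the integral solution
(`Transport.exists_contraction`).

A Lipschitz solution satisfies the equations only where it is differentiable, and a characteristic
may miss such points altogether. Rademacher's theorem and Fubini's theorem, together with continuity
of velocities and rates, show that the derivative in the characteristic direction exists with the
right value at every interior point (`hasDerivAt_line`). The fundamental theorem of calculus along
characteristics then yields the integral form (`Transport.integrates_of_hasDerivAt`). The converse
is `Transport.Integrates.eq_rate`. Uniqueness for a single `w` is joint uniqueness for the system
with `d = 0` (`System.freeze`).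

For `C^1` data, the defect between difference quotients at two scales obeys an integral inequality
that halves any bound up to an arbitrarily small error. So the quotients are uniform
(`Transport.uniformDQ_of_integrates`), and a Lipschitz function on a convex body with this property
is `C^1` up to the boundary (`UniformDQ.contDiffOn`). For larger `r`, the solution and its spatial
derivatives solve a transport system with the same characteristics and with data of one class less
(`Transport.fderivWithin_eq_integral`, `Transport.prolong`), and induction applies
(`Transport.contDiffOn_of_integrates`). -/

theorem le_of_self_improving {σ : Type*} {x ω : σ → ℝ} {C c₀ : ℝ}
    (hω : ∀ s, 0 ≤ ω s) (hC : 0 ≤ C) (hc₀ : 0 ≤ c₀) (h₀ : ∀ s, x s ≤ c₀ * ω s)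
    (h : ∀ c, 0 ≤ c → (∀ s, x s ≤ c * ω s) → ∀ s, x s ≤ (C + c / 2) * ω s) :
    ∀ s, x s ≤ 2 * C * ω s := by
  -- `2 * C` is the fixed point of `c ↦ C + c / 2`, and the excess over it halves at each
  -- application. The a priori bound `c₀` only starts the iteration.
  have key : ∀ k : ℕ, ∀ s, x s ≤ (2 * C + c₀ * (1 / 2) ^ k) * ω s := by
    intro k
    induction k with
    | zero =>
      intro s
      have := h₀ s
      have := mul_nonneg hC (hω s)
      simp only [pow_zero, mul_one]
      nlinarith
    | succ k ih =>
      intro s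
      have := h _ (by positivity) ih s
      refine this.trans (le_of_eq ?_)
      ring
  intro s
  have hlim : Tendsto (fun k : ℕ => (2 * C + c₀ * (1 / 2 : ℝ) ^ k) * ω s) atTop
      (𝓝 ((2 * C + c₀ * 0) * ω s)) :=
    ((tendsto_const_nhds.add (tendsto_const_nhds.mul
      (tendsto_pow_atTop_nhds_zero_of_lt_one (by norm_num) (by norm_num)))).mul
        tendsto_const_nhds)
  have := ge_of_tendsto' hlim (fun k => key k s)
  simpa using this

/-- The contraction principle for a relation, in a weighted supremum norm. -/
theorem exists_fixedPoint {σ V : Type*} [NormedAddCommGroup V] [CompleteSpace V] (S : Set σ)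
    (P : (σ → V) → Prop) (rel : (σ → V) → (σ → V) → Prop) (ω : σ → ℝ)
    (step : ∀ f, P f → ∃ f', P f' ∧ rel f f')
    (contr : ∀ f g f' g' c, P f → P g → rel f f' → rel g g' → 0 ≤ c →
      (∀ s ∈ S, ‖f s - g s‖ ≤ c * ω s) → ∀ s ∈ S, ‖f' s - g' s‖ ≤ c / 2 * ω s)
    (f₀ : σ → V) (hf₀ : P f₀)
    (bound : ∀ f', P f' → ∃ c, 0 ≤ c ∧ ∀ s ∈ S, ‖f₀ s - f' s‖ ≤ c * ω s)
    (closed : ∀ (F : ℕ → σ → V) f, (∀ k, P (F k)) →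
      (∀ s ∈ S, Tendsto (fun k => F k s) atTop (𝓝 (f s))) → P f) :
    ∃ f f', P f ∧ rel f f' ∧ ∀ s ∈ S, f' s = f s := by
  classical
  -- Values off `S` are not controlled by the relation, so a map is chosen and its fixed point is an
  -- identity on `S` only.
  choose! nxt hP hrel using step
  let F : ℕ → σ → V := fun k => nxt^[k] f₀
  have hFs : ∀ k, F (k + 1) = nxt (F k) := fun k => Function.iterate_succ_apply' nxt k f₀
  have hFP : ∀ k, P (F k) := by
    intro k
    induction k with
    | zero => exact hf₀
    | succ k ih => rw [hFs]; exact hP _ ih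
  obtain ⟨c, hc, hb⟩ := bound (F 1) (hFP 1)
  have hstep : ∀ k : ℕ, ∀ s ∈ S, ‖F k s - F (k + 1) s‖ ≤ c * (1 / 2) ^ k * ω s := by
    intro k
    induction k with
    | zero =>
      intro s hs
      rw [pow_zero, mul_one]
      exact hb s hs
    | succ k ih =>
      intro s hs
      have := contr (F k) (F (k + 1)) (F (k + 1)) (F (k + 1 + 1)) _ (hFP _) (hFP _)
        (by rw [hFs]; exact hrel _ (hFP _)) (by rw [hFs (k + 1)]; exact hrel _ (hFP _))
        (by positivity) ih s hs
      refine this.trans (le_of_eq ?_)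
      ring
  have hstep' : ∀ s ∈ S, ∀ k : ℕ, dist (F k s) (F (k + 1) s) ≤ (c * ω s) * (1 / 2) ^ k := by
    intro s hs k
    rw [dist_eq_norm]
    refine (hstep k s hs).trans (le_of_eq ?_)
    ring
  have hconv : ∀ s, ∃ v, s ∈ S → Tendsto (fun k => F k s) atTop (𝓝 v) := by
    intro s
    by_cases hs : s ∈ S
    · obtain ⟨v, hv⟩ := cauchySeq_tendsto_of_complete
        (cauchySeq_of_le_geometric (1 / 2) (c * ω s) (by norm_num) (hstep' s hs))
      exact ⟨v, fun _ => hv⟩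
    · exact ⟨0, fun h => absurd h hs⟩
  choose f hf using hconv
  have hPf : P f := closed F f hFP (fun s hs => hf s hs)
  refine ⟨f, nxt f, hPf, hrel f hPf, fun s hs => ?_⟩
  have hlim1 : Tendsto (fun k => F (k + 1) s) atTop (𝓝 (f s)) :=
    (hf s hs).comp (tendsto_add_atTop_nat 1)
  have hdist : ∀ k, ∀ s ∈ S, ‖F k s - f s‖ ≤ (2 * c * (1 / 2) ^ k) * ω s := by
    intro k s hs
    have := dist_le_of_le_geometric_of_tendsto (1 / 2) (c * ω s) (by norm_num) (hstep' s hs)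
      (hf s hs) k
    rw [dist_eq_norm] at this
    refine this.trans (le_of_eq ?_)
    ring
  -- The contraction property, applied to `F k` and to the limit `f`, shows that the iterates also
  -- converge to `nxt f`; no continuity of `nxt` is needed.
  have hlim2 : Tendsto (fun k => F (k + 1) s) atTop (𝓝 (nxt f s)) := by
    rw [tendsto_iff_norm_sub_tendsto_zero]
    have hz : Tendsto (fun k : ℕ => (2 * c * (1 / 2 : ℝ) ^ k) / 2 * ω s) atTop (𝓝 0) := by
      have h1 := tendsto_pow_atTop_nhds_zero_of_lt_one (r := (1 / 2 : ℝ)) (by norm_num)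
        (by norm_num)
      simpa using ((h1.const_mul (2 * c)).div_const 2).mul_const (ω s)
    refine squeeze_zero (fun k => norm_nonneg _) (fun k => ?_) hz
    exact contr (F k) f (F (k + 1)) (nxt f) _ (hFP k) hPf (by rw [hFs]; exact hrel _ (hFP k))
      (hrel f hPf) (by positivity) (hdist k) s hs
  exact tendsto_nhds_unique hlim2 hlim1

/-! ### Integrals over the upper part of the unit interval. -/

theorem intervalIntegrable_of_continuousOn_unit {V : Type*} [NormedAddCommGroup V]
    {f : ℝ → V} (hf : ContinuousOn f (Icc 0 1)) {a b : ℝ} (ha : a ∈ Icc (0 : ℝ) 1)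
    (hb : b ∈ Icc (0 : ℝ) 1) : IntervalIntegrable f MeasureTheory.volume a b :=
  (hf.mono (uIcc_subset_Icc ha hb)).intervalIntegrable

theorem integral_sub_unit {V : Type*} [NormedAddCommGroup V] [NormedSpace ℝ V]
    {f g : ℝ → V} (hf : ContinuousOn f (Icc 0 1)) (hg : ContinuousOn g (Icc 0 1)) {a b : ℝ}
    (ha : a ∈ Icc (0 : ℝ) 1) (hb : b ∈ Icc (0 : ℝ) 1) :
    ∫ τ in a..b, (f τ - g τ) = (∫ τ in a..b, f τ) - ∫ τ in a..b, g τ :=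
  intervalIntegral.integral_sub (intervalIntegrable_of_continuousOn_unit hf ha hb)
    (intervalIntegrable_of_continuousOn_unit hg ha hb)

theorem integral_add_unit {V : Type*} [NormedAddCommGroup V] [NormedSpace ℝ V]
    {f g : ℝ → V} (hf : ContinuousOn f (Icc 0 1)) (hg : ContinuousOn g (Icc 0 1)) {a b : ℝ}
    (ha : a ∈ Icc (0 : ℝ) 1) (hb : b ∈ Icc (0 : ℝ) 1) :
    ∫ τ in a..b, (f τ + g τ) = (∫ τ in a..b, f τ) + ∫ τ in a..b, g τ :=
  intervalIntegral.integral_add (intervalIntegrable_of_continuousOn_unit hf ha hb)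
    (intervalIntegrable_of_continuousOn_unit hg ha hb)

theorem one_mem_unit : (1 : ℝ) ∈ Icc (0 : ℝ) 1 := ⟨zero_le_one, le_rfl⟩

theorem zero_mem_unit : (0 : ℝ) ∈ Icc (0 : ℝ) 1 := ⟨le_rfl, zero_le_one⟩

theorem mem_unit_of_mem {θ τ : ℝ} (hθ : θ ∈ Icc (0 : ℝ) 1) (h : τ ∈ Icc θ 1) :
    τ ∈ Icc (0 : ℝ) 1 := ⟨hθ.1.trans h.1, h.2⟩

/-- Monotonicity of the integral over the upper part of the unit interval. -/
theorem norm_integral_le_integral_unit {V : Type*} [NormedAddCommGroup V] [NormedSpace ℝ V]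
    {f : ℝ → V} {g : ℝ → ℝ} {θ : ℝ} (hθ : θ ∈ Icc (0 : ℝ) 1)
    (hg : ContinuousOn g (Icc 0 1))
    (h : ∀ τ ∈ Icc θ 1, ‖f τ‖ ≤ g τ) : ‖∫ τ in θ..1, f τ‖ ≤ ∫ τ in θ..1, g τ :=
  intervalIntegral.norm_integral_le_of_norm_le hθ.2
    (Filter.Eventually.of_forall fun τ hτ => h τ ⟨hτ.1.le, hτ.2⟩)
    (intervalIntegrable_of_continuousOn_unit hg hθ one_mem_unit)

theorem integral_mono_unit {f g : ℝ → ℝ} {θ : ℝ} (hθ : θ ∈ Icc (0 : ℝ) 1)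
    (hf : ContinuousOn f (Icc 0 1)) (hg : ContinuousOn g (Icc 0 1))
    (h : ∀ τ ∈ Icc θ 1, f τ ≤ g τ) : ∫ τ in θ..1, f τ ≤ ∫ τ in θ..1, g τ :=
  intervalIntegral.integral_mono_on hθ.2
    (intervalIntegrable_of_continuousOn_unit hf hθ one_mem_unit)
    (intervalIntegrable_of_continuousOn_unit hg hθ one_mem_unit) h

/-! ### Exponential weights and the backward Gronwall inequality. -/

theorem integral_exp_one_sub (A μ θ : ℝ) :
    ∫ τ in θ..1, μ * (A * Real.exp (μ * (1 - τ))) = A * Real.exp (μ * (1 - θ)) - A := by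
  have hd : ∀ τ ∈ uIcc θ 1, HasDerivAt (fun τ => -(A * Real.exp (μ * (1 - τ))))
      (μ * (A * Real.exp (μ * (1 - τ)))) τ := fun τ _ => by
    have h1 : HasDerivAt (fun τ : ℝ => μ * (1 - τ)) (μ * -1) τ :=
      ((hasDerivAt_id τ).const_sub 1).const_mul μ
    exact (h1.exp.const_mul A).fun_neg.congr_deriv (by ring)
  have hi : IntervalIntegrable (fun τ => μ * (A * Real.exp (μ * (1 - τ))))
      MeasureTheory.volume θ 1 := by
    apply Continuous.intervalIntegrable; fun_prop
  rw [intervalIntegral.integral_eq_sub_of_hasDerivAt hd hi]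
  simp
  ring

theorem mul_integral_exp_le (μ θ : ℝ) :
    μ * ∫ τ in θ..1, Real.exp (μ * (1 - τ)) ≤ Real.exp (μ * (1 - θ)) := by
  have h := integral_exp_one_sub 1 μ θ
  simp only [one_mul] at h
  rw [← intervalIntegral.integral_const_mul, h]
  linarith

theorem mul_integral_exp_le' (μ θ : ℝ) :
    μ * ∫ τ in θ..1, Real.exp (μ * τ) ≤ Real.exp μ := by
  have hd : ∀ τ ∈ uIcc θ 1, HasDerivAt (fun τ => Real.exp (μ * τ))
      (μ * Real.exp (μ * τ)) τ := fun τ _ => by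
    have h1 : HasDerivAt (fun τ : ℝ => μ * τ) (μ * 1) τ := (hasDerivAt_id τ).const_mul μ
    exact h1.exp.congr_deriv (by ring)
  have hi : IntervalIntegrable (fun τ => μ * Real.exp (μ * τ)) MeasureTheory.volume θ 1 := by
    apply Continuous.intervalIntegrable; fun_prop
  rw [← intervalIntegral.integral_const_mul,
    intervalIntegral.integral_eq_sub_of_hasDerivAt hd hi, mul_one]
  have := Real.exp_pos (μ * θ)
  linarith

/-- Measured against the weight `exp (μ (1 - θ))` with `μ > 2 B`, the right-hand side is at most
half of any bound of `w`. Starting from the bound by compactness, self-improvement with `C = 0`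
leaves nothing. -/
theorem le_zero_of_le_integral {w : ℝ → ℝ} (hw : ContinuousOn w (Icc 0 1)) {B : ℝ} (hB : 0 ≤ B)
    (h : ∀ θ ∈ Icc (0 : ℝ) 1, w θ ≤ B * ∫ τ in θ..1, max (w τ) 0) :
    ∀ θ ∈ Icc (0 : ℝ) 1, w θ ≤ 0 := by
  obtain ⟨R, hR⟩ := isCompact_Icc.exists_bound_of_continuousOn hw
  have hmax : ContinuousOn (fun τ => max (w τ) 0) (Icc 0 1) := hw.sup continuousOn_const
  set μ := 2 * B + 1
  have key := le_of_self_improving (σ := Icc (0 : ℝ) 1) (x := fun θ => w θ)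
    (ω := fun θ => Real.exp (μ * (1 - θ))) (C := 0) (c₀ := |R|)
    (fun s => (Real.exp_pos _).le) le_rfl (abs_nonneg R) (by
      rintro ⟨θ, hθ⟩
      have h1 : w θ ≤ |R| := (le_abs_self _).trans ((hR θ hθ).trans (le_abs_self _))
      have h2 : 1 ≤ Real.exp (μ * (1 - θ)) :=
        Real.one_le_exp (mul_nonneg (by positivity) (by linarith [hθ.2]))
      have := abs_nonneg R
      show w θ ≤ |R| * Real.exp (μ * (1 - θ))
      nlinarith) (by
      rintro c hc hle ⟨θ, hθ⟩
      show w θ ≤ (0 + c / 2) * Real.exp (μ * (1 - θ))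
      have h1 : ∫ τ in θ..1, max (w τ) 0 ≤ ∫ τ in θ..1, c * Real.exp (μ * (1 - τ)) :=
        integral_mono_unit hθ hmax (Continuous.continuousOn (by fun_prop)) (fun τ hτ =>
          max_le (hle ⟨τ, mem_unit_of_mem hθ hτ⟩) (by positivity))
      rw [intervalIntegral.integral_const_mul] at h1
      have h2 := mul_integral_exp_le μ θ
      have h0 : 0 ≤ ∫ τ in θ..1, Real.exp (μ * (1 - τ)) :=
        intervalIntegral.integral_nonneg hθ.2 (fun _ _ => (Real.exp_pos _).le)
      set J := ∫ τ in θ..1, Real.exp (μ * (1 - τ))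
      have h3 : B * J ≤ Real.exp (μ * (1 - θ)) / 2 := by
        simp only [μ] at h2 ⊢
        nlinarith
      calc w θ ≤ B * (c * J) := (h θ hθ).trans (mul_le_mul_of_nonneg_left h1 hB)
        _ = c * (B * J) := by ring
        _ ≤ c * (Real.exp (μ * (1 - θ)) / 2) := mul_le_mul_of_nonneg_left h3 hc
        _ = _ := by ring)
  intro θ hθ
  simpa using key ⟨θ, hθ⟩

/-- Backward integral Gronwall inequality: a subsolution lies below a supersolution. -/
theorem gronwall_backward {δ e k : ℝ → ℝ} {A : ℝ} (hδ : ContinuousOn δ (Icc 0 1))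
    (he : ContinuousOn e (Icc 0 1)) (hk : ContinuousOn k (Icc 0 1))
    (hk0 : ∀ τ ∈ Icc (0 : ℝ) 1, 0 ≤ k τ)
    (h₁ : ∀ θ ∈ Icc (0 : ℝ) 1, δ θ ≤ A + ∫ τ in θ..1, k τ * δ τ)
    (h₂ : ∀ θ ∈ Icc (0 : ℝ) 1, A + ∫ τ in θ..1, k τ * e τ ≤ e θ) :
    ∀ θ ∈ Icc (0 : ℝ) 1, δ θ ≤ e θ := by
  obtain ⟨B, hB⟩ := isCompact_Icc.exists_bound_of_continuousOn hk
  have hB0 : 0 ≤ B := (norm_nonneg _).trans (hB 0 zero_mem_unit)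
  have hw : ContinuousOn (fun τ => δ τ - e τ) (Icc 0 1) := hδ.sub he
  have hmax : ContinuousOn (fun τ => max (δ τ - e τ) 0) (Icc 0 1) := hw.sup continuousOn_const
  -- The difference `w = δ - e` satisfies `w θ ≤ ∫ k w`, and `k w ≤ B max (w, 0)` because `0 ≤ k ≤
  -- B`.
  have key := le_zero_of_le_integral hw hB0 (fun θ hθ => by
    have h3 : (∫ τ in θ..1, k τ * δ τ) - ∫ τ in θ..1, k τ * e τ =
        ∫ τ in θ..1, k τ * (δ τ - e τ) := by
      rw [← integral_sub_unit (f := fun τ => k τ * δ τ) (g := fun τ => k τ * e τ)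
        (hk.mul hδ) (hk.mul he) hθ one_mem_unit]
      simp only [mul_sub]
    have h4 : ∫ τ in θ..1, k τ * (δ τ - e τ) ≤ ∫ τ in θ..1, B * max (δ τ - e τ) 0 := by
      refine integral_mono_unit hθ (hk.mul hw) (continuousOn_const.mul hmax) (fun τ hτ => ?_)
      have hτ' := mem_unit_of_mem hθ hτ
      have h5 := hB τ hτ'
      rw [Real.norm_of_nonneg (hk0 τ hτ')] at h5
      calc k τ * (δ τ - e τ) ≤ k τ * max (δ τ - e τ) 0 :=
            mul_le_mul_of_nonneg_left (le_max_left _ _) (hk0 τ hτ')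
        _ ≤ _ := mul_le_mul_of_nonneg_right h5 (le_max_right _ _)
    rw [intervalIntegral.integral_const_mul] at h4
    have := h₁ θ hθ
    have := h₂ θ hθ
    linarith)
  intro θ hθ
  have := key θ hθ
  linarith

theorem gronwall_backward_const {δ : ℝ → ℝ} {A B : ℝ} (hδ : ContinuousOn δ (Icc 0 1))
    (hB : 0 ≤ B) (h : ∀ θ ∈ Icc (0 : ℝ) 1, δ θ ≤ A + B * ∫ τ in θ..1, δ τ) :
    ∀ θ ∈ Icc (0 : ℝ) 1, δ θ ≤ A * Real.exp (B * (1 - θ)) := by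
  refine gronwall_backward (k := fun _ => B) (A := A) hδ (Continuous.continuousOn (by fun_prop))
    continuousOn_const (fun _ _ => hB) (fun θ hθ => ?_) (fun θ hθ => ?_)
  · rw [intervalIntegral.integral_const_mul]
    exact h θ hθ
  · rw [integral_exp_one_sub]
    simp

end ParamPDE

namespace ParamPDE

set_option linter.unusedSectionVars false

open Filter

/-! ### Characteristic curves, parametrised over the unit interval -/

section Characteristics

variable {E : Type*} [NormedAddCommGroup E] [NormedSpace ℝ E]

/-- `K ⊆ ℝ × E` is closed, and a point of `K` may be moved towards time `0` with any velocity
of the closed convex set `vel`, without leaving `K`. -/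
structure BackwardInvariant (K : Set (ℝ × E)) (vel : Set E) : Prop where
  closed : IsClosed K
  vel_convex : Convex ℝ vel
  vel_closed : IsClosed vel
  back : ∀ z ∈ K, ∀ v ∈ vel, ∀ θ ∈ Icc (0 : ℝ) 1, (θ * z.1, z.2 - ((1 - θ) * z.1) • v) ∈ K

/-- A bounded Lipschitz velocity field on `K` with values in `vel`. -/
structure IsField (K : Set (ℝ × E)) (vel : Set E) (c : ℝ × E → E) (H M : ℝ) : Prop where
  mem : ∀ z ∈ K, c z ∈ vel
  nonneg : 0 ≤ H
  lip : ∀ z ∈ K, ∀ z' ∈ K, ‖c z - c z'‖ ≤ H * (|z.1 - z'.1| + ‖z.2 - z'.2‖)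
  bound : ∀ z ∈ K, ‖c z‖ ≤ M

/-- `η θ` is the position at time `θ t` of the characteristic curve of `c` through `z = (t, x)`. -/
structure IsChar (K : Set (ℝ × E)) (c : ℝ × E → E) (z : ℝ × E) (η : ℝ → E) : Prop where
  cont : ContinuousOn η (Icc 0 1)
  mem : ∀ θ ∈ Icc (0 : ℝ) 1, (θ * z.1, η θ) ∈ K
  -- Since the parameter is the fraction of the time `z.1`, curves through points of different times
  -- can be compared at equal parameters, and both signs of time are treated at once.
  eq : ∀ θ ∈ Icc (0 : ℝ) 1, η θ = z.2 - z.1 • ∫ τ in θ..1, c (τ * z.1, η τ)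

variable {K : Set (ℝ × E)} {vel : Set E} {c c' : ℝ × E → E} {H M : ℝ} {z z' : ℝ × E} {η η' : ℝ → E}

theorem continuousOn_of_lip {V : Type*} [NormedAddCommGroup V] {g : ℝ × E → V}
    (h : ∀ z ∈ K, ∀ z' ∈ K, ‖g z - g z'‖ ≤ H * (|z.1 - z'.1| + ‖z.2 - z'.2‖)) :
    ContinuousOn g K := by
  intro z hz
  rw [ContinuousWithinAt, tendsto_iff_norm_sub_tendsto_zero]
  refine squeeze_zero' (Eventually.of_forall fun _ => norm_nonneg _)
    (eventually_nhdsWithin_of_forall fun z' hz' => h z' hz' z hz) ?_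
  have : ContinuousAt (fun z' : ℝ × E => H * (|z'.1 - z.1| + ‖z'.2 - z.2‖)) z := by fun_prop
  have h2 := this.tendsto
  simp only [sub_self, abs_zero, norm_zero, add_zero, mul_zero] at h2
  exact h2.mono_left nhdsWithin_le_nhds

theorem IsField.continuousOn (hc : IsField K vel c H M) : ContinuousOn c K :=
  continuousOn_of_lip hc.lip

/-- A continuous function on `K` along a continuous curve. -/
theorem continuousOn_along {V : Type*} [TopologicalSpace V] {g : ℝ × E → V}
    (hg : ContinuousOn g K) (hη : ContinuousOn η (Icc 0 1)) {t : ℝ}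
    (hmem : ∀ θ ∈ Icc (0 : ℝ) 1, (θ * t, η θ) ∈ K) :
    ContinuousOn (fun τ => g (τ * t, η τ)) (Icc 0 1) :=
  hg.comp ((continuousOn_id.mul continuousOn_const).prodMk hη) hmem

/-- The displacement equals `(1 - θ) z.1` times the mean of the velocities over `[θ, 1]`. This mean
lies in `vel`, a closed convex set, so a curve with varying velocity ends where a straight move with
one admissible velocity ends. -/
theorem mem_of_back [CompleteSpace E] (hvel : Convex ℝ vel) (hvel' : IsClosed vel)
    {S : Set (ℝ × E)} (hz : z ∈ S)
    (hback : ∀ v ∈ vel, ∀ θ ∈ Icc (0 : ℝ) 1, (θ * z.1, z.2 - ((1 - θ) * z.1) • v) ∈ S) {g : ℝ → E} (hg : ContinuousOn g (Icc 0 1))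
    (hv : ∀ τ ∈ Icc (0 : ℝ) 1, g τ ∈ vel) {θ : ℝ} (hθ : θ ∈ Icc (0 : ℝ) 1) :
    (θ * z.1, z.2 - z.1 • ∫ τ in θ..1, g τ) ∈ S := by
  rcases eq_or_lt_of_le hθ.2 with h | h
  · subst h
    simpa using hz
  · have hint : IntervalIntegrable g MeasureTheory.volume θ 1 :=
      intervalIntegrable_of_continuousOn_unit hg hθ one_mem_unit
    have havg : (⨍ τ in Ioc θ 1, g τ) ∈ vel := by
      refine hvel.set_average_mem hvel' ?_ ?_ ?_ ?_
      · simp [h]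
      · simp
      · refine (MeasureTheory.ae_restrict_iff' measurableSet_Ioc).2
          (Eventually.of_forall fun τ hτ => hv τ ⟨hθ.1.trans hτ.1.le, hτ.2⟩)
      · exact (intervalIntegrable_iff_integrableOn_Ioc_of_le hθ.2).1 hint
    have h2 := hback _ havg θ hθ
    have h3 : ((1 - θ) * z.1) • (⨍ τ in Ioc θ 1, g τ) = z.1 • ∫ τ in θ..1, g τ := by
      rw [intervalIntegral.integral_of_le hθ.2, MeasureTheory.setAverage_eq, smul_smul]
      congr 1
      have : (1 - θ) ≠ 0 := by linarith
      simp only [MeasureTheory.measureReal_def, Real.volume_Ioc]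
      rw [ENNReal.toReal_ofReal (by linarith)]
      field_simp
    rwa [h3] at h2

theorem norm_integral_sub_le_unit {V : Type*} [NormedAddCommGroup V] [NormedSpace ℝ V]
    {g : ℝ → V} (hg : ContinuousOn g (Icc 0 1)) {M : ℝ} (hM : ∀ τ ∈ Icc (0 : ℝ) 1, ‖g τ‖ ≤ M)
    {θ θ' : ℝ} (hθ : θ ∈ Icc (0 : ℝ) 1) (hθ' : θ' ∈ Icc (0 : ℝ) 1) :
    ‖(∫ τ in θ..1, g τ) - ∫ τ in θ'..1, g τ‖ ≤ M * |θ - θ'| := by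
  have h := intervalIntegral.integral_add_adjacent_intervals
    (intervalIntegrable_of_continuousOn_unit hg hθ hθ')
    (intervalIntegrable_of_continuousOn_unit hg hθ' one_mem_unit)
  rw [← h, add_sub_cancel_right, abs_sub_comm]
  refine intervalIntegral.norm_integral_le_of_norm_le_const fun τ hτ => hM τ ?_
  exact uIcc_subset_Icc hθ hθ' (uIoc_subset_uIcc hτ)

/-- Picard iteration among curves that stay in `K` and are Lipschitz with constant `|t| M`, started
at the straight line with velocity `c z`. Backward invariance keeps every iterate in `K`, so the
solution reaches time `0`. The weight `exp (μ (1 - θ))` with `μ > 2 |t| H` gives the contraction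
factor `1/2` without any smallness of `t`. -/
theorem exists_isChar [CompleteSpace E] (hK : BackwardInvariant K vel) (hc : IsField K vel c H M)
    (hz : z ∈ K) : ∃ η, IsChar K c z η := by
  have hH := hc.nonneg
  have hM : 0 ≤ M := (norm_nonneg _).trans (hc.bound z hz)
  set t := z.1 with ht
  set μ := 2 * (|t| * H) + 1
  have hcont : ∀ η : ℝ → E, (∀ θ ∈ Icc (0 : ℝ) 1, ∀ θ' ∈ Icc (0 : ℝ) 1,
      ‖η θ - η θ'‖ ≤ |t| * M * |θ - θ'|) → ContinuousOn η (Icc 0 1) := by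
    intro η h
    refine LipschitzOnWith.continuousOn (K := Real.toNNReal (|t| * M)) ?_
    refine LipschitzOnWith.of_dist_le_mul fun θ hθ θ' hθ' => ?_
    rw [dist_eq_norm, Real.dist_eq, Real.coe_toNNReal _ (by positivity)]
    exact h θ hθ θ' hθ'
  have key := exists_fixedPoint (V := E) (Icc (0 : ℝ) 1)
    (fun η => (∀ θ ∈ Icc (0 : ℝ) 1, ∀ θ' ∈ Icc (0 : ℝ) 1, ‖η θ - η θ'‖ ≤ |t| * M * |θ - θ'|) ∧
      ∀ θ ∈ Icc (0 : ℝ) 1, (θ * t, η θ) ∈ K)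
    (fun η η' => ∀ θ ∈ Icc (0 : ℝ) 1, η' θ = z.2 - t • ∫ τ in θ..1, c (τ * t, η τ))
    (fun θ => Real.exp (μ * (1 - θ))) ?_ ?_ (fun θ => z.2 - ((1 - θ) * t) • c z) ?_ ?_ ?_
  · obtain ⟨η, η', hP, hrel, heq⟩ := key
    refine ⟨η, hcont η hP.1, hP.2, fun θ hθ => ?_⟩
    rw [← heq θ hθ]
    exact hrel θ hθ
  · rintro η ⟨h1, h2⟩
    have hg := continuousOn_along hc.continuousOn (hcont η h1) h2
    refine ⟨fun θ => z.2 - t • ∫ τ in θ..1, c (τ * t, η τ), ⟨?_, ?_⟩, fun _ _ => rfl⟩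
    · intro θ hθ θ' hθ'
      have h3 := norm_integral_sub_le_unit hg (fun τ hτ => hc.bound _ (h2 τ hτ)) hθ hθ'
      rw [sub_sub_sub_cancel_left, ← smul_sub, norm_smul, norm_sub_rev, Real.norm_eq_abs, mul_assoc]
      exact mul_le_mul_of_nonneg_left h3 (abs_nonneg t)
    · intro θ hθ
      exact mem_of_back hK.vel_convex hK.vel_closed hz (hK.back z hz) hg (fun τ hτ => hc.mem _ (h2 τ hτ)) hθ
  · intro f g f' g' a hf hg hff hgg ha hle θ hθ
    have hfc := continuousOn_along hc.continuousOn (hcont f hf.1) hf.2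
    have hgc := continuousOn_along hc.continuousOn (hcont g hg.1) hg.2
    rw [hff θ hθ, hgg θ hθ, sub_sub_sub_cancel_left, ← smul_sub, norm_smul, Real.norm_eq_abs,
      ← integral_sub_unit hgc hfc hθ one_mem_unit]
    have h1 : ‖∫ τ in θ..1, (c (τ * t, g τ) - c (τ * t, f τ))‖ ≤
        ∫ τ in θ..1, H * a * Real.exp (μ * (1 - τ)) := by
      refine norm_integral_le_integral_unit hθ (by fun_prop) (fun τ hτ => ?_)
      have hτ' := mem_unit_of_mem hθ hτ
      have h2 := hc.lip _ (hg.2 τ hτ') _ (hf.2 τ hτ')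
      have h3 := hle τ hτ'
      rw [norm_sub_rev] at h3
      simp only [sub_self, abs_zero, zero_add] at h2
      refine h2.trans ?_
      rw [mul_assoc]
      exact mul_le_mul_of_nonneg_left h3 hH
    rw [intervalIntegral.integral_const_mul] at h1
    have h2 := mul_integral_exp_le μ θ
    have h0 : 0 ≤ ∫ τ in θ..1, Real.exp (μ * (1 - τ)) :=
      intervalIntegral.integral_nonneg hθ.2 (fun _ _ => (Real.exp_pos _).le)
    set J := ∫ τ in θ..1, Real.exp (μ * (1 - τ))
    have h3 : |t| * H * J ≤ Real.exp (μ * (1 - θ)) / 2 := by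
      simp only [μ] at h2 ⊢
      nlinarith
    calc |t| * _ ≤ |t| * (H * a * J) := mul_le_mul_of_nonneg_left h1 (abs_nonneg t)
      _ = a * (|t| * H * J) := by ring
      _ ≤ a * (Real.exp (μ * (1 - θ)) / 2) := mul_le_mul_of_nonneg_left h3 ha
      _ = _ := by ring
  · refine ⟨fun θ hθ θ' hθ' => ?_, fun θ hθ => hK.back z hz _ (hc.mem z hz) θ hθ⟩
    rw [sub_sub_sub_cancel_left, ← sub_smul, norm_smul, Real.norm_eq_abs,
      show (1 - θ') * t - (1 - θ) * t = t * (θ - θ') by ring, abs_mul]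
    have := hc.bound z hz
    have := mul_le_mul_of_nonneg_left this (mul_nonneg (abs_nonneg t) (abs_nonneg (θ - θ')))
    linarith
  · rintro g ⟨hg, -⟩
    have h0 : ContinuousOn (fun θ : ℝ => z.2 - ((1 - θ) * t) • c z - g θ) (Icc 0 1) :=
      ContinuousOn.sub (by fun_prop) (hcont g hg)
    obtain ⟨R, hR⟩ := isCompact_Icc.exists_bound_of_continuousOn h0
    refine ⟨R, (norm_nonneg _).trans (hR 0 zero_mem_unit), fun θ hθ => (hR θ hθ).trans ?_⟩
    have h1 := (norm_nonneg _).trans (hR 0 zero_mem_unit)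
    have h2 : 1 ≤ Real.exp (μ * (1 - θ)) :=
      Real.one_le_exp (mul_nonneg (by positivity) (by linarith [hθ.2]))
    nlinarith
  · intro F f hF hlim
    refine ⟨fun θ hθ θ' hθ' => ?_, fun θ hθ => ?_⟩
    · exact le_of_tendsto' ((hlim θ hθ).sub (hlim θ' hθ')).norm (fun k => (hF k).1 θ hθ θ' hθ')
    · exact hK.closed.mem_of_tendsto (tendsto_const_nhds.prodMk_nhds (hlim θ hθ))
        (Eventually.of_forall fun k => (hF k).2 θ hθ)

/-- Comparison of two characteristic curves with the same parametrisation of time. -/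
theorem IsChar.norm_sub_le (h : IsChar K c z η) (h' : IsChar K c' z' η')
    (hc : ContinuousOn c K) (hc' : ContinuousOn c' K) {B : ℝ → ℝ} (hB : ContinuousOn B (Icc 0 1))
    (hle : ∀ τ ∈ Icc (0 : ℝ) 1,
      ‖z.1 • c (τ * z.1, η τ) - z'.1 • c' (τ * z'.1, η' τ)‖ ≤ B τ) {θ : ℝ}
    (hθ : θ ∈ Icc (0 : ℝ) 1) :
    ‖η θ - η' θ‖ ≤ ‖z.2 - z'.2‖ + ∫ τ in θ..1, B τ := by
  have hi : ContinuousOn (fun τ => z.1 • c (τ * z.1, η τ)) (Icc 0 1) :=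
    (continuousOn_along hc h.cont h.mem).const_smul z.1
  have hi' : ContinuousOn (fun τ => z'.1 • c' (τ * z'.1, η' τ)) (Icc 0 1) :=
    (continuousOn_along hc' h'.cont h'.mem).const_smul z'.1
  have h1 : η θ - η' θ = (z.2 - z'.2) -
      ∫ τ in θ..1, (z.1 • c (τ * z.1, η τ) - z'.1 • c' (τ * z'.1, η' τ)) := by
    rw [integral_sub_unit hi hi' hθ one_mem_unit]
    rw [intervalIntegral.integral_smul,
      intervalIntegral.integral_smul, h.eq θ hθ, h'.eq θ hθ]
    abel
  rw [h1]
  refine (_root_.norm_sub_le _ _).trans (add_le_add le_rfl ?_)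
  exact norm_integral_le_integral_unit hθ hB (fun τ hτ => hle τ (mem_unit_of_mem hθ hτ))

theorem IsChar.unique (hc : IsField K vel c H M) (h : IsChar K c z η) (h' : IsChar K c z η') :
    EqOn η η' (Icc 0 1) := by
  have hδ : ContinuousOn (fun θ => ‖η θ - η' θ‖) (Icc 0 1) := (h.cont.sub h'.cont).norm
  have key := gronwall_backward_const (A := 0) (B := |z.1| * H) hδ
    (mul_nonneg (abs_nonneg _) hc.nonneg) (fun θ hθ => by
      have := h.norm_sub_le h' hc.continuousOn hc.continuousOn
        (B := fun τ => |z.1| * H * ‖η τ - η' τ‖) (continuousOn_const.mul hδ) (fun τ hτ => by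
          rw [← smul_sub, norm_smul, Real.norm_eq_abs, mul_assoc]
          have := hc.lip _ (h.mem τ hτ) _ (h'.mem τ hτ)
          simp only [sub_self, abs_zero, zero_add] at this
          exact mul_le_mul_of_nonneg_left this (abs_nonneg _)) hθ
      rwa [sub_self, norm_zero, intervalIntegral.integral_const_mul] at this)
  intro θ hθ
  have := key θ hθ
  rw [zero_mul] at this
  exact sub_eq_zero.1 (norm_le_zero_iff.1 this)

/-- The part of a characteristic curve before one of its points is a characteristic curve. -/
theorem IsChar.restrict (hc : ContinuousOn c K) (h : IsChar K c z η) {σ : ℝ}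
    (hσ : σ ∈ Icc (0 : ℝ) 1) :
    IsChar K c (σ * z.1, η σ) (fun θ => η (σ * θ)) := by
  have hmaps : ∀ θ ∈ Icc (0 : ℝ) 1, σ * θ ∈ Icc (0 : ℝ) 1 := fun θ hθ =>
    ⟨mul_nonneg hσ.1 hθ.1, mul_le_one₀ hσ.2 hθ.1 hθ.2⟩
  refine ⟨h.cont.comp (by fun_prop) hmaps, fun θ hθ => ?_, fun θ hθ => ?_⟩
  · have := h.mem _ (hmaps θ hθ)
    rwa [show σ * θ * z.1 = θ * (σ * z.1) by ring] at this
  · have hg := continuousOn_along hc h.cont h.mem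
    have h1 := h.eq _ (hmaps θ hθ)
    have h2 := h.eq _ hσ
    have h3 := intervalIntegral.integral_add_adjacent_intervals
      (intervalIntegrable_of_continuousOn_unit hg (hmaps θ hθ) hσ)
      (intervalIntegrable_of_continuousOn_unit hg hσ one_mem_unit)
    have h4 := intervalIntegral.smul_integral_comp_mul_left (a := θ) (b := 1)
      (fun τ => c (τ * z.1, η τ)) σ
    rw [mul_one] at h4
    show η (σ * θ) = η σ - (σ * z.1) • ∫ τ in θ..1, c (τ * (σ * z.1), η (σ * τ))
    rw [h1, ← h3, ← h4, smul_add, mul_comm σ z.1, mul_smul]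
    have h5 : z.2 = η σ + z.1 • ∫ τ in σ..1, c (τ * z.1, η τ) := by rw [h2]; abel
    rw [h5]
    simp only [mul_comm, mul_left_comm]
    abel

theorem integral_restrict {g : ℝ × E → ℝ} (hg : ContinuousOn g K) (h : IsChar K c z η) {σ : ℝ}
    (hσ : σ ∈ Icc (0 : ℝ) 1) :
    z.1 * (∫ τ in (0 : ℝ)..1, g (τ * z.1, η τ)) =
      σ * z.1 * (∫ τ in (0 : ℝ)..1, g (τ * (σ * z.1), η (σ * τ))) +
        z.1 * ∫ τ in σ..1, g (τ * z.1, η τ) := by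
  have hg := continuousOn_along hg h.cont h.mem
  have h3 := intervalIntegral.integral_add_adjacent_intervals
    (intervalIntegrable_of_continuousOn_unit hg zero_mem_unit hσ)
    (intervalIntegrable_of_continuousOn_unit hg hσ one_mem_unit)
  have h4 := intervalIntegral.mul_integral_comp_mul_left (a := 0) (b := 1)
    (f := fun τ => g (τ * z.1, η τ)) (c := σ)
  rw [mul_one, mul_zero] at h4
  rw [← h3, ← h4, mul_add]
  congr 1
  rw [← mul_assoc, mul_comm z.1 σ]
  simp only [mul_comm, mul_left_comm]

/-- Characteristic curves depend on the end point in a Lipschitz way. -/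
theorem IsChar.norm_sub_le_of_lip {α : ℝ} (hα : ∀ z ∈ K, |z.1| ≤ α)
    (hc : IsField K vel c H M) (hz : z ∈ K) (hz' : z' ∈ K)
    (h : IsChar K c z η) (h' : IsChar K c z' η') {θ : ℝ} (hθ : θ ∈ Icc (0 : ℝ) 1) :
    ‖η θ - η' θ‖ ≤ (1 + M + α * H) * (|z.1 - z'.1| + ‖z.2 - z'.2‖) * Real.exp (α * H) := by
  have hH := hc.nonneg
  have hM : 0 ≤ M := (norm_nonneg _).trans (hc.bound z hz)
  have hα0 : 0 ≤ α := (abs_nonneg _).trans (hα z hz)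
  have hδ : ContinuousOn (fun θ => ‖η θ - η' θ‖) (Icc 0 1) := (h.cont.sub h'.cont).norm
  set A := (1 + M + α * H) * (|z.1 - z'.1| + ‖z.2 - z'.2‖) with hA
  have hA0 : 0 ≤ A := by positivity
  have key := gronwall_backward_const (A := A) (B := α * H) hδ
    (mul_nonneg hα0 hH) (fun θ hθ => by
      have := h.norm_sub_le h' hc.continuousOn hc.continuousOn
        (B := fun τ => (M + α * H) * |z.1 - z'.1| + α * H * ‖η τ - η' τ‖)
        (continuousOn_const.add (continuousOn_const.mul hδ)) (fun τ hτ => by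
          -- The time difference enters twice: through the factor in front of the velocity, at the
          -- cost `M`, and through the time argument of `c`, at the cost `α H`.
          have h1 : z.1 • c (τ * z.1, η τ) - z'.1 • c (τ * z'.1, η' τ) =
              (z.1 - z'.1) • c (τ * z.1, η τ) +
                z'.1 • (c (τ * z.1, η τ) - c (τ * z'.1, η' τ)) := by
            rw [sub_smul, smul_sub]; abel
          rw [h1]
          refine (norm_add_le _ _).trans ?_
          rw [norm_smul, norm_smul, Real.norm_eq_abs, Real.norm_eq_abs]
          have h2 := hc.lip _ (h.mem τ hτ) _ (h'.mem τ hτ)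
          have h3 := hc.bound _ (h.mem τ hτ)
          have h4 : |τ * z.1 - τ * z'.1| ≤ |z.1 - z'.1| := by
            rw [← mul_sub, abs_mul, abs_of_nonneg hτ.1]
            exact mul_le_of_le_one_left (abs_nonneg _) hτ.2
          have h5 : |z.1 - z'.1| * ‖c (τ * z.1, η τ)‖ ≤ |z.1 - z'.1| * M :=
            mul_le_mul_of_nonneg_left h3 (abs_nonneg _)
          have h6 : ‖c (τ * z.1, η τ) - c (τ * z'.1, η' τ)‖ ≤
              H * (|z.1 - z'.1| + ‖η τ - η' τ‖) :=
            h2.trans (mul_le_mul_of_nonneg_left (add_le_add_left h4 _) hH)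
          have h7 := mul_le_mul (hα z' hz') h6 (norm_nonneg _) hα0
          linarith) hθ
      refine this.trans ?_
      rw [integral_add_unit continuousOn_const (g := fun τ => α * H * ‖η τ - η' τ‖)
        (continuousOn_const.mul hδ) hθ one_mem_unit, intervalIntegral.integral_const, smul_eq_mul,
        intervalIntegral.integral_const_mul]
      have h8 : (1 - θ) * ((M + α * H) * |z.1 - z'.1|) ≤ (M + α * H) * |z.1 - z'.1| :=
        mul_le_of_le_one_left (by positivity) (by linarith [hθ.1])
      have h9 : 0 ≤ (M + α * H) * ‖z.2 - z'.2‖ := by positivity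
      have h10 := abs_nonneg (z.1 - z'.1)
      simp only [hA]
      linarith)
  refine (key θ hθ).trans (mul_le_mul_of_nonneg_left (Real.exp_le_exp.2 ?_) hA0)
  exact mul_le_of_le_one_right (mul_nonneg hα0 hH) (by linarith [hθ.1])

theorem IsChar.norm_sub_le_time (hc : IsField K vel c H M) (h : IsChar K c z η) {θ θ' : ℝ}
    (hθ : θ ∈ Icc (0 : ℝ) 1) (hθ' : θ' ∈ Icc (0 : ℝ) 1) :
    ‖η θ - η θ'‖ ≤ |z.1| * (M * |θ - θ'|) := by
  have hg := continuousOn_along hc.continuousOn h.cont h.mem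
  have h3 := norm_integral_sub_le_unit hg (fun τ hτ => hc.bound _ (h.mem τ hτ)) hθ hθ'
  rw [h.eq θ hθ, h.eq θ' hθ', sub_sub_sub_cancel_left, ← smul_sub, norm_smul, norm_sub_rev,
    Real.norm_eq_abs]
  exact mul_le_mul_of_nonneg_left h3 (abs_nonneg _)

theorem IsChar.apply_one (h : IsChar K c z η) : η 1 = z.2 := by
  simpa using h.eq 1 one_mem_unit

end Characteristics

end ParamPDE

namespace ParamPDE

set_option linter.unusedSectionVars false

open Filter

/-! ### The Riccati comparison function -/

/-- Comparison functions for the Lipschitz constants along hyperplanes `t = const`: `L` bounds the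
solution, and `e s t` bounds the expansion of characteristics between the times `t` and `s`. -/
structure IsLipschitzProfile (n : ℕ) (α Λ LD LI Lf : ℝ) (L : ℝ → ℝ) (e : ℝ → ℝ → ℝ) : Prop where
  continuous_L : ContinuousOn L (Icc 0 α)
  continuous_e : ∀ t ∈ Icc 0 α, ContinuousOn (fun s => e s t) (Icc 0 α)
  nonneg : ∀ t ∈ Icc 0 α, 0 ≤ L t
  le : ∀ t ∈ Icc 0 α, L t ≤ Lf
  expansion : ∀ t ∈ Icc 0 α, ∀ θ ∈ Icc (0 : ℝ) 1,
    1 + t * ∫ τ in θ..1, Λ * (1 + n * L (τ * t)) * e (τ * t) t ≤ e (θ * t) t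
  growth : ∀ t ∈ Icc 0 α,
    LI * e 0 t + t * ∫ τ in (0 : ℝ)..1, LD * (1 + n * L (τ * t)) * e (τ * t) t ≤ L t

/-- If the expansion and growth conditions hold with equality, then `u = 1 + n L` satisfies `u' =
(c₁ + Λ u) u` and `∂ₛ e = -Λ u(s) e`. The solution is `u = u₀ exp (c₁ t) / den t` with `den t = 1 -
Λ u₀ ∫₀ᵗ exp (c₁ s) ds` and `e s t = den s / den t`. The smallness condition keeps `den` positive up
to `α`. -/
theorem exists_isLipschitzProfile {n : ℕ} (hn : 1 ≤ n) {α Λ LD LI : ℝ} (hα : 0 ≤ α) (hΛ : 0 ≤ Λ)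
    (hLD : 0 ≤ LD) (hLI : 0 ≤ LI) {c₁ m : ℝ} (hc₁ : c₁ = n * LD - Λ)
    (hm : m = α * Real.exp (step c₁ * c₁ * α)) (hsmall : Λ * (1 + n * LI) * m < 1) :
    ∃ L e, IsLipschitzProfile n α Λ LD LI
      (((1 + n * LI) * Real.exp (c₁ * α) / (1 - Λ * (1 + n * LI) * m) - 1) / n) L e := by
  have hn0 : (0 : ℝ) < n := by exact_mod_cast hn
  set u₀ : ℝ := 1 + n * LI with hu₀
  have hu₀1 : 1 ≤ u₀ := by simp only [hu₀]; nlinarith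
  -- Keeping the integral instead of `(exp (c₁ t) - 1) / c₁` avoids a special case `c₁ = 0`. The
  -- step function in `m` bounds the integrand on `[0, α]` for either sign of `c₁`.
  set ψ : ℝ → ℝ := fun t => ∫ s in (0 : ℝ)..t, Real.exp (c₁ * s) with hψ
  have hψd : ∀ t, HasDerivAt ψ (Real.exp (c₁ * t)) t := fun t =>
    intervalIntegral.integral_hasDerivAt_right
      (Continuous.intervalIntegrable (by fun_prop) _ _)
      (Continuous.stronglyMeasurableAtFilter (by fun_prop) _ _)
      (Continuous.continuousAt (by fun_prop))
  have hψc : Continuous ψ := continuous_iff_continuousAt.2 fun t => (hψd t).continuousAt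
  have hψ0 : ψ 0 = 0 := by simp [hψ]
  have hψmono : Monotone ψ := monotone_of_hasDerivAt_nonneg hψd (fun t => (Real.exp_pos _).le)
  have hexp : ∀ t, Real.exp (c₁ * t) = 1 + c₁ * ψ t := by
    intro t
    have h1 : ∀ s ∈ uIcc 0 t, HasDerivAt (fun s => Real.exp (c₁ * s))
        (c₁ * Real.exp (c₁ * s)) s := fun s _ => by
      have h1 : HasDerivAt (fun τ : ℝ => c₁ * τ) (c₁ * 1) s := (hasDerivAt_id s).const_mul c₁
      exact h1.exp.congr_deriv (by ring)
    have h2 : IntervalIntegrable (fun τ => c₁ * Real.exp (c₁ * τ)) MeasureTheory.volume 0 t := by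
      apply Continuous.intervalIntegrable; fun_prop
    have h3 := intervalIntegral.integral_eq_sub_of_hasDerivAt h1 h2
    rw [intervalIntegral.integral_const_mul] at h3
    simp only [mul_zero, Real.exp_zero] at h3
    simp only [hψ]
    linarith
  have hψm : ψ α ≤ m := by
    have h1 : ‖ψ α‖ ≤ Real.exp (step c₁ * c₁ * α) * |α - 0| := by
      refine intervalIntegral.norm_integral_le_of_norm_le_const fun s hs => ?_
      rw [uIoc_of_le hα] at hs
      rw [Real.norm_of_nonneg (Real.exp_pos _).le, Real.exp_le_exp]
      unfold step
      split_ifs with h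
      · rw [one_mul]; exact mul_le_mul_of_nonneg_left hs.2 h
      · rw [zero_mul, zero_mul]
        exact mul_nonpos_of_nonpos_of_nonneg (not_le.1 h).le hs.1.le
    rw [sub_zero, abs_of_nonneg hα] at h1
    rw [hm, mul_comm]
    exact (le_abs_self _).trans h1
  have hb0 : 0 ≤ Λ * u₀ := by positivity
  set den : ℝ → ℝ := fun t => 1 - Λ * u₀ * ψ t with hden
  have hdenc : Continuous den := by simp only [hden]; fun_prop
  have hdenα : ∀ t ≤ α, 1 - Λ * u₀ * m ≤ den t := by
    intro t ht
    have := mul_le_mul_of_nonneg_left ((hψmono ht).trans hψm) hb0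
    simp only [hden]; linarith
  have hdenpos : ∀ t ≤ α, 0 < den t := fun t ht => by have := hdenα t ht; linarith
  have hdend : ∀ t, HasDerivAt den (-(Λ * u₀ * Real.exp (c₁ * t))) t := fun t =>
    ((hψd t).const_mul (Λ * u₀)).const_sub 1
  set u : ℝ → ℝ := fun t => u₀ * Real.exp (c₁ * t) / den t with hu
  -- Although `c₁` may be negative, `u` is increasing: after cross-multiplication and `exp (c₁ t) =
  -- 1 + c₁ ψ t`, the comparison of `u s` and `u t` reduces to the sign of this sum.
  have hkey : 0 ≤ c₁ + Λ * u₀ := by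
    have : c₁ + Λ * u₀ = n * (LD + Λ * LI) := by rw [hc₁, hu₀]; ring
    rw [this]; positivity
  have humono : ∀ s t, s ≤ t → t ≤ α → u s ≤ u t := by
    intro s t hst ht
    simp only [hu]
    rw [div_le_div_iff₀ (hdenpos s (hst.trans ht)) (hdenpos t ht), hexp s, hexp t]
    have h1 := mul_nonneg hkey (sub_nonneg.2 (hψmono hst))
    have h2 : 0 ≤ u₀ * ((c₁ + Λ * u₀) * (ψ t - ψ s)) := mul_nonneg (by linarith) h1
    simp only [hden]
    nlinarith
  have hu0 : u 0 = u₀ := by simp [hu, hden, hψ0]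
  -- Expansion and growth hold with equality here. An estimate is needed only for `L ≤ L_f`, where
  -- `u t` is replaced by `u α` and `ψ α` by `m`.
  refine ⟨fun t => (u t - 1) / n, fun s t => den s / den t, ?_, ?_, ?_, ?_, ?_, ?_⟩
  · refine ContinuousOn.div_const (ContinuousOn.sub ?_ continuousOn_const) _
    exact ContinuousOn.div (by fun_prop) hdenc.continuousOn (fun t ht => (hdenpos t ht.2).ne')
  · intro t _
    exact (hdenc.div_const _).continuousOn
  · intro t ht
    have := humono 0 t ht.1 ht.2
    rw [hu0] at this
    have : 0 ≤ u t - 1 := by linarith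
    positivity
  · intro t ht
    refine div_le_div_of_nonneg_right (sub_le_sub_right ((humono t α ht.2 le_rfl).trans ?_) 1) hn0.le
    have := hdenα α le_rfl
    exact div_le_div_of_nonneg_left (by positivity) (by linarith) this
  · intro t ht θ hθ
    have h1 : ∀ τ ∈ uIcc θ 1, HasDerivAt (fun τ => -(den (τ * t) / den t))
        (t * (Λ * u₀ * Real.exp (c₁ * (τ * t)) / den t)) τ := by
      intro τ _
      have h2 : HasDerivAt (fun τ : ℝ => τ * t) (1 * t) τ := (hasDerivAt_id τ).mul_const t
      have h3 := (((hdend (τ * t)).comp τ h2).div_const (den t)).fun_neg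
      exact h3.congr_deriv (by ring)
    have h2 : ∫ τ in θ..1, Λ * (1 + n * ((u (τ * t) - 1) / n)) * (den (τ * t) / den t) =
        ∫ τ in θ..1, Λ * u₀ * Real.exp (c₁ * (τ * t)) / den t := by
      refine intervalIntegral.integral_congr fun τ hτ => ?_
      rw [uIcc_of_le hθ.2] at hτ
      have h4 : τ * t ≤ α := (mul_le_of_le_one_left ht.1 hτ.2).trans ht.2
      have h5 := (hdenpos _ h4).ne'
      simp only [hu]
      field_simp
      ring
    rw [h2, ← intervalIntegral.integral_const_mul,
      intervalIntegral.integral_eq_sub_of_hasDerivAt h1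
        (by apply Continuous.intervalIntegrable; fun_prop), one_mul,
      div_self (hdenpos t ht.2).ne']
    linarith
  · intro t ht
    have h1 : ∀ τ ∈ uIcc (0 : ℝ) 1, HasDerivAt
        (fun τ => (u₀ * Real.exp (c₁ * (τ * t)) - den (τ * t)) / n / den t)
        (t * (LD * u₀ * Real.exp (c₁ * (τ * t)) / den t)) τ := by
      intro τ _
      have h2 : HasDerivAt (fun τ : ℝ => τ * t) (1 * t) τ := (hasDerivAt_id τ).mul_const t
      have h3 : HasDerivAt (fun s : ℝ => c₁ * s) (c₁ * 1) (τ * t) :=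
        (hasDerivAt_id _).const_mul c₁
      have h4 := ((((h3.exp.const_mul u₀).sub (hdend (τ * t))).comp τ h2).div_const
        (n : ℝ)).div_const (den t)
      refine h4.congr_deriv ?_
      have h5 : c₁ + Λ = n * LD := by rw [hc₁]; ring
      have : u₀ * (Real.exp (c₁ * (τ * t)) * (c₁ * 1)) - -(Λ * u₀ * Real.exp (c₁ * (τ * t))) =
        n * (LD * u₀ * Real.exp (c₁ * (τ * t))) := by
        linear_combination (u₀ * Real.exp (c₁ * (τ * t))) * h5
      rw [this]
      field_simp
    have h2 : ∫ τ in (0 : ℝ)..1, LD * (1 + n * ((u (τ * t) - 1) / n)) * (den (τ * t) / den t) =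
        ∫ τ in (0 : ℝ)..1, LD * u₀ * Real.exp (c₁ * (τ * t)) / den t := by
      refine intervalIntegral.integral_congr fun τ hτ => ?_
      rw [uIcc_of_le zero_le_one] at hτ
      have h4 : τ * t ≤ α := (mul_le_of_le_one_left ht.1 hτ.2).trans ht.2
      have h5 := (hdenpos _ h4).ne'
      simp only [hu]
      field_simp
      ring
    rw [h2, ← intervalIntegral.integral_const_mul,
      intervalIntegral.integral_eq_sub_of_hasDerivAt h1
        (by apply Continuous.intervalIntegrable; fun_prop)]
    have h6 := (hdenpos t ht.2).ne'
    have h7 : den 0 = 1 := by simp [hden, hψ0]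
    simp only [one_mul, zero_mul, mul_zero, Real.exp_zero, mul_one, h7, hu]
    refine le_of_eq ?_
    rw [hu₀]
    field_simp
    ring

end ParamPDE

namespace ParamPDE

set_option linter.unusedSectionVars false

open Filter

/-! ### Transport systems and their integral solutions -/

/-- A first order system in which the `i`-th component is transported with the velocity `c i`,
and grows with the rate `D i`, on a domain `K` of space-time points. -/
structure Transport (E : Type*) (n : ℕ) where
  K : Set (ℝ × E)
  vel : Set E
  y₀ : Fin n → ℝ
  b : ℝ
  c : Fin n → (ℝ × E) × (Fin n → ℝ) → E
  D : Fin n → (ℝ × E) × (Fin n → ℝ) → ℝ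
  I : E → Fin n → ℝ

namespace Transport

variable {E : Type*} [NormedAddCommGroup E] [NormedSpace ℝ E] {n : ℕ} (T : Transport E n)

/-- The box of values. -/
def val : Set (Fin n → ℝ) := Metric.closedBall T.y₀ T.b

/-- Bounds and Lipschitz constants of a transport system. -/
structure Bounds (α Λ LD LI Mc MD : ℝ) : Prop where
  inv : BackwardInvariant T.K T.vel
  time : ∀ z ∈ T.K, |z.1| ≤ α
  α_nonneg : 0 ≤ α
  Λ_nonneg : 0 ≤ Λ
  LD_nonneg : 0 ≤ LD
  LI_nonneg : 0 ≤ LI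
  Mc_nonneg : 0 ≤ Mc
  MD_nonneg : 0 ≤ MD
  b_nonneg : 0 ≤ T.b
  c_mem : ∀ i, ∀ z ∈ T.K, ∀ y ∈ T.val, T.c i (z, y) ∈ T.vel
  c_bound : ∀ i, ∀ z ∈ T.K, ∀ y ∈ T.val, ‖T.c i (z, y)‖ ≤ Mc
  D_bound : ∀ i, ∀ z ∈ T.K, ∀ y ∈ T.val, |T.D i (z, y)| ≤ MD
  c_lip : ∀ i, ∀ z ∈ T.K, ∀ y ∈ T.val, ∀ z' ∈ T.K, ∀ y' ∈ T.val,
    ‖T.c i (z, y) - T.c i (z', y')‖ ≤ Λ * (|z.1 - z'.1| + ‖z.2 - z'.2‖ + l1 (y - y'))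
  D_lip : ∀ i, ∀ z ∈ T.K, ∀ y ∈ T.val, ∀ z' ∈ T.K, ∀ y' ∈ T.val,
    |T.D i (z, y) - T.D i (z', y')| ≤ LD * (|z.1 - z'.1| + ‖z.2 - z'.2‖ + l1 (y - y'))
  I_lip : ∀ i, ∀ x, ((0 : ℝ), x) ∈ T.K → ∀ x', ((0 : ℝ), x') ∈ T.K →
    |T.I x i - T.I x' i| ≤ LI * ‖x - x'‖

/-- The `i`-th velocity field of a function. -/
def field (f : ℝ × E → Fin n → ℝ) (i : Fin n) (z : ℝ × E) : E := T.c i (z, f z)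

/-- The `i`-th rate of a function. -/
def rate (f : ℝ × E → Fin n → ℝ) (i : Fin n) (z : ℝ × E) : ℝ := T.D i (z, f z)

/-- `f` maps `K` into the box of values, and is Lipschitz with constant `N`. -/
structure Admits (f : ℝ × E → Fin n → ℝ) (N : ℝ) : Prop where
  maps : ∀ z ∈ T.K, f z ∈ T.val
  nonneg : 0 ≤ N
  lip : ∀ i, ∀ z ∈ T.K, ∀ z' ∈ T.K, |f z i - f z' i| ≤ N * (|z.1 - z'.1| + ‖z.2 - z'.2‖)

/-- `f'` arises from `f` by integration along the characteristics of `f`. -/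
def Integrates (f f' : ℝ × E → Fin n → ℝ) : Prop :=
  ∀ i, ∀ z ∈ T.K, ∀ η, IsChar T.K (T.field f i) z η →
    f' z i = T.I (η 0) i + z.1 * ∫ τ in (0 : ℝ)..1, T.rate f i (τ * z.1, η τ)

variable {T} {α Λ LD LI Mc MD N : ℝ} {f g f' g' : ℝ × E → Fin n → ℝ}

theorem l1_sub_le {y y' : Fin n → ℝ} {r : ℝ} (h : ∀ j, |y j - y' j| ≤ r) :
    l1 (y - y') ≤ n * r := by
  unfold l1
  refine (Finset.sum_le_sum fun j _ => h j).trans ?_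
  simp

theorem Admits.isField (h : T.Bounds α Λ LD LI Mc MD) (hf : T.Admits f N) (i : Fin n) :
    IsField T.K T.vel (T.field f i) (Λ * (1 + n * N)) Mc := by
  have hN := hf.nonneg
  have hΛ := h.Λ_nonneg
  refine ⟨fun z hz => h.c_mem i z hz _ (hf.maps z hz), by positivity, fun z hz z' hz' => ?_,
    fun z hz => h.c_bound i z hz _ (hf.maps z hz)⟩
  refine (h.c_lip i z hz _ (hf.maps z hz) z' hz' _ (hf.maps z' hz')).trans ?_
  rw [mul_assoc]
  refine mul_le_mul_of_nonneg_left ?_ hΛ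
  have := l1_sub_le (fun j => hf.lip j z hz z' hz')
  linarith

theorem Admits.rate_lip (h : T.Bounds α Λ LD LI Mc MD) (hf : T.Admits f N) (i : Fin n) :
    ∀ z ∈ T.K, ∀ z' ∈ T.K, ‖T.rate f i z - T.rate f i z'‖ ≤
      LD * (1 + n * N) * (|z.1 - z'.1| + ‖z.2 - z'.2‖) := by
  intro z hz z' hz'
  refine (h.D_lip i z hz _ (hf.maps z hz) z' hz' _ (hf.maps z' hz')).trans ?_
  rw [mul_assoc]
  refine mul_le_mul_of_nonneg_left ?_ h.LD_nonneg
  have := l1_sub_le (fun j => hf.lip j z hz z' hz')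
  linarith

theorem Admits.continuousOn_rate (h : T.Bounds α Λ LD LI Mc MD) (hf : T.Admits f N)
    (i : Fin n) : ContinuousOn (T.rate f i) T.K :=
  continuousOn_of_lip (hf.rate_lip h i)

theorem Admits.continuousOn (hf : T.Admits f N) : ContinuousOn f T.K :=
  continuousOn_pi.2 fun i => continuousOn_of_lip (H := N) (hf.lip i)

theorem Bounds.zero_mem {i : Fin n} {z : ℝ × E} {η : ℝ → E} (hη : IsChar T.K (T.field f i) z η) : ((0 : ℝ), η 0) ∈ T.K := by
  simpa using hη.mem 0 zero_mem_unit

theorem mul_integral_exp_abs_le {lam : ℝ} (t : ℝ) (hlam : 0 < lam) {θ : ℝ}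
    (hθ : θ ∈ Icc (0 : ℝ) 1) :
    |t| * ∫ τ in θ..1, Real.exp (lam * |τ * t|) ≤ Real.exp (lam * |t|) / lam := by
  have h1 : ∫ τ in θ..1, Real.exp (lam * |τ * t|) = ∫ τ in θ..1, Real.exp (lam * |t| * τ) := by
    refine intervalIntegral.integral_congr fun τ hτ => ?_
    rw [uIcc_of_le hθ.2] at hτ
    simp only [abs_mul, abs_of_nonneg (hθ.1.trans hτ.1)]
    ring_nf
  rw [h1, le_div_iff₀ hlam]
  have := mul_integral_exp_le' (lam * |t|) θ
  linarith

theorem continuous_exp_abs (lam t : ℝ) : Continuous fun τ : ℝ => Real.exp (lam * |τ * t|) := by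
  fun_prop

/-- Integration along characteristics is a contraction, in a suitable weighted norm. -/
theorem exists_contraction (h : T.Bounds α Λ LD LI Mc MD) (hN : 0 ≤ N) : ∃ lam : ℝ, 0 < lam ∧
    ∀ f g f' g' : ℝ × E → Fin n → ℝ, ∀ a : ℝ, T.Admits f N → T.Admits g N →
      (∀ i, ∀ z ∈ T.K, ∃ η, IsChar T.K (T.field f i) z η) →
      (∀ i, ∀ z ∈ T.K, ∃ η, IsChar T.K (T.field g i) z η) →
      T.Integrates f f' → T.Integrates g g' → 0 ≤ a →
      (∀ z ∈ T.K, ‖f z - g z‖ ≤ a * Real.exp (lam * |z.1|)) →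
      ∀ z ∈ T.K, ‖f' z - g' z‖ ≤ a / 2 * Real.exp (lam * |z.1|) := by
  have hα := h.α_nonneg
  have hΛ := h.Λ_nonneg
  have hLD := h.LD_nonneg
  have hLI := h.LI_nonneg
  set H := Λ * (1 + n * N) with hH
  have hH0 : 0 ≤ H := by positivity
  -- `Q` collects the effects of a change of `f`: the displaced characteristic alters the initial
  -- value and the rates, and the changed values enter `D` directly. Integrating the weight over
  -- time produces `1 / lam`, so `lam > 2 Q` gives the factor `1/2`.
  set Q := (LI + α * (LD * (1 + n * N))) * (Λ * n * Real.exp (α * H)) + LD * n with hQ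
  have hQ0 : 0 ≤ Q := by positivity
  refine ⟨2 * Q + 1, by positivity, fun f g f' g' a hf hg hfη hgη hff hgg ha hle z hz => ?_⟩
  set lam := 2 * Q + 1 with hlam
  have hlam0 : 0 < lam := by positivity
  set t := z.1 with ht
  set X := a * Real.exp (lam * |t|) / lam with hX
  have hX0 : 0 ≤ X := by positivity
  rw [pi_norm_le_iff_of_nonneg (by positivity)]
  intro i
  obtain ⟨η, hη⟩ := hfη i z hz
  obtain ⟨ζ, hζ⟩ := hgη i z hz
  have hδ : ContinuousOn (fun θ => ‖η θ - ζ θ‖) (Icc 0 1) := (hη.cont.sub hζ.cont).norm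
  have hval : ∀ τ ∈ Icc (0 : ℝ) 1, l1 (f (τ * t, η τ) - g (τ * t, ζ τ)) ≤
      n * (N * ‖η τ - ζ τ‖ + a * Real.exp (lam * |τ * t|)) := by
    intro τ hτ
    refine l1_sub_le fun j => ?_
    have h1 := hf.lip j _ (hη.mem τ hτ) _ (hζ.mem τ hτ)
    have h2 := (norm_le_pi_norm _ j).trans (hle _ (hζ.mem τ hτ))
    simp only [sub_self, abs_zero, zero_add, Pi.sub_apply, Real.norm_eq_abs] at h1 h2
    calc |f (τ * t, η τ) j - g (τ * t, ζ τ) j|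
        ≤ |f (τ * t, η τ) j - f (τ * t, ζ τ) j| + |f (τ * t, ζ τ) j - g (τ * t, ζ τ) j| :=
          abs_sub_le _ _ _
      _ ≤ _ := add_le_add h1 h2
  have hce := (continuous_exp_abs lam t).continuousOn (s := Icc 0 1)
  -- Both characteristics end at the same point `z`, so they separate only because the two velocity
  -- fields differ.
  have hδle := gronwall_backward_const (A := Λ * n * X) (B := α * H) hδ
    (mul_nonneg hα hH0) (fun θ hθ => by
      have h1 := hη.norm_sub_le hζ (hf.isField h i).continuousOn (hg.isField h i).continuousOn
        (B := fun τ => α * H * ‖η τ - ζ τ‖ + |t| * (Λ * n * a) * Real.exp (lam * |τ * t|))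
        ((continuousOn_const.mul hδ).add (continuousOn_const.mul hce)) (fun τ hτ => by
          rw [← smul_sub, norm_smul, Real.norm_eq_abs]
          have h2 := h.c_lip i _ (hη.mem τ hτ) _ (hf.maps _ (hη.mem τ hτ))
            _ (hζ.mem τ hτ) _ (hg.maps _ (hζ.mem τ hτ))
          simp only [sub_self, abs_zero, zero_add] at h2
          have h3 : ‖T.field f i (τ * t, η τ) - T.field g i (τ * t, ζ τ)‖ ≤
              H * ‖η τ - ζ τ‖ + Λ * n * a * Real.exp (lam * |τ * t|) := by
            refine h2.trans ?_
            have := mul_le_mul_of_nonneg_left (hval τ hτ) hΛ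
            simp only [hH]
            linarith
          have h4 := mul_le_mul_of_nonneg_left h3 (abs_nonneg t)
          have h5 := mul_le_mul_of_nonneg_right (h.time z hz)
            (mul_nonneg hH0 (norm_nonneg (η τ - ζ τ)))
          rw [← ht] at h5
          linarith) hθ
      rw [sub_self, norm_zero, zero_add, integral_add_unit
        (f := fun τ => α * H * ‖η τ - ζ τ‖)
        (g := fun τ => |t| * (Λ * n * a) * Real.exp (lam * |τ * t|))
        (continuousOn_const.mul hδ) (continuousOn_const.mul hce) hθ one_mem_unit,
        intervalIntegral.integral_const_mul, intervalIntegral.integral_const_mul] at h1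
      have h6 := mul_le_mul_of_nonneg_left (mul_integral_exp_abs_le t hlam0 hθ)
        (show 0 ≤ Λ * n * a by positivity)
      have h7 : Λ * n * a * (Real.exp (lam * |t|) / lam) = Λ * n * X := by
        simp only [hX]; ring
      linarith)
  set δ₀ := Λ * n * X * Real.exp (α * H) with hδ₀
  have hδ₀0 : 0 ≤ δ₀ := by positivity
  have hδle' : ∀ θ ∈ Icc (0 : ℝ) 1, ‖η θ - ζ θ‖ ≤ δ₀ := fun θ hθ =>
    (hδle θ hθ).trans (mul_le_mul_of_nonneg_left (Real.exp_le_exp.2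
      (mul_le_of_le_one_right (mul_nonneg hα hH0) (by linarith [hθ.1]))) (by positivity))
  have hrf := continuousOn_along (hf.continuousOn_rate h i) hη.cont hη.mem
  have hrg := continuousOn_along (hg.continuousOn_rate h i) hζ.cont hζ.mem
  rw [← ht] at hrf hrg
  have hr : ‖∫ τ in (0 : ℝ)..1, (T.rate f i (τ * t, η τ) - T.rate g i (τ * t, ζ τ))‖ ≤
      ∫ τ in (0 : ℝ)..1, (LD * (1 + n * N) * δ₀ + LD * n * a * Real.exp (lam * |τ * t|)) := by
    refine norm_integral_le_integral_unit zero_mem_unit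
      (continuousOn_const.add (continuousOn_const.mul hce)) (fun τ hτ => ?_)
    have h2 := h.D_lip i _ (hη.mem τ hτ) _ (hf.maps _ (hη.mem τ hτ))
      _ (hζ.mem τ hτ) _ (hg.maps _ (hζ.mem τ hτ))
    simp only [sub_self, abs_zero, zero_add] at h2
    refine h2.trans ?_
    have h3 := mul_le_mul_of_nonneg_left (hval τ hτ) hLD
    have h4 := mul_le_mul_of_nonneg_left (hδle' τ hτ) (show 0 ≤ LD * (1 + n * N) by positivity)
    linarith
  rw [integral_add_unit continuousOn_const
    (g := fun τ => LD * n * a * Real.exp (lam * |τ * t|)) (continuousOn_const.mul hce)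
    zero_mem_unit one_mem_unit, intervalIntegral.integral_const, sub_zero, one_smul,
    intervalIntegral.integral_const_mul, integral_sub_unit hrf hrg zero_mem_unit
    one_mem_unit] at hr
  have hI := (h.I_lip i _ (Bounds.zero_mem hη) _ (Bounds.zero_mem hζ)).trans
    (mul_le_mul_of_nonneg_left (hδle' 0 zero_mem_unit) hLI)
  have h8 := mul_le_mul_of_nonneg_left (mul_integral_exp_abs_le t hlam0 zero_mem_unit)
    (show 0 ≤ LD * n * a by positivity)
  have h9 := mul_le_mul_of_nonneg_right (h.time z hz)
    (show 0 ≤ LD * (1 + n * N) * δ₀ by positivity)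
  rw [← ht] at h9
  have h10 := mul_le_mul_of_nonneg_left hr (abs_nonneg t)
  rw [Real.norm_eq_abs, ← abs_mul] at h10
  have h11 : LD * n * a * (Real.exp (lam * |t|) / lam) = LD * n * X := by simp only [hX]; ring
  have h12 : ‖(f' z - g' z) i‖ ≤ Q * X := by
    rw [Pi.sub_apply, hff i z hz η hη, hgg i z hz ζ hζ, Real.norm_eq_abs]
    have h13 : T.I (η 0) i + t * (∫ τ in (0 : ℝ)..1, T.rate f i (τ * t, η τ)) -
        (T.I (ζ 0) i + t * ∫ τ in (0 : ℝ)..1, T.rate g i (τ * t, ζ τ)) =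
        (T.I (η 0) i - T.I (ζ 0) i) + t * ((∫ τ in (0 : ℝ)..1, T.rate f i (τ * t, η τ)) -
          ∫ τ in (0 : ℝ)..1, T.rate g i (τ * t, ζ τ)) := by ring
    rw [h13]
    refine (abs_add_le _ _).trans ?_
    have h14 : Q * X = LI * δ₀ + α * (LD * (1 + n * N) * δ₀) + LD * n * X := by
      simp only [hQ, hδ₀]; ring
    rw [h14]
    linarith
  refine h12.trans ?_
  have h15 : a / 2 * Real.exp (lam * |t|) = lam / 2 * X := by
    simp only [hX]; field_simp
  rw [h15]
  exact mul_le_mul_of_nonneg_right (by simp only [hlam]; linarith) hX0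

theorem exists_char [CompleteSpace E] (h : T.Bounds α Λ LD LI Mc MD) (hf : T.Admits f N) :
    ∀ i, ∀ z ∈ T.K, ∃ η, IsChar T.K (T.field f i) z η :=
  fun i _ hz => exists_isChar h.inv (hf.isField h i) hz

/-- Fixed points of the integration along characteristics are unique. -/
theorem eqOn_of_integrates [CompleteSpace E] (h : T.Bounds α Λ LD LI Mc MD)
    (hf : T.Admits f N) (hg : T.Admits g N) (hff : T.Integrates f f) (hgg : T.Integrates g g) :
    EqOn f g T.K := by
  obtain ⟨lam, hlam, hcon⟩ := exists_contraction h hf.nonneg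
  have key := le_of_self_improving (σ := T.K) (x := fun z => ‖f z - g z‖)
    (ω := fun z => Real.exp (lam * |z.1.1|)) (C := 0) (c₀ := 2 * T.b)
    (fun s => (Real.exp_pos _).le) le_rfl (by linarith [h.b_nonneg]) (by
      rintro ⟨z, hz⟩
      have h1 := hf.maps z hz
      have h2 := hg.maps z hz
      have h3 : ‖f z - g z‖ ≤ 2 * T.b := by
        rw [← dist_eq_norm]
        have := dist_triangle_right (f z) (g z) T.y₀
        have := Metric.mem_closedBall.1 h1
        have := Metric.mem_closedBall.1 h2
        linarith
      have h4 : 1 ≤ Real.exp (lam * |z.1|) := Real.one_le_exp (by positivity)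
      have := h.b_nonneg
      exact h3.trans (le_mul_of_one_le_right (by positivity) h4)) (by
      rintro c hc hle ⟨z, hz⟩
      have := hcon f g f g c hf hg (exists_char h hf) (exists_char h hg) hff hgg hc
        (fun z hz => hle ⟨z, hz⟩) z hz
      simpa using this)
  intro z hz
  have := key ⟨z, hz⟩
  simp only [mul_zero, zero_mul] at this
  exact sub_eq_zero.1 (norm_le_zero_iff.1 this)

/-- Along a characteristic, the integrated function grows with the given rate. -/
theorem Integrates.sub_eq (h : T.Bounds α Λ LD LI Mc MD) (hf : T.Admits f N)
    (hff : T.Integrates f f') {i : Fin n} {z : ℝ × E} (hz : z ∈ T.K) {η : ℝ → E}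
    (hη : IsChar T.K (T.field f i) z η) {σ : ℝ} (hσ : σ ∈ Icc (0 : ℝ) 1) :
    f' z i - f' (σ * z.1, η σ) i = z.1 * ∫ τ in σ..1, T.rate f i (τ * z.1, η τ) := by
  have h1 := hff i z hz η hη
  have h2 := hff i _ (hη.mem σ hσ) _ (hη.restrict (hf.isField h i).continuousOn hσ)
  have h3 := integral_restrict (hf.continuousOn_rate h i) hη hσ
  rw [h1, h2, h3, mul_zero]
  ring

theorem abs_integral_rate_le (h : T.Bounds α Λ LD LI Mc MD) (hf : T.Admits f N)
    {i : Fin n} {z : ℝ × E} {η : ℝ → E} (hη : IsChar T.K (T.field f i) z η) {σ : ℝ}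
    (hσ : σ ∈ Icc (0 : ℝ) 1) :
    |∫ τ in σ..1, T.rate f i (τ * z.1, η τ)| ≤ MD * (1 - σ) := by
  have h1 := intervalIntegral.norm_integral_le_of_norm_le_const (a := σ) (b := 1) (C := MD)
    (f := fun τ => T.rate f i (τ * z.1, η τ)) (fun τ hτ => by
      rw [uIoc_of_le hσ.2] at hτ
      have hτ' := hη.mem τ ⟨hσ.1.trans hτ.1.le, hτ.2⟩
      exact h.D_bound i _ hτ' _ (hf.maps _ hτ'))
  rwa [Real.norm_eq_abs, abs_of_nonneg (sub_nonneg.2 hσ.2)] at h1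

/-- For times of equal sign, the point farther from `0` is moved to the time of the nearer one; for
opposite signs both are moved to `0`. Either way the total time travelled is `|t - t'|`, which keeps
the joint Lipschitz constant sharp enough for `L_Ufs`. -/
theorem exists_common_time (t t' : ℝ) : ∃ σ ∈ Icc (0 : ℝ) 1, ∃ σ' ∈ Icc (0 : ℝ) 1,
    σ * t = σ' * t' ∧ |t| * (1 - σ) + |t'| * (1 - σ') = |t - t'| := by
  have key : ∀ t t' : ℝ, 0 ≤ t → t' ≤ t → ∃ σ ∈ Icc (0 : ℝ) 1, ∃ σ' ∈ Icc (0 : ℝ) 1,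
      σ * t = σ' * t' ∧ |t| * (1 - σ) + |t'| * (1 - σ') = |t - t'| := by
    intro t t' ht htt
    rcases eq_or_lt_of_le ht with h0 | h0
    · subst h0
      exact ⟨0, zero_mem_unit, 0, zero_mem_unit, by simp, by simp⟩
    · rcases le_total 0 t' with h | h
      · refine ⟨t' / t, ⟨by positivity, (div_le_one h0).2 htt⟩, 1, one_mem_unit, ?_, ?_⟩
        · field_simp
        · rw [abs_of_nonneg ht, abs_of_nonneg (sub_nonneg.2 htt)]
          field_simp
          ring
      · refine ⟨0, zero_mem_unit, 0, zero_mem_unit, by simp, ?_⟩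
        rw [abs_of_nonneg ht, abs_of_nonpos h, abs_of_nonneg (sub_nonneg.2 htt)]
        ring
  have key2 : ∀ t t' : ℝ, t' ≤ t → ∃ σ ∈ Icc (0 : ℝ) 1, ∃ σ' ∈ Icc (0 : ℝ) 1,
      σ * t = σ' * t' ∧ |t| * (1 - σ) + |t'| * (1 - σ') = |t - t'| := by
    intro t t' htt
    rcases le_total 0 t with h | h
    · exact key t t' h htt
    · obtain ⟨σ, hσ, σ', hσ', h1, h2⟩ := key (-t') (-t) (by linarith) (by linarith)
      refine ⟨σ', hσ', σ, hσ, by linarith, ?_⟩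
      rw [abs_neg, abs_neg] at h2
      rw [show t - t' = -t' - -t by ring, ← h2]
      ring
  rcases le_total t' t with h | h
  · exact key2 t t' h
  · obtain ⟨σ, hσ, σ', hσ', h1, h2⟩ := key2 t' t h
    exact ⟨σ', hσ', σ, hσ, h1.symm, by rw [abs_sub_comm, ← h2]; ring⟩

/-- A bound of the oscillation along hyperplanes `t = const` yields a joint one. -/
theorem Integrates.abs_sub_le [CompleteSpace E] (h : T.Bounds α Λ LD LI Mc MD)
    (hf : T.Admits f N) (hff : T.Integrates f f') {Lf : ℝ} (hLf : 0 ≤ Lf) {i : Fin n}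
    (hslice : ∀ z ∈ T.K, ∀ z' ∈ T.K, z.1 = z'.1 → |f' z i - f' z' i| ≤ Lf * ‖z.2 - z'.2‖)
    {z z' : ℝ × E} (hz : z ∈ T.K) (hz' : z' ∈ T.K) :
    |f' z i - f' z' i| ≤ Lf * ‖z.2 - z'.2‖ + (MD + Lf * Mc) * |z.1 - z'.1| := by
  obtain ⟨σ, hσ, σ', hσ', hσσ, hsum⟩ := exists_common_time z.1 z'.1
  obtain ⟨η, hη⟩ := exists_char h hf i z hz
  obtain ⟨ζ, hζ⟩ := exists_char h hf i z' hz'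
  have h1 := hff.sub_eq h hf hz hη hσ
  have h2 := hff.sub_eq h hf hz' hζ hσ'
  -- At the common time only the slice bound is used. Each unit of travelled time costs `MD` in the
  -- value and `Mc` in the position, and the displacement in turn costs `Lf`.
  have h3 := hslice _ (hη.mem σ hσ) _ (hζ.mem σ' hσ') hσσ
  have h4 := hη.norm_sub_le_time (hf.isField h i) hσ one_mem_unit
  have h5 := hζ.norm_sub_le_time (hf.isField h i) hσ' one_mem_unit
  rw [hη.apply_one, abs_of_nonpos (show σ - 1 ≤ 0 by linarith [hσ.2])] at h4
  rw [hζ.apply_one, abs_of_nonpos (show σ' - 1 ≤ 0 by linarith [hσ'.2])] at h5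
  have h6 := mul_le_mul_of_nonneg_left (abs_integral_rate_le h hf hη hσ) (abs_nonneg z.1)
  have h7 := mul_le_mul_of_nonneg_left (abs_integral_rate_le h hf hζ hσ') (abs_nonneg z'.1)
  rw [← abs_mul, ← h1] at h6
  rw [← abs_mul, ← h2] at h7
  have h8 : ‖η σ - ζ σ'‖ ≤ ‖z.2 - z'.2‖ + Mc * |z.1 - z'.1| := by
    have : η σ - ζ σ' = (η σ - z.2) + (z.2 - z'.2) - (ζ σ' - z'.2) := by abel
    rw [this]
    refine (norm_sub_le _ _).trans ?_
    have := norm_add_le (η σ - z.2) (z.2 - z'.2)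
    rw [← hsum]
    linarith
  have h9 := mul_le_mul_of_nonneg_left h8 hLf
  have h10 : f' z i - f' z' i = (f' z i - f' (σ * z.1, η σ) i) +
      (f' (σ * z.1, η σ) i - f' (σ' * z'.1, ζ σ') i) - (f' z' i - f' (σ' * z'.1, ζ σ') i) := by
    ring
  rw [h10]
  have h11 := abs_sub ((f' z i - f' (σ * z.1, η σ) i) +
      (f' (σ * z.1, η σ) i - f' (σ' * z'.1, ζ σ') i)) (f' z' i - f' (σ' * z'.1, ζ σ') i)
  have h12 := abs_add_le (f' z i - f' (σ * z.1, η σ) i)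
    (f' (σ * z.1, η σ) i - f' (σ' * z'.1, ζ σ') i)
  have h13 : MD * |z.1 - z'.1| = |z.1| * (MD * (1 - σ)) + |z'.1| * (MD * (1 - σ')) := by
    rw [← hsum]; ring
  simp only at h3
  linarith

/-- The class of functions in which the solution is found. -/
structure InClass (T : Transport E n) (L : ℝ → ℝ) (Lf Lt : ℝ) (f : ℝ × E → Fin n → ℝ) : Prop where
  maps : ∀ z ∈ T.K, f z ∈ T.val
  slice : ∀ i, ∀ z ∈ T.K, ∀ z' ∈ T.K, z.1 = z'.1 → |f z i - f z' i| ≤ L |z.1| * ‖z.2 - z'.2‖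
  lip : ∀ i, ∀ z ∈ T.K, ∀ z' ∈ T.K, |f z i - f z' i| ≤ Lf * ‖z.2 - z'.2‖ + Lt * |z.1 - z'.1|

theorem InClass.admits {L : ℝ → ℝ} {Lf Lt : ℝ} (hf : InClass T L Lf Lt f) (hLf : 0 ≤ Lf) :
    T.Admits f (max Lf Lt) := by
  refine ⟨hf.maps, hLf.trans (le_max_left _ _), fun i z hz z' hz' => ?_⟩
  have h1 := hf.lip i z hz z' hz'
  have h2 := mul_le_mul_of_nonneg_right (le_max_left Lf Lt) (norm_nonneg (z.2 - z'.2))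
  have h3 := mul_le_mul_of_nonneg_right (le_max_right Lf Lt) (abs_nonneg (z.1 - z'.1))
  linarith

/-- Two characteristics of `f` ending at the same time `t` are at time `s` at most `e s t` times as
far apart as their ends, because `e` is a supersolution of the Gronwall inequality for their
distance. The growth condition of the profile then returns the slice constant `L t` for the
integrated function. The joint constant follows by moving to a common time, and the values stay in
the box because at most `α * MD` is added to the initial datum. -/
theorem InClass.exists_integrates [CompleteSpace E] (h : T.Bounds α Λ LD LI Mc MD)
    (hI : ∀ i, ∀ x, ((0 : ℝ), x) ∈ T.K → |T.I x i - T.y₀ i| ≤ T.b - α * MD)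
    {L : ℝ → ℝ} {e : ℝ → ℝ → ℝ} {Lf : ℝ} (hL : IsLipschitzProfile n α Λ LD LI Lf L e)
    (hf : InClass T L Lf (MD + Lf * Mc) f) :
    ∃ f', InClass T L Lf (MD + Lf * Mc) f' ∧ T.Integrates f f' := by
  classical
  have hα := h.α_nonneg
  have hLf : 0 ≤ Lf := (hL.nonneg 0 ⟨le_rfl, hα⟩).trans (hL.le 0 ⟨le_rfl, hα⟩)
  have hA := hf.admits hLf
  have hch : ∀ i z, ∃ η, z ∈ T.K → IsChar T.K (T.field f i) z η := by
    intro i z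
    by_cases hz : z ∈ T.K
    · obtain ⟨η, hη⟩ := exists_char h hA i z hz
      exact ⟨η, fun _ => hη⟩
    · exact ⟨0, fun hz' => absurd hz' hz⟩
  choose γ hγ using hch
  set f' : ℝ × E → Fin n → ℝ := fun z i =>
    T.I (γ i z 0) i + z.1 * ∫ τ in (0 : ℝ)..1, T.rate f i (τ * z.1, γ i z τ) with hf'
  have hint : T.Integrates f f' := by
    intro i z hz η hη
    have huniq := (hγ i z hz).unique (hA.isField h i) hη
    simp only [hf']
    rw [huniq zero_mem_unit]
    congr 2
    refine intervalIntegral.integral_congr fun τ hτ => ?_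
    rw [uIcc_of_le zero_le_one] at hτ
    simp only [huniq hτ]
  have hslice : ∀ i, ∀ z ∈ T.K, ∀ z' ∈ T.K, z.1 = z'.1 →
      |f' z i - f' z' i| ≤ L |z.1| * ‖z.2 - z'.2‖ := by
    intro i z hz z' hz' hzz
    have ht : |z.1| ∈ Icc 0 α := ⟨abs_nonneg _, h.time z hz⟩
    set s := |z.1| with hs
    set η := γ i z
    set ζ := γ i z'
    have hη := hγ i z hz
    have hζ := hγ i z' hz'
    have hmaps : ∀ τ ∈ Icc (0 : ℝ) 1, τ * s ∈ Icc 0 α := fun τ hτ =>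
      ⟨mul_nonneg hτ.1 ht.1, (mul_le_of_le_one_left ht.1 hτ.2).trans ht.2⟩
    have habs : ∀ τ ∈ Icc (0 : ℝ) 1, |τ * z.1| = τ * s := fun τ hτ => by
      rw [abs_mul, abs_of_nonneg hτ.1]
    have hLc : ContinuousOn (fun τ => L (τ * s)) (Icc 0 1) :=
      hL.continuous_L.comp (by fun_prop) hmaps
    have hec : ContinuousOn (fun τ => e (τ * s) s) (Icc 0 1) :=
      (hL.continuous_e s ht).comp (f := fun τ => τ * s) (by fun_prop) hmaps
    have hk : ContinuousOn (fun τ => 1 + n * L (τ * s)) (Icc 0 1) :=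
      continuousOn_const.add (continuousOn_const.mul hLc)
    have hk0 : ∀ τ ∈ Icc (0 : ℝ) 1, 0 ≤ 1 + n * L (τ * s) := fun τ hτ => by
      have := hL.nonneg _ (hmaps τ hτ)
      positivity
    have hδ : ContinuousOn (fun θ => ‖η θ - ζ θ‖) (Icc 0 1) := (hη.cont.sub hζ.cont).norm
    have hl1 : ∀ τ ∈ Icc (0 : ℝ) 1, ‖η τ - ζ τ‖ + l1 (f (τ * z.1, η τ) - f (τ * z'.1, ζ τ)) ≤
        (1 + n * L (τ * s)) * ‖η τ - ζ τ‖ := by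
      intro τ hτ
      have := l1_sub_le (fun j => hf.slice j _ (hη.mem τ hτ) _ (hζ.mem τ hτ) (by simp [hzz]))
      simp only [habs τ hτ] at this
      linarith
    have hδle : ∀ θ ∈ Icc (0 : ℝ) 1, ‖η θ - ζ θ‖ ≤ ‖z.2 - z'.2‖ * e (θ * s) s := by
      refine gronwall_backward (A := ‖z.2 - z'.2‖)
        (k := fun τ => s * (Λ * (1 + n * L (τ * s)))) hδ (continuousOn_const.mul hec)
        (continuousOn_const.mul (continuousOn_const.mul hk)) (fun τ hτ =>
          mul_nonneg ht.1 (mul_nonneg h.Λ_nonneg (hk0 τ hτ))) (fun θ hθ => ?_) (fun θ hθ => ?_)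
      · refine hη.norm_sub_le hζ (hA.isField h i).continuousOn (hA.isField h i).continuousOn
          (B := fun τ => s * (Λ * (1 + n * L (τ * s))) * ‖η τ - ζ τ‖)
          ((continuousOn_const.mul (continuousOn_const.mul hk)).mul hδ) (fun τ hτ => ?_) hθ
        rw [← hzz, ← smul_sub, norm_smul, Real.norm_eq_abs, ← hs]
        have h2 := h.c_lip i _ (hη.mem τ hτ) _ (hA.maps _ (hη.mem τ hτ))
            _ (hζ.mem τ hτ) _ (hA.maps _ (hζ.mem τ hτ))
        simp only [← hzz, sub_self, abs_zero, zero_add] at h2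
        have h3 := hl1 τ hτ
        rw [← hzz] at h3
        have h4 := mul_le_mul_of_nonneg_left (h2.trans (mul_le_mul_of_nonneg_left h3 h.Λ_nonneg))
          ht.1
        refine h4.trans (le_of_eq (by ring))
      -- The expansion condition, scaled by the distance of the end points, is the supersolution
      -- property of `e`.
      · have h2 := mul_le_mul_of_nonneg_left (hL.expansion s ht θ hθ) (norm_nonneg (z.2 - z'.2))
        refine le_trans (le_of_eq ?_) h2
        rw [mul_add, mul_one, ← intervalIntegral.integral_const_mul,
          ← intervalIntegral.integral_const_mul]
        congr 2
        ext τ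
        ring
    have hrf := continuousOn_along (hA.continuousOn_rate h i) hη.cont hη.mem
    have hrg := continuousOn_along (hA.continuousOn_rate h i) hζ.cont hζ.mem
    have hr : ‖∫ τ in (0 : ℝ)..1, (T.rate f i (τ * z.1, η τ) - T.rate f i (τ * z'.1, ζ τ))‖ ≤
        ∫ τ in (0 : ℝ)..1, ‖z.2 - z'.2‖ * (LD * (1 + n * L (τ * s)) * e (τ * s) s) := by
      refine norm_integral_le_integral_unit zero_mem_unit
        (continuousOn_const.mul ((continuousOn_const.mul hk).mul hec)) (fun τ hτ => ?_)
      have h2 := h.D_lip i _ (hη.mem τ hτ) _ (hA.maps _ (hη.mem τ hτ))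
        _ (hζ.mem τ hτ) _ (hA.maps _ (hζ.mem τ hτ))
      simp only [hzz, sub_self, abs_zero, zero_add] at h2
      have h3 := hl1 τ hτ
      rw [hzz] at h3
      have h4 := mul_le_mul_of_nonneg_left (h3.trans
        (mul_le_mul_of_nonneg_left (hδle τ hτ) (hk0 τ hτ))) h.LD_nonneg
      rw [hzz]
      refine h2.trans (h4.trans (le_of_eq (by ring)))
    rw [intervalIntegral.integral_const_mul, integral_sub_unit hrf hrg zero_mem_unit
      one_mem_unit] at hr
    have hI := (h.I_lip i _ (Bounds.zero_mem hη) _ (Bounds.zero_mem hζ)).trans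
      (mul_le_mul_of_nonneg_left (hδle 0 zero_mem_unit) h.LI_nonneg)
    have hG := mul_le_mul_of_nonneg_left (hL.growth s ht) (norm_nonneg (z.2 - z'.2))
    have h10 := mul_le_mul_of_nonneg_left hr (abs_nonneg z.1)
    rw [Real.norm_eq_abs, ← abs_mul, ← hs] at h10
    have h13 : f' z i - f' z' i = (T.I (η 0) i - T.I (ζ 0) i) +
        z.1 * ((∫ τ in (0 : ℝ)..1, T.rate f i (τ * z.1, η τ)) -
          ∫ τ in (0 : ℝ)..1, T.rate f i (τ * z'.1, ζ τ)) := by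
      simp only [hf', ← hzz, η, ζ]; ring
    rw [h13]
    refine (abs_add_le _ _).trans ?_
    rw [zero_mul] at hI
    rw [mul_add] at hG
    linarith
  refine ⟨f', ⟨fun z hz => ?_, hslice, fun i z hz z' hz' => ?_⟩, hint⟩
  · rw [val, Metric.mem_closedBall, dist_eq_norm, pi_norm_le_iff_of_nonneg h.b_nonneg]
    intro i
    have hη := hγ i z hz
    have h1 := hI i _ (Bounds.zero_mem hη)
    have h2 := mul_le_mul (h.time z hz) (abs_integral_rate_le h hA hη zero_mem_unit)
      (abs_nonneg _) hα
    rw [← abs_mul, sub_zero, mul_one] at h2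
    have h4 : f' z i - T.y₀ i = (T.I (γ i z 0) i - T.y₀ i) +
      z.1 * ∫ τ in (0 : ℝ)..1, T.rate f i (τ * z.1, γ i z τ) := by simp only [hf']; ring
    rw [Pi.sub_apply, Real.norm_eq_abs, h4]
    refine (abs_add_le _ _).trans ?_
    linarith
  · refine hint.abs_sub_le h hA hLf (fun z hz z' hz' hzz => ?_) hz hz'
    exact (hslice i z hz z' hz' hzz).trans (mul_le_mul_of_nonneg_right
      (hL.le _ ⟨abs_nonneg _, h.time z hz⟩) (norm_nonneg _))

/-- Existence of an integral solution. -/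
theorem exists_solution [CompleteSpace E] (h : T.Bounds α Λ LD LI Mc MD)
    (hI : ∀ i, ∀ x, ((0 : ℝ), x) ∈ T.K → |T.I x i - T.y₀ i| ≤ T.b - α * MD)
    {L : ℝ → ℝ} {e : ℝ → ℝ → ℝ} {Lf : ℝ} (hL : IsLipschitzProfile n α Λ LD LI Lf L e) :
    ∃ f, InClass T L Lf (MD + Lf * Mc) f ∧ T.Integrates f f := by
  have hα := h.α_nonneg
  have hLf : 0 ≤ Lf := (hL.nonneg 0 ⟨le_rfl, hα⟩).trans (hL.le 0 ⟨le_rfl, hα⟩)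
  have hLt : 0 ≤ MD + Lf * Mc := add_nonneg h.MD_nonneg (mul_nonneg hLf h.Mc_nonneg)
  obtain ⟨lam, hlam, hcon⟩ := exists_contraction (N := max Lf (MD + Lf * Mc)) h
    (hLf.trans (le_max_left _ _))
  have key := exists_fixedPoint T.K (InClass T L Lf (MD + Lf * Mc)) T.Integrates
    (fun z => Real.exp (lam * |z.1|)) (fun f hf => hf.exists_integrates h hI hL)
    (fun f g f' g' a hf hg hff hgg ha hle => hcon f g f' g' a (hf.admits hLf) (hg.admits hLf)
      (exists_char h (hf.admits hLf)) (exists_char h (hg.admits hLf)) hff hgg ha hle)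
    (fun _ => T.y₀) ⟨fun z _ => Metric.mem_closedBall_self h.b_nonneg, fun i z hz z' _ _ => by
        have := hL.nonneg _ ⟨abs_nonneg _, h.time z hz⟩
        rw [sub_self, abs_zero]; positivity, fun i z hz z' _ => by
        rw [sub_self, abs_zero]; positivity⟩ ?_ ?_
  · obtain ⟨f, f', hf, hff, heq⟩ := key
    exact ⟨f, hf, fun i z hz η hη => by rw [← heq z hz]; exact hff i z hz η hη⟩
  · intro f' hf'
    refine ⟨T.b, h.b_nonneg, fun z hz => ?_⟩
    have h1 := hf'.maps z hz
    rw [val, Metric.mem_closedBall', dist_eq_norm] at h1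
    have h4 : 1 ≤ Real.exp (lam * |z.1|) := Real.one_le_exp (by positivity)
    exact h1.trans (le_mul_of_one_le_right h.b_nonneg h4)
  · intro F f hF hlim
    have hlim' : ∀ i, ∀ z ∈ T.K, Tendsto (fun k => F k z i) atTop (𝓝 (f z i)) :=
      fun i z hz => (tendsto_pi_nhds.1 (hlim z hz)) i
    refine ⟨fun z hz => ?_, fun i z hz z' hz' hzz => ?_, fun i z hz z' hz' => ?_⟩
    · exact Metric.isClosed_closedBall.mem_of_tendsto (hlim z hz)
        (Eventually.of_forall fun k => (hF k).maps z hz)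
    · exact le_of_tendsto' ((hlim' i z hz).sub (hlim' i z' hz')).abs
        (fun k => (hF k).slice i z hz z' hz' hzz)
    · exact le_of_tendsto' ((hlim' i z hz).sub (hlim' i z' hz')).abs
        (fun k => (hF k).lip i z hz z' hz')

end Transport

end ParamPDE

namespace ParamPDE

set_option linter.unusedSectionVars false

open Filter

/-! ### Lipschitz functions with prescribed directional derivatives -/

section Rademacher

open MeasureTheory

variable {Z : Type*} [NormedAddCommGroup Z] [NormedSpace ℝ Z]

/-- A Lipschitz function of one variable is absolutely continuous, hence the integral of its
derivative, so an estimate of the derivative almost everywhere suffices. -/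
theorem abs_sub_sub_le_of_ae_deriv {φ : ℝ → ℝ} {C : NNReal} (hφ : LipschitzWith C φ) {δ ε s : ℝ}
    (h : ∀ᵐ u : ℝ, u ∈ uIoc 0 s → |deriv φ u - δ| ≤ ε) : |φ s - φ 0 - s * δ| ≤ ε * |s| := by
  have hac : AbsolutelyContinuousOnInterval φ 0 s :=
    (hφ.lipschitzOnWith (s := uIcc 0 s)).absolutelyContinuousOnInterval
  have h1 : ∫ u in (0 : ℝ)..s, (deriv φ u - δ) = φ s - φ 0 - s * δ := by
    rw [intervalIntegral.integral_sub hac.intervalIntegrable_deriv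
      _root_.intervalIntegrable_const, hac.integral_deriv_eq_sub]
    simp
  have h2 := intervalIntegral.norm_integral_le_of_norm_le_const_ae
    (f := fun u => deriv φ u - δ) (C := ε) (a := 0) (b := s) (by simpa only [Real.norm_eq_abs] using h)
  rwa [h1, Real.norm_eq_abs, sub_zero] at h2

/-- For almost every `z`, almost all points of the line `z + ℝ v` have a property that holds
almost everywhere. -/
theorem dense_ae_line [FiniteDimensional ℝ Z] [MeasurableSpace Z] [BorelSpace Z]
    {P : Z → Prop} (hP : ∀ᵐ z ∂(Measure.addHaar : Measure Z), P z) (v : Z) :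
    Dense {z : Z | ∀ᵐ s : ℝ, P (z + s • v)} := by
  obtain ⟨N, hN, hNm, hN0⟩ := exists_measurable_superset_of_null hP
  have hmeas : MeasurableSet {x : Z × ℝ | x.1 + x.2 • v ∉ N} := by
    refine (hNm.compl).preimage ?_
    exact (by fun_prop : Continuous fun x : Z × ℝ => x.1 + x.2 • v).measurable
  -- For fixed `s` the translate of a null set is null. Fubini's theorem exchanges the quantifiers,
  -- and a set of full Haar measure is dense.
  have h1 : ∀ᵐ s : ℝ, ∀ᵐ z ∂(Measure.addHaar : Measure Z), z + s • v ∉ N := by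
    refine Eventually.of_forall fun s => ?_
    have h3 : (Measure.addHaar : Measure Z) ((fun z => z + s • v) ⁻¹' N) = 0 := by
      rw [measure_preimage_add_right, hN0]
    exact measure_eq_zero_iff_ae_notMem.1 h3
  have h2 := (Measure.ae_ae_comm (p := fun (z : Z) (s : ℝ) => z + s • v ∉ N) hmeas).2 h1
  refine (Measure.dense_of_ae h2).mono fun z hz => ?_
  exact (show ∀ᵐ s : ℝ, z + s • v ∉ N from hz).mono fun s hs => by_contra fun hcon => hs (hN hcon)

/-- Freeze the direction `v = b z₀`. Near `z₀`, at almost every point, the derivative in the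
direction `v` differs from `d z₀` by at most `C ‖v - b z‖ + |d z - d z₀|`, which is small by
continuity. On a dense set of parallel lines this holds almost everywhere along the line and can be
integrated; the resulting increment estimate is closed in the starting point and so holds on the
line through `z₀`. -/
theorem hasDerivAt_line [FiniteDimensional ℝ Z] {n : ℕ} {g : Z → Fin n → ℝ} {C : NNReal}
    (hg : LipschitzWith C g) {U : Set Z} (hU : IsOpen U) {b : Z → Z} {d : Z → ℝ} {i : Fin n}
    (hb : ContinuousOn b U) (hd : ContinuousOn d U)
    (h : ∀ z ∈ U, DifferentiableAt ℝ g z → fderiv ℝ g z (b z) i = d z) {z₀ : Z} (hz₀ : z₀ ∈ U) :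
    HasDerivAt (fun s : ℝ => g (z₀ + s • b z₀) i) (d z₀) 0 := by
  let _ : MeasurableSpace Z := borel Z
  have _ : BorelSpace Z := ⟨rfl⟩
  set v := b z₀ with hv
  have hgi : LipschitzWith C fun z => g z i := fun z z' =>
    (edist_le_pi_edist (g z) (g z') i).trans (hg z z')
  have key : ∀ ε > 0, ∃ r > 0, ∀ s : ℝ, |s| < r →
      |g (z₀ + s • v) i - g z₀ i - s * d z₀| ≤ ε * |s| := by
    intro ε hε
    have hcont : ContinuousAt (fun z => (C : ℝ) * ‖v - b z‖ + |d z - d z₀|) z₀ := by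
      have h1 := (hb.continuousAt (hU.mem_nhds hz₀))
      have h2 := (hd.continuousAt (hU.mem_nhds hz₀))
      exact (((continuousAt_const.sub h1).norm).const_mul _).add (h2.sub continuousAt_const).abs
    have hev : ∀ᶠ z in 𝓝 z₀, z ∈ U ∧ (C : ℝ) * ‖v - b z‖ + |d z - d z₀| < ε := by
      refine (hU.eventually_mem hz₀).and (hcont.eventually_lt_const ?_)
      simpa [hv] using hε
    obtain ⟨r, hr, hball⟩ := Metric.eventually_nhds_iff_ball.1 hev
    have hae : ∀ᵐ z ∂(Measure.addHaar : Measure Z), z ∈ Metric.ball z₀ r →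
        DifferentiableAt ℝ g z ∧ |fderiv ℝ g z v i - d z₀| ≤ ε := by
      filter_upwards [hg.ae_differentiableAt (μ := (Measure.addHaar : Measure Z))] with z hz hzr
      refine ⟨hz, ?_⟩
      obtain ⟨hzU, hzε⟩ := hball z hzr
      have h1 := h z hzU hz
      have h2 : fderiv ℝ g z v i - d z₀ = fderiv ℝ g z (v - b z) i + (d z - d z₀) := by
        rw [map_sub, Pi.sub_apply, h1]; ring
      have h3 : |fderiv ℝ g z (v - b z) i| ≤ C * ‖v - b z‖ := by
        refine (norm_le_pi_norm (fderiv ℝ g z (v - b z)) i).trans ?_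
        exact ((fderiv ℝ g z).le_opNorm _).trans
          (mul_le_mul_of_nonneg_right (norm_fderiv_le_of_lipschitz ℝ hg) (norm_nonneg _))
      rw [h2]
      exact (abs_add_le _ _).trans (by linarith)
    have hdense := dense_ae_line hae v
    refine ⟨r / 2 / (1 + ‖v‖), by positivity, fun s hs => ?_⟩
    have hsv : |s| * ‖v‖ < r / 2 := by
      rw [lt_div_iff₀ (by positivity)] at hs
      nlinarith [abs_nonneg s]
    have hline : ∀ z ∈ Metric.ball z₀ (r / 2) ∩ {z : Z | ∀ᵐ s : ℝ, z + s • v ∈ Metric.ball z₀ r →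
        DifferentiableAt ℝ g (z + s • v) ∧ |fderiv ℝ g (z + s • v) v i - d z₀| ≤ ε},
        |g (z + s • v) i - g z i - s * d z₀| ≤ ε * |s| := by
      rintro z ⟨hz, hzae⟩
      have hlip : LipschitzWith (C * ‖v‖₊) fun u : ℝ => g (z + u • v) i := by
        refine hgi.comp (LipschitzWith.of_dist_le_mul fun u u' => ?_)
        rw [dist_add_left, dist_eq_norm, ← sub_smul, norm_smul, mul_comm]
        rfl
      have h1 := abs_sub_sub_le_of_ae_deriv (δ := d z₀) (ε := ε) (s := s) hlip (by
        filter_upwards [hzae] with u hu hus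
        have hus' : |u| ≤ |s| := by
          rcases le_total 0 s with h0 | h0
          · rw [uIoc_of_le h0] at hus
            rw [abs_of_nonneg h0, abs_of_pos hus.1]; exact hus.2
          · rw [uIoc_of_ge h0] at hus
            rw [abs_of_nonpos h0, abs_of_nonpos hus.2]; linarith [hus.1]
        have hmem : z + u • v ∈ Metric.ball z₀ r := by
          rw [Metric.mem_ball, dist_eq_norm] at hz ⊢
          have h2 : z + u • v - z₀ = (z - z₀) + u • v := by abel
          rw [h2]
          refine (norm_add_le _ _).trans_lt ?_
          rw [norm_smul, Real.norm_eq_abs]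
          have := mul_le_mul_of_nonneg_right hus' (norm_nonneg v)
          linarith
        obtain ⟨hdiff, hle⟩ := hu hmem
        have h3 : HasDerivAt (fun u : ℝ => z + u • v) v u := by
          simpa using ((hasDerivAt_id u).smul_const v).const_add z
        have h4 := (hasDerivAt_pi.1 (hdiff.hasFDerivAt.comp_hasDerivAt u h3)) i
        rwa [show deriv (fun u : ℝ => g (z + u • v) i) u = _ from h4.deriv])
      simpa using h1
    -- The increment estimate involves no derivative of `g`, so it passes from the dense set to
    -- `z₀`, whose own line may be exceptional.
    have hclosed : IsClosed {z : Z | |g (z + s • v) i - g z i - s * d z₀| ≤ ε * |s|} := by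
      have h1 := hgi.continuous
      have h2 : Continuous fun z => g (z + s • v) i := h1.comp (by fun_prop)
      exact isClosed_le ((h2.sub h1).sub continuous_const).abs continuous_const
    have h5 := hdense.open_subset_closure_inter (Metric.isOpen_ball (x := z₀) (ε := r / 2))
    exact closure_minimal hline hclosed (h5 (Metric.mem_ball_self (by positivity)))
  rw [hasDerivAt_iff_isLittleO, Asymptotics.isLittleO_iff]
  intro ε hε
  obtain ⟨r, hr, hk⟩ := key ε hε
  filter_upwards [Metric.ball_mem_nhds (0 : ℝ) hr] with s hs
  have := hk s (by simpa using hs)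
  simpa using this

end Rademacher

/-! ### Integral equations and derivatives in characteristic directions. -/

theorem IsChar.hasDerivAt_graph {E : Type*} [NormedAddCommGroup E] [NormedSpace ℝ E]
    [CompleteSpace E] {K : Set (ℝ × E)} {c : ℝ × E → E} {z : ℝ × E} {η : ℝ → E}
    (hη : IsChar K c z η) (hc : ContinuousOn c K) {τ : ℝ} (hτ : τ ∈ Ioo (0 : ℝ) 1) :
    HasDerivAt (fun τ => (τ * z.1, η τ)) (z.1, z.1 • c (τ * z.1, η τ)) τ := by
  have hτ' : τ ∈ Icc (0 : ℝ) 1 := Ioo_subset_Icc_self hτ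
  have hcη := continuousOn_along hc hη.cont hη.mem
  have h1 : HasDerivAt (fun θ => z.2 - z.1 • ∫ u in θ..1, c (u * z.1, η u))
      (-(z.1 • -c (τ * z.1, η τ))) τ := by
    refine HasDerivAt.const_sub _ (HasDerivAt.const_smul _ ?_)
    refine intervalIntegral.integral_hasDerivAt_left
      (intervalIntegrable_of_continuousOn_unit hcη hτ' one_mem_unit) ?_
      (hcη.continuousAt (Icc_mem_nhds hτ.1 hτ.2))
    exact (hcη.mono Ioo_subset_Icc_self).stronglyMeasurableAtFilter isOpen_Ioo τ hτ
  rw [smul_neg, neg_neg] at h1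
  refine HasDerivAt.prodMk ?_ (h1.congr_of_eventuallyEq ?_)
  · simpa using (hasDerivAt_id τ).mul_const z.1
  · filter_upwards [Icc_mem_nhds hτ.1 hτ.2] with θ hθ using hη.eq θ hθ

namespace Transport

variable {E : Type*} [NormedAddCommGroup E] [NormedSpace ℝ E] {n : ℕ} {T : Transport E n}
  {α Λ LD LI Mc MD N : ℝ} {f g f' : ℝ × E → Fin n → ℝ}

theorem exists_time_ratio {t s : ℝ} (h : 0 ≤ s * t) :
    ∃ θ ∈ Icc (0 : ℝ) 1, θ * (t + s) = t := by
  rcases eq_or_ne (t + s) 0 with h0 | h0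
  · refine ⟨1, one_mem_unit, ?_⟩
    have : s = -t := by linarith
    subst this
    have : t = 0 := by nlinarith [sq_nonneg t]
    simp [this]
  · refine ⟨t / (t + s), ?_, by field_simp⟩
    rcases lt_or_gt_of_ne h0 with h1 | h1
    · have ht : t ≤ 0 := by
        by_contra hcon
        push Not at hcon
        nlinarith
      have hs : s ≤ 0 := by
        by_contra hcon
        push Not at hcon
        nlinarith
      exact ⟨div_nonneg_of_nonpos ht h1.le, (div_le_one_of_neg h1).2 (by linarith)⟩
    · have ht : 0 ≤ t := by
        by_contra hcon
        push Not at hcon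
        nlinarith
      have hs : 0 ≤ s := by
        by_contra hcon
        push Not at hcon
        nlinarith
      exact ⟨by positivity, (div_le_one h1).2 (by linarith)⟩

theorem norm_smul_integral_le {V : Type*} [NormedAddCommGroup V] [NormedSpace ℝ V] {k : ℝ → V}
    {C M t s θ : ℝ} (hθ : θ ∈ Icc (0 : ℝ) 1) (hs : |t| * (1 - θ) = |s|)
    (hk : ∀ τ ∈ Icc θ 1, ‖k τ‖ ≤ C * (M * |s|)) :
    ‖t • ∫ τ in θ..1, k τ‖ ≤ C * M * s ^ 2 := by
  have h1 := intervalIntegral.norm_integral_le_of_norm_le_const (a := θ) (b := 1)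
    (C := C * (M * |s|)) (f := k) (fun τ hτ => by
      rw [uIoc_of_le hθ.2] at hτ
      exact hk τ ⟨hτ.1.le, hτ.2⟩)
  rw [abs_of_nonneg (sub_nonneg.2 hθ.2)] at h1
  rw [norm_smul, Real.norm_eq_abs]
  calc |t| * ‖∫ τ in θ..1, k τ‖ ≤ |t| * (C * (M * |s|) * (1 - θ)) :=
        mul_le_mul_of_nonneg_left h1 (abs_nonneg _)
    _ = C * M * (|s| * (|t| * (1 - θ))) := by ring
    _ = C * M * s ^ 2 := by rw [hs, ← sq, sq_abs]

/-- A solution of the integral equations, along a short straight step in the characteristic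
direction that leads away from time `0`. -/
theorem Integrates.abs_step_le [CompleteSpace E] (h : T.Bounds α Λ LD LI Mc MD)
    (hf : T.Admits f N) (hff : T.Integrates f f) {i : Fin n} {z : ℝ × E} (hz : z ∈ T.K) {s : ℝ}
    (hsz : 0 ≤ s * z.1) (hz' : (z.1 + s, z.2 + s • T.field f i z) ∈ T.K) :
    |f (z.1 + s, z.2 + s • T.field f i z) i - f z i - s * T.rate f i z| ≤
      (N * (Λ * (1 + n * N)) + LD * (1 + n * N)) * (1 + 2 * Mc) * s ^ 2 := by
  have hΛ := h.Λ_nonneg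
  have hLD := h.LD_nonneg
  have hMc := h.Mc_nonneg
  have hN := hf.nonneg
  have hfield := hf.isField h i
  set H := Λ * (1 + n * N) with hH
  set R := LD * (1 + n * N) with hR
  have hH0 : 0 ≤ H := by positivity
  have hR0 : 0 ≤ R := by positivity
  set v := T.field f i z with hv
  set z' : ℝ × E := (z.1 + s, z.2 + s • v) with hz'def
  -- The characteristic through the end point `z'` covers only times between `0` and `z'.1`. It
  -- passes the time `z.1`, at the parameter `θ`, because the step leads away from time `0`.
  obtain ⟨θ, hθ, hθt⟩ := exists_time_ratio hsz
  have hs : z'.1 * (1 - θ) = s := by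
    have : z'.1 = z.1 + s := rfl
    rw [mul_sub, mul_one, mul_comm z'.1 θ, this, hθt]; ring
  have hs' : |z'.1| * (1 - θ) = |s| := by
    rw [← hs, abs_mul, abs_of_nonneg (sub_nonneg.2 hθ.2)]
  obtain ⟨η, hη⟩ := exists_char h hf i z' hz'
  have hvM : ‖v‖ ≤ Mc := hfield.bound z hz
  have hnear : ∀ τ ∈ Icc θ 1, |τ * z'.1 - z.1| + ‖η τ - z.2‖ ≤ (1 + 2 * Mc) * |s| := by
    intro τ hτ
    have hτ' := mem_unit_of_mem hθ hτ
    have h1 : |τ * z'.1 - z.1| ≤ |s| := by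
      have : τ * z'.1 - z.1 = (τ - θ) * z'.1 := by rw [sub_mul, ← hθt]
      rw [this, abs_mul, abs_of_nonneg (sub_nonneg.2 hτ.1), ← hs', mul_comm]
      exact mul_le_mul_of_nonneg_left (by linarith [hτ.2]) (abs_nonneg _)
    have h2 := hη.norm_sub_le_time hfield hτ' one_mem_unit
    have h3 : |z'.1| * (Mc * |τ - 1|) ≤ Mc * |s| := by
      rw [abs_sub_comm, abs_of_nonneg (sub_nonneg.2 hτ.2), ← hs']
      have : |z'.1| * (1 - τ) ≤ |z'.1| * (1 - θ) :=
        mul_le_mul_of_nonneg_left (by linarith [hτ.1]) (abs_nonneg _)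
      nlinarith
    have h4 : ‖η τ - z.2‖ ≤ ‖η τ - η 1‖ + ‖s • v‖ := by
      have : η τ - z.2 = (η τ - η 1) + s • v := by
        rw [hη.apply_one]; simp only [hz'def]; abel
      rw [this]
      exact norm_add_le _ _
    have h5 : ‖s • v‖ ≤ Mc * |s| := by
      rw [norm_smul, Real.norm_eq_abs, mul_comm]
      exact mul_le_mul_of_nonneg_right hvM (abs_nonneg _)
    linarith
  have hmem : ∀ τ ∈ Icc θ 1, (τ * z'.1, η τ) ∈ T.K := fun τ hτ =>
    hη.mem τ (mem_unit_of_mem hθ hτ)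
  have hcη := continuousOn_along hfield.continuousOn hη.cont hη.mem
  have hrη := continuousOn_along (hf.continuousOn_rate h i) hη.cont hη.mem
  -- At time `z.1` the characteristic through `z'` misses `z` by the integral of the velocity minus
  -- its value at `z`. The integrand is of order `|s|` over a time of length `|s|`, so the miss is
  -- of order `s ^ 2`.
  have h1 : η θ - z.2 = -(z'.1 • ∫ τ in θ..1, (T.field f i (τ * z'.1, η τ) - v)) := by
    rw [integral_sub_unit hcη continuousOn_const hθ one_mem_unit, hη.eq θ hθ,
      intervalIntegral.integral_const, smul_sub, smul_smul, hs]
    simp only [hz'def]; abel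
  have h2 : ‖η θ - z.2‖ ≤ H * (1 + 2 * Mc) * s ^ 2 := by
    rw [h1, norm_neg]
    refine norm_smul_integral_le hθ hs' fun τ hτ => ?_
    exact (hfield.lip _ (hmem τ hτ) z hz).trans (mul_le_mul_of_nonneg_left (hnear τ hτ) hH0)
  have h3 := hff.sub_eq h hf hz' hη hθ
  have hθz : θ * z'.1 = z.1 := hθt
  have h4 : |f (θ * z'.1, η θ) i - f z i| ≤ N * ‖η θ - z.2‖ := by
    have := hf.lip i _ (hη.mem θ hθ) z hz
    simpa [hθz] using this
  have h5 : f z' i - f z i - s * T.rate f i z = (f (θ * z'.1, η θ) i - f z i) +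
      z'.1 • ∫ τ in θ..1, (T.rate f i (τ * z'.1, η τ) - T.rate f i z) := by
    rw [integral_sub_unit hrη continuousOn_const hθ one_mem_unit,
      intervalIntegral.integral_const, smul_sub, smul_smul, hs, smul_eq_mul, smul_eq_mul, ← h3]
    ring
  have h6 : ‖z'.1 • ∫ τ in θ..1, (T.rate f i (τ * z'.1, η τ) - T.rate f i z)‖ ≤
      R * (1 + 2 * Mc) * s ^ 2 := by
    refine norm_smul_integral_le hθ hs' fun τ hτ => ?_
    exact (hf.rate_lip h i _ (hmem τ hτ) z hz).trans (mul_le_mul_of_nonneg_left (hnear τ hτ) hR0)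
  rw [h5]
  refine (abs_add_le _ _).trans ?_
  have h7 := mul_le_mul_of_nonneg_left h2 hN
  rw [Real.norm_eq_abs] at h6
  calc _ ≤ N * (H * (1 + 2 * Mc) * s ^ 2) + R * (1 + 2 * Mc) * s ^ 2 := by linarith
    _ = _ := by ring

/-- A solution of the integral equations has the right derivative in the characteristic direction,
wherever this derivative exists. -/
theorem Integrates.eq_rate [CompleteSpace E] (h : T.Bounds α Λ LD LI Mc MD)
    (hf : T.Admits f N) (hff : T.Integrates f f) {i : Fin n} {z : ℝ × E} (hzK : z ∈ T.K)
    (hK : ∀ᶠ s : ℝ in 𝓝 0, (z.1 + s, z.2 + s • T.field f i z) ∈ T.K) {δ : ℝ}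
    (hδ : HasDerivAt (fun s : ℝ => f (z.1 + s, z.2 + s • T.field f i z) i) δ 0) :
    δ = T.rate f i z := by
  set C := (N * (Λ * (1 + n * N)) + LD * (1 + n * N)) * (1 + 2 * Mc)
  -- Only steps away from time `0` are controlled, so the expansion gives a one-sided derivative. As
  -- `δ` is known to be a two-sided derivative, one side determines it.
  have key : ∀ S : Set ℝ, (∀ s ∈ S, 0 ≤ s * z.1) → UniqueDiffWithinAt ℝ S 0 →
      δ = T.rate f i z := by
    intro S hS huniq
    have h1 : HasDerivWithinAt (fun s : ℝ => f (z.1 + s, z.2 + s • T.field f i z) i)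
        (T.rate f i z) S 0 := by
      rw [hasDerivWithinAt_iff_isLittleO]
      have h2 : (fun s : ℝ => f (z.1 + s, z.2 + s • T.field f i z) i -
          f (z.1 + 0, z.2 + (0 : ℝ) • T.field f i z) i - (s - 0) • T.rate f i z)
          =O[𝓝[S] 0] fun s => s ^ 2 := by
        refine Asymptotics.IsBigO.of_bound C ?_
        filter_upwards [hK.filter_mono nhdsWithin_le_nhds, self_mem_nhdsWithin] with s hs hsS
        have := hff.abs_step_le h hf hzK (hS s hsS) hs
        simpa using this
      refine h2.trans_isLittleO ?_
      have h3 := (Asymptotics.isLittleO_pow_id (𝕜 := ℝ) (n := 2) (by norm_num))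
      simpa using h3.mono (nhdsWithin_le_nhds (s := S))
    exact huniq.eq_deriv _ hδ.hasDerivWithinAt h1
  rcases le_total 0 z.1 with h0 | h0
  · exact key (Ici 0) (fun s hs => mul_nonneg hs h0) (uniqueDiffWithinAt_Ici 0)
  · exact key (Iic 0) (fun s hs => mul_nonneg_of_nonpos_of_nonpos hs h0) (uniqueDiffWithinAt_Iic 0)

/-- An open part of the domain that is dense and invariant. -/
structure IsCore (T : Transport E n) (U : Set (ℝ × E)) : Prop where
  isOpen : IsOpen U
  subset : U ⊆ T.K
  back : ∀ z ∈ U, ∀ v ∈ T.vel, ∀ θ ∈ Icc (0 : ℝ) 1, (θ * z.1, z.2 - ((1 - θ) * z.1) • v) ∈ U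
  dense : T.K ⊆ closure U

/-- The curve differs from its tangent line by `o(u - τ)`, and a Lipschitz function cannot
distinguish the two to first order. Thus the derivative along the line is enough, even if `k` is not
differentiable at the point. -/
theorem hasDerivAt_along {K : Set (ℝ × E)} {k : ℝ × E → ℝ} {N : ℝ}
    (hk : ∀ z ∈ K, ∀ z' ∈ K, |k z - k z'| ≤ N * (|z.1 - z'.1| + ‖z.2 - z'.2‖))
    {γ : ℝ → ℝ × E} {τ t δ : ℝ} {v : E} (hγK : γ τ ∈ interior K)
    (hγ : HasDerivAt γ (t, t • v) τ)
    (hline : HasDerivAt (fun s : ℝ => k ((γ τ).1 + s, (γ τ).2 + s • v)) δ 0) :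
    HasDerivAt (fun u => k (γ u)) (t * δ) τ := by
  have hK := mem_interior_iff_mem_nhds.1 hγK
  set L : ℝ → ℝ × E := fun u => ((γ τ).1 + (u - τ) * t, (γ τ).2 + ((u - τ) * t) • v) with hL
  have hLK : ∀ᶠ u in 𝓝 τ, L u ∈ K := by
    have : ContinuousAt L τ := by fun_prop
    exact this.eventually_mem (by simpa [hL] using hK)
  have hγK' : ∀ᶠ u in 𝓝 τ, γ u ∈ K := hγ.continuousAt.eventually_mem hK
  have h1 : HasDerivAt (fun u => k (L u)) (t * δ) τ := by
    have h2 : HasDerivAt (fun u : ℝ => (u - τ) * t) t τ := by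
      simpa using ((hasDerivAt_id τ).sub_const τ).mul_const t
    have h3 : HasDerivAt (fun s : ℝ => k ((γ τ).1 + s, (γ τ).2 + s • v)) δ ((τ - τ) * t) := by
      simpa using hline
    have h4 := h3.comp τ h2
    rw [mul_comm] at h4
    exact h4
  rw [hasDerivAt_iff_isLittleO] at h1 hγ ⊢
  have h4 : (fun u => k (γ u) - k (L u)) =O[𝓝 τ]
      fun u => γ u - γ τ - (u - τ) • ((t, t • v) : ℝ × E) := by
    refine Asymptotics.IsBigO.of_bound (2 * |N|) ?_
    filter_upwards [hLK, hγK'] with u hu hu'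
    have h5 : γ u - γ τ - (u - τ) • ((t, t • v) : ℝ × E) = γ u - L u := by
      ext
      · simp [hL]; ring
      · simp [hL, smul_smul]; abel
    rw [h5, Real.norm_eq_abs]
    refine (hk _ hu' _ hu).trans ?_
    have h6 : |(γ u).1 - (L u).1| ≤ ‖γ u - L u‖ := norm_fst_le (γ u - L u)
    have h7 : ‖(γ u).2 - (L u).2‖ ≤ ‖γ u - L u‖ := norm_snd_le (γ u - L u)
    have h8 := mul_le_mul (le_abs_self N) (add_le_add h6 h7) (by positivity) (abs_nonneg N)
    linarith
  refine ((h4.trans_isLittleO hγ).add h1).congr_left fun u => ?_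
  have : k (L τ) = k (γ τ) := by simp [hL]
  rw [this]; ring

/-- A Lipschitz function with the right directional derivatives in a core solves the integral
equations. -/
theorem integrates_of_hasDerivAt [CompleteSpace E] (h : T.Bounds α Λ LD LI Mc MD)
    (hg : T.Admits g N) {U : Set (ℝ × E)} (hU : T.IsCore U)
    (hinit : ∀ x, ((0 : ℝ), x) ∈ T.K → g (0, x) = T.I x)
    (hder : ∀ i, ∀ z ∈ U, HasDerivAt (fun s : ℝ => g (z.1 + s, z.2 + s • T.field g i z) i)
      (T.rate g i z) 0) : T.Integrates g g := by
  have hN := hg.nonneg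
  have hLI := h.LI_nonneg
  have hα := h.α_nonneg
  have hΛ := h.Λ_nonneg
  have hLD := h.LD_nonneg
  have hMc := h.Mc_nonneg
  have hMD := h.MD_nonneg
  have hUint : U ⊆ interior T.K := hU.isOpen.subset_interior_iff.2 hU.subset
  -- Characteristics that end in the core stay in it, so the fundamental theorem of calculus applies
  -- along them.
  have core : ∀ i, ∀ z ∈ U, ∀ η, IsChar T.K (T.field g i) z η →
      g z i = T.I (η 0) i + z.1 * ∫ τ in (0 : ℝ)..1, T.rate g i (τ * z.1, η τ) := by
    intro i z hz η hη
    have hfield := hg.isField h i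
    have hcη := continuousOn_along hfield.continuousOn hη.cont hη.mem
    have hrη := continuousOn_along (hg.continuousOn_rate h i) hη.cont hη.mem
    have hmemU : ∀ θ ∈ Icc (0 : ℝ) 1, (θ * z.1, η θ) ∈ U := by
      intro θ hθ
      rw [hη.eq θ hθ]
      exact mem_of_back h.inv.vel_convex h.inv.vel_closed hz (hU.back z hz) hcη
        (fun τ hτ => hfield.mem _ (hη.mem τ hτ)) hθ
    have hcont : ContinuousOn (fun τ => g (τ * z.1, η τ) i) (Icc 0 1) :=
      continuousOn_along (g := fun z => g z i) (continuousOn_of_lip (H := N) (hg.lip i))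
        hη.cont hη.mem
    have hd : ∀ τ ∈ Ioo (0 : ℝ) 1, HasDerivAt (fun τ => g (τ * z.1, η τ) i)
        (z.1 * T.rate g i (τ * z.1, η τ)) τ := by
      intro τ hτ
      have hτ' : τ ∈ Icc (0 : ℝ) 1 := Ioo_subset_Icc_self hτ
      have hγ := hη.hasDerivAt_graph hfield.continuousOn hτ
      exact hasDerivAt_along (k := fun z => g z i) (hg.lip i) (hUint (hmemU τ hτ')) hγ
        (hder i _ (hmemU τ hτ'))
    have hint := intervalIntegral.integral_eq_sub_of_hasDerivAt_of_le zero_le_one hcont hd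
      (intervalIntegrable_of_continuousOn_unit (continuousOn_const.mul hrη) zero_mem_unit
        one_mem_unit)
    rw [intervalIntegral.integral_const_mul] at hint
    simp only [one_mul, zero_mul, hη.apply_one] at hint
    rw [hint, hinit (η 0) (Bounds.zero_mem hη)]
    ring
  intro i z hz η hη
  have hfield := hg.isField h i
  set H := Λ * (1 + n * N) with hH
  set R := LD * (1 + n * N) with hR
  have hH0 : 0 ≤ H := by positivity
  have hR0 : 0 ≤ R := by positivity
  set A := (1 + Mc + α * H) * Real.exp (α * H) with hA
  have hA0 : 0 ≤ A := by positivity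
  have hrη := continuousOn_along (hg.continuousOn_rate h i) hη.cont hη.mem
  -- At a general point of `K` the defect of the integral equation is bounded by a constant times
  -- the distance to any core point, since every ingredient depends on the end point in a Lipschitz
  -- way. Density of the core makes the defect vanish.
  have hclose : ∀ z' ∈ U, |g z i - (T.I (η 0) i + z.1 * ∫ τ in (0 : ℝ)..1,
      T.rate g i (τ * z.1, η τ))| ≤
      (N + LI * A + MD + α * R * (1 + A)) * (|z.1 - z'.1| + ‖z.2 - z'.2‖) := by
    intro z' hz'
    have hzK' := hU.subset hz'
    obtain ⟨ζ, hζ⟩ := exists_char h hg i z' hzK'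
    have hrζ := continuousOn_along (hg.continuousOn_rate h i) hζ.cont hζ.mem
    set δ := |z.1 - z'.1| + ‖z.2 - z'.2‖ with hδ
    have hδ0 : |z.1 - z'.1| ≤ δ := by simp [hδ]
    have hδ1 : 0 ≤ δ := (abs_nonneg _).trans hδ0
    have h1 := core i z' hz' ζ hζ
    have h2 : ∀ θ ∈ Icc (0 : ℝ) 1, ‖η θ - ζ θ‖ ≤ A * δ := fun θ hθ =>
      (hη.norm_sub_le_of_lip h.time hfield hz hzK' hζ hθ).trans_eq (by rw [hA]; ring)
    have h3 := hg.lip i z hz z' hzK'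
    have h4 := h.I_lip i _ (Bounds.zero_mem hη) _ (Bounds.zero_mem hζ)
    have h5 := mul_le_mul_of_nonneg_left (h2 0 zero_mem_unit) hLI
    have h6 : |(∫ τ in (0 : ℝ)..1, T.rate g i (τ * z.1, η τ)) -
        ∫ τ in (0 : ℝ)..1, T.rate g i (τ * z'.1, ζ τ)| ≤ R * (1 + A) * δ := by
      rw [← integral_sub_unit hrη hrζ zero_mem_unit one_mem_unit]
      have := intervalIntegral.norm_integral_le_of_norm_le_const (a := (0 : ℝ)) (b := 1)
        (C := R * (1 + A) * δ)
        (f := fun τ => T.rate g i (τ * z.1, η τ) - T.rate g i (τ * z'.1, ζ τ)) (fun τ hτ => by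
          rw [uIoc_of_le zero_le_one] at hτ
          have hτ' : τ ∈ Icc (0 : ℝ) 1 := Ioc_subset_Icc_self hτ
          rw [mul_assoc R]
          refine (hg.rate_lip h i _ (hη.mem τ hτ') _ (hζ.mem τ hτ')).trans
            (mul_le_mul_of_nonneg_left ?_ hR0)
          have h8 : |τ * z.1 - τ * z'.1| ≤ |z.1 - z'.1| := by
            rw [← mul_sub, abs_mul, abs_of_nonneg hτ'.1]
            exact mul_le_of_le_one_left (abs_nonneg _) hτ'.2
          have h9 := h2 τ hτ'
          simp only
          linarith)
      simpa using this
    have h7 := abs_integral_rate_le h hg hζ zero_mem_unit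
    rw [sub_zero, mul_one] at h7
    set P := ∫ τ in (0 : ℝ)..1, T.rate g i (τ * z.1, η τ)
    set P' := ∫ τ in (0 : ℝ)..1, T.rate g i (τ * z'.1, ζ τ)
    have h8 : g z i - (T.I (η 0) i + z.1 * P) =
        (g z i - g z' i) - (T.I (η 0) i - T.I (ζ 0) i) - (z.1 - z'.1) * P' - z.1 * (P - P') := by
      rw [h1]; ring
    have h9 : |(z.1 - z'.1) * P'| ≤ δ * MD := by
      rw [abs_mul]
      exact mul_le_mul hδ0 h7 (abs_nonneg _) hδ1
    have h10 : |z.1 * (P - P')| ≤ α * (R * (1 + A) * δ) := by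
      rw [abs_mul]
      exact mul_le_mul (h.time z hz) h6 (abs_nonneg _) hα
    rw [h8]
    have e1 := abs_sub (g z i - g z' i - (T.I (η 0) i - T.I (ζ 0) i) - (z.1 - z'.1) * P') (z.1 * (P - P'))
    have e2 := abs_sub (g z i - g z' i - (T.I (η 0) i - T.I (ζ 0) i)) ((z.1 - z'.1) * P')
    have e3 := abs_sub (g z i - g z' i) (T.I (η 0) i - T.I (ζ 0) i)
    have e4 : (N + LI * A + MD + α * R * (1 + A)) * δ =
      N * δ + LI * (A * δ) + δ * MD + α * (R * (1 + A) * δ) := by ring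
    rw [e4]
    linarith
  have hclosed : IsClosed {z' : ℝ × E | |g z i - (T.I (η 0) i + z.1 * ∫ τ in (0 : ℝ)..1,
      T.rate g i (τ * z.1, η τ))| ≤
      (N + LI * A + MD + α * R * (1 + A)) * (|z.1 - z'.1| + ‖z.2 - z'.2‖)} :=
    isClosed_le continuous_const (by fun_prop)
  have h0 := closure_minimal hclose hclosed (hU.dense hz)
  have h1 : |g z i - (T.I (η 0) i + z.1 * ∫ τ in (0 : ℝ)..1, T.rate g i (τ * z.1, η τ))| ≤ 0 := by
    refine le_of_le_of_eq h0 ?_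
    simp
  exact sub_eq_zero.1 (abs_nonpos_iff.1 h1)

/-- The statement about lines needs a globally Lipschitz function, so `g` is extended from `K` to
the whole space; near points of the open set `U` nothing changes. -/
theorem hasDerivAt_of_fderiv [FiniteDimensional ℝ E] (h : T.Bounds α Λ LD LI Mc MD)
    (hg : T.Admits g N) {U : Set (ℝ × E)} (hU : IsOpen U) (hUK : U ⊆ T.K)
    (hpde : ∀ z ∈ U, DifferentiableAt ℝ g z → ∀ i,
      fderiv ℝ g z (1, T.field g i z) i = T.rate g i z) (i : Fin n) {z : ℝ × E} (hz : z ∈ U) :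
    HasDerivAt (fun s : ℝ => g (z.1 + s, z.2 + s • T.field g i z) i) (T.rate g i z) 0 := by
  have hN := hg.nonneg
  have hlip : LipschitzOnWith (Real.toNNReal (2 * N)) g T.K := by
    refine LipschitzOnWith.of_dist_le_mul fun z hz z' hz' => ?_
    rw [Real.coe_toNNReal _ (by positivity)]
    refine (dist_pi_le_iff (by positivity)).2 fun j => ?_
    rw [Real.dist_eq]
    refine (hg.lip j z hz z' hz').trans ?_
    have h1 : |z.1 - z'.1| ≤ dist z z' := by rw [dist_eq_norm]; exact norm_fst_le (z - z')
    have h2 : ‖z.2 - z'.2‖ ≤ dist z z' := by rw [dist_eq_norm]; exact norm_snd_le (z - z')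
    nlinarith
  obtain ⟨k, hk, hkg⟩ := hlip.extend_pi
  have hkU : ∀ z ∈ U, k =ᶠ[𝓝 z] g := fun z hz => by
    filter_upwards [hU.mem_nhds hz] with z' hz' using (hkg (hUK hz')).symm
  have key := hasDerivAt_line (i := i) hk hU (b := fun z => (1, T.field g i z))
    (d := fun z => T.rate g i z)
    (continuousOn_const.prodMk ((hg.isField h i).continuousOn.mono hUK))
    ((hg.continuousOn_rate h i).mono hUK) (fun z hz hd => by
      rw [(hkU z hz).fderiv_eq]
      exact hpde z hz ((hkU z hz).differentiableAt_iff.1 hd) i) hz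
  refine key.congr_of_eventuallyEq ?_
  have hline : ContinuousAt (fun s : ℝ => (z.1 + s, z.2 + s • T.field g i z)) 0 := by fun_prop
  have hmem : ∀ᶠ s : ℝ in 𝓝 0, (z.1 + s, z.2 + s • T.field g i z) ∈ U :=
    hline.eventually_mem (by simpa using hU.mem_nhds hz)
  filter_upwards [hmem] with s hs
  have h1 : z + s • ((1, T.field g i z) : ℝ × E) = (z.1 + s, z.2 + s • T.field g i z) := by
    ext <;> simp
  rw [h1, hkg (hUK hs)]

end Transport

end ParamPDE

namespace ParamPDE

set_option linter.unusedSectionVars false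

open Filter

/-! ### Uniform difference quotients -/

section DifferenceQuotients

variable {Z F : Type*} [NormedAddCommGroup Z] [NormedSpace ℝ Z] [NormedAddCommGroup F]
  [NormedSpace ℝ F] {S : Set Z} {G : Z → F}

/-- The difference quotients of `G` along segments of `S` depend uniformly little on the length of
the segment. -/
def UniformDQ (S : Set Z) (G : Z → F) : Prop :=
  ∀ ε > 0, ∃ δ > 0, ∀ z ∈ S, ∀ h, z + h ∈ S → ‖h‖ ≤ δ → ∀ ρ : ℝ, 0 < ρ → ρ ≤ 1 →
    ‖(G (z + h) - G z) - ρ⁻¹ • (G (z + ρ • h) - G z)‖ ≤ ε * ‖h‖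

theorem add_smul_mem_of_convex (hS : Convex ℝ S) {z h : Z} (hz : z ∈ S) (hh : z + h ∈ S) {ρ : ℝ}
    (h0 : 0 ≤ ρ) (h1 : ρ ≤ 1) : z + ρ • h ∈ S :=
  hS.add_smul_mem hz hh ⟨h0, h1⟩

theorem exists_lipschitz_of_contDiffOn (hS : IsCompact S) (hconv : Convex ℝ S)
    (hint : (interior S).Nonempty) (hG : ContDiffOn ℝ 1 G S) :
    ∃ L, 0 ≤ L ∧ ∀ x ∈ S, ∀ y ∈ S, ‖G x - G y‖ ≤ L * ‖x - y‖ := by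
  have hu := uniqueDiffOn_convex hconv hint
  obtain ⟨L, hL⟩ := hS.exists_bound_of_continuousOn (hG.continuousOn_fderivWithin hu le_rfl)
  have hL0 : 0 ≤ L := by
    obtain ⟨x, hx⟩ := hint
    exact (norm_nonneg _).trans (hL x (interior_subset hx))
  exact ⟨L, hL0, fun x hx y hy => hconv.norm_image_sub_le_of_norm_fderivWithin_le
    (hG.differentiableOn one_ne_zero) hL hy hx⟩

/-- The linear part of `G` at `z` cancels between the two quotients. The remainder is at most `ε /
2` times the length, with one `δ` for all points, because the derivative is uniformly continuous on
the compact set. -/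
theorem uniformDQ_of_contDiffOn (hS : IsCompact S) (hconv : Convex ℝ S)
    (hint : (interior S).Nonempty) (hG : ContDiffOn ℝ 1 G S) : UniformDQ S G := by
  have hu := uniqueDiffOn_convex hconv hint
  have hunif := hS.uniformContinuousOn_of_continuous (hG.continuousOn_fderivWithin hu le_rfl)
  intro ε hε
  obtain ⟨δ, hδ, hδ'⟩ := Metric.uniformContinuousOn_iff.1 hunif (ε / 2) (by positivity)
  refine ⟨δ / 2, by positivity, fun z hz h hzh hh ρ hρ0 hρ1 => ?_⟩
  have key : ∀ k, z + k ∈ S → ‖k‖ ≤ δ / 2 →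
      ‖G (z + k) - G z - fderivWithin ℝ G S z k‖ ≤ ε / 2 * ‖k‖ := by
    intro k hk hkδ
    have hsub : S ∩ Metric.ball z δ ⊆ S := inter_subset_left
    have h1 := Convex.norm_image_sub_le_of_norm_hasFDerivWithin_le' (𝕜 := ℝ) (f := G)
      (f' := fderivWithin ℝ G S) (φ := fderivWithin ℝ G S z) (C := ε / 2)
      (s := S ∩ Metric.ball z δ) (x := z) (y := z + k)
      (fun x hx => (((hG.differentiableOn one_ne_zero) x hx.1).hasFDerivWithinAt).mono hsub)
      (fun x hx => by
        rw [← dist_eq_norm]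
        exact (hδ' x hx.1 z hz hx.2).le) (hconv.inter (convex_ball z δ))
      ⟨hz, Metric.mem_ball_self hδ⟩ ⟨hk, by rw [Metric.mem_ball, dist_eq_norm]; simp; linarith⟩
    simpa using h1
  have h1 := key h hzh hh
  have h2 := key (ρ • h) (add_smul_mem_of_convex hconv hz hzh hρ0.le hρ1) (by
    rw [norm_smul, Real.norm_eq_abs, abs_of_pos hρ0]
    exact (mul_le_of_le_one_left (norm_nonneg _) hρ1).trans hh)
  have h3 : (G (z + h) - G z) - ρ⁻¹ • (G (z + ρ • h) - G z) =
      (G (z + h) - G z - fderivWithin ℝ G S z h) -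
        ρ⁻¹ • (G (z + ρ • h) - G z - fderivWithin ℝ G S z (ρ • h)) := by
    rw [map_smul, smul_sub ρ⁻¹ (G (z + ρ • h) - G z), smul_smul, inv_mul_cancel₀ hρ0.ne', one_smul]
    abel
  rw [h3]
  refine (norm_sub_le _ _).trans ?_
  rw [norm_smul, norm_inv, Real.norm_eq_abs, abs_of_pos hρ0]
  rw [norm_smul, Real.norm_eq_abs, abs_of_pos hρ0] at h2
  have h4 : ρ⁻¹ * ‖G (z + ρ • h) - G z - fderivWithin ℝ G S z (ρ • h)‖ ≤ ε / 2 * ‖h‖ := by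
    rw [inv_mul_le_iff₀ hρ0]; linarith
  linarith

/-- Replacing the intermediate point `a + ρ (a' - a)` by an arbitrary `a''` costs `L` times the
distance of the two, divided by `ρ`. This quotient is the norm of `(a' - a) - ρ⁻¹ (a'' - a)`. The
lemma serves as a chain rule for the defect of difference quotients. -/
theorem three_point_le (hconv : Convex ℝ S) {L B ρ : ℝ}
    (hL : ∀ x ∈ S, ∀ y ∈ S, ‖G x - G y‖ ≤ L * ‖x - y‖) {a a' a'' : Z} (ha : a ∈ S) (ha' : a' ∈ S)
    (ha'' : a'' ∈ S) (hρ0 : 0 < ρ) (hρ1 : ρ ≤ 1)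
    (h1 : ‖(G a' - G a) - ρ⁻¹ • (G (a + ρ • (a' - a)) - G a)‖ ≤ B) :
    ‖(G a' - G a) - ρ⁻¹ • (G a'' - G a)‖ ≤ L * ‖(a' - a) - ρ⁻¹ • (a'' - a)‖ + B := by
  have h2 := hL _ (add_smul_mem_of_convex (h := a' - a) hconv ha (by simpa using ha') hρ0.le hρ1)
    a'' ha''
  have h3 : (G a' - G a) - ρ⁻¹ • (G a'' - G a) =
      ((G a' - G a) - ρ⁻¹ • (G (a + ρ • (a' - a)) - G a)) +
        ρ⁻¹ • (G (a + ρ • (a' - a)) - G a'') := by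
    generalize G (a + ρ • (a' - a)) = b
    simp only [smul_sub]; abel
  have h4 : a + ρ • (a' - a) - a'' = ρ • ((a' - a) - ρ⁻¹ • (a'' - a)) := by
    rw [smul_sub ρ (a' - a), smul_smul, mul_inv_cancel₀ hρ0.ne', one_smul]; abel
  rw [h4, norm_smul, Real.norm_eq_abs, abs_of_pos hρ0] at h2
  rw [h3]
  refine (norm_add_le _ _).trans ?_
  rw [norm_smul, norm_inv, Real.norm_eq_abs, abs_of_pos hρ0]
  have h5 : ρ⁻¹ * ‖G (a + ρ • (a' - a)) - G a''‖ ≤ L * ‖(a' - a) - ρ⁻¹ • (a'' - a)‖ := by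
    rw [inv_mul_le_iff₀ hρ0]; linarith
  linarith

/-- Difference quotients of `G` at the endpoints of triangles that are almost segments. -/
theorem UniformDQ.three_point (hconv : Convex ℝ S) (hG : UniformDQ S G) {L : ℝ}
    (hL : ∀ x ∈ S, ∀ y ∈ S, ‖G x - G y‖ ≤ L * ‖x - y‖) {ε : ℝ} (hε : 0 < ε) :
    ∃ δ > 0, ∀ a ∈ S, ∀ a' ∈ S, ∀ a'' ∈ S, ‖a' - a‖ ≤ δ → ∀ ρ : ℝ, 0 < ρ → ρ ≤ 1 →
      ‖(G a' - G a) - ρ⁻¹ • (G a'' - G a)‖ ≤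
        L * ‖(a' - a) - ρ⁻¹ • (a'' - a)‖ + ε * ‖a' - a‖ := by
  obtain ⟨δ, hδ, h⟩ := hG ε hε
  refine ⟨δ, hδ, fun a ha a' ha' a'' ha'' hle ρ hρ0 hρ1 => ?_⟩
  have h1 := h a ha (a' - a) (by simpa using ha') hle ρ hρ0 hρ1
  rw [add_sub_cancel] at h1
  exact three_point_le hconv hL ha ha' ha'' hρ0 hρ1 h1

/-- Let `ρ → 0` in the definition: the small-scale quotient becomes the derivative, while `δ` stays
independent of the point. -/
theorem UniformDQ.fderiv_le (hG : UniformDQ S G) {ε : ℝ} (hε : 0 < ε) :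
    ∃ δ > 0, ∀ z ∈ S, DifferentiableAt ℝ G z → ∀ w ∈ S, ‖w - z‖ ≤ δ →
      ‖G w - G z - fderiv ℝ G z (w - z)‖ ≤ ε * ‖w - z‖ := by
  obtain ⟨δ, hδ, h⟩ := hG ε hε
  refine ⟨δ, hδ, fun z hz hd w hw hwz => ?_⟩
  have h1 : HasDerivAt (fun t : ℝ => G (z + t • (w - z))) (fderiv ℝ G z (w - z)) 0 :=
    hd.hasFDerivAt.hasLineDerivAt (w - z)
  have h2 := (hasDerivAt_iff_tendsto_slope_zero.1 h1).mono_left (nhdsGT_le_nhdsNE 0)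
  simp only [zero_add, zero_smul, add_zero] at h2
  have h3 : Tendsto (fun ρ : ℝ => ‖(G w - G z) - ρ⁻¹ • (G (z + ρ • (w - z)) - G z)‖) (𝓝[>] 0)
      (𝓝 ‖G w - G z - fderiv ℝ G z (w - z)‖) := (h2.const_sub _).norm
  refine le_of_tendsto h3 ?_
  filter_upwards [Ioc_mem_nhdsGT (zero_lt_one' ℝ)] with ρ hρ
  simpa using h z hz (w - z) (by simpa using hw) hwz ρ hρ.1 hρ.2

/-- Lipschitz functions with uniform difference quotients are `C¹`, up to the boundary of a
convex body. -/
theorem UniformDQ.contDiffOn [FiniteDimensional ℝ Z] [FiniteDimensional ℝ F]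
    (hS : IsCompact S) (hconv : Convex ℝ S) (hint : (interior S).Nonempty) (hG : UniformDQ S G)
    {L : ℝ} (hL : ∀ x ∈ S, ∀ y ∈ S, ‖G x - G y‖ ≤ L * ‖x - y‖) : ContDiffOn ℝ 1 G S := by
  have hu := uniqueDiffOn_convex hconv hint
  set A := interior S ∩ {z | DifferentiableAt ℝ G z} with hA
  have hAS : A ⊆ S := inter_subset_left.trans interior_subset
  -- By Rademacher's theorem the interior points of differentiability are dense in the interior, and
  -- the interior of a convex body is dense in it.
  have hdense : S ⊆ closure A := by
    let _ : MeasurableSpace Z := borel Z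
    have _ : BorelSpace Z := ⟨rfl⟩
    have hlip : LipschitzOnWith (Real.toNNReal L) G S := by
      refine LipschitzOnWith.of_dist_le_mul fun x hx y hy => ?_
      rw [dist_eq_norm, dist_eq_norm]
      exact (hL x hx y hy).trans
        (mul_le_mul_of_nonneg_right (Real.le_coe_toNNReal L) (norm_nonneg _))
    have h1 := MeasureTheory.Measure.dense_of_ae
      (hlip.ae_differentiableWithinAt_of_mem (μ := MeasureTheory.Measure.addHaar))
    have h2 := h1.open_subset_closure_inter (isOpen_interior (s := S))
    have h3 : S ⊆ closure (interior S) := by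
      rw [hconv.closure_interior_eq_closure_of_nonempty_interior hint]
      exact subset_closure
    refine h3.trans (closure_minimal (h2.trans (closure_mono ?_)) isClosed_closure)
    rintro z ⟨hz, hd⟩
    exact ⟨hz, (hd (interior_subset hz)).differentiableAt (mem_interior_iff_mem_nhds.1 hz)⟩
  obtain ⟨x₀, hx₀⟩ := hint
  obtain ⟨r, hr, hball⟩ := Metric.isOpen_iff.1 isOpen_interior x₀ hx₀
  have hball' : ∀ k : Z, ‖k‖ < r → x₀ + k ∈ S := fun k hk => interior_subset (hball (by simpa using hk))
  obtain ⟨R, hR⟩ := hS.isBounded.exists_norm_le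
  have hR0 : 0 ≤ R := (norm_nonneg _).trans (hR x₀ (interior_subset hx₀))
  -- The derivatives at `z` and `z'` are compared through the same increment `h` at a fixed scale
  -- `s`, selected first. Each is within `ε₁ ‖h‖` of an increment of `G`, and the two increments
  -- differ by at most `2 |L| ‖z - z'‖`, which is small compared with `s` once `z` and `z'` are
  -- close.
  have hunif : ∀ ε > 0, ∃ δ > 0, ∀ z ∈ A, ∀ z' ∈ A, ‖z - z'‖ < δ →
      ‖fderiv ℝ G z - fderiv ℝ G z'‖ ≤ ε := by
    intro ε hε
    set R' := 2 * R + r with hR'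
    have hR'0 : 0 < R' := by positivity
    set ε₁ := ε * r / (32 * R') with hε₁
    have hε₁0 : 0 < ε₁ := by positivity
    obtain ⟨δ, hδ, hle⟩ := hG.fderiv_le hε₁0
    set s := min 1 (δ / R') with hs
    have hs0 : 0 < s := by positivity
    have hs1 : s ≤ 1 := min_le_left _ _
    have hsδ : s * R' ≤ δ := by rw [← le_div_iff₀ hR'0]; exact min_le_right _ _
    refine ⟨min (r / 2) (s * (ε * r / (32 * (|L| + 1)))), by positivity, fun z hz z' hz' hzz => ?_⟩
    have hzz1 : ‖z - z'‖ < r / 2 := hzz.trans_le (min_le_left _ _)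
    have hzz2 : |L| * ‖z - z'‖ ≤ s * (ε * r / 32) := by
      have h1 := (hzz.trans_le (min_le_right _ _)).le
      have h2 : s * (ε * r / (32 * (|L| + 1))) = s * (ε * r / 32) / (|L| + 1) := by
        field_simp
      rw [h2, le_div_iff₀ (by positivity)] at h1
      nlinarith [norm_nonneg (z - z'), abs_nonneg L]
    have key : ∀ k : Z, ‖k‖ < r / 2 →
        ‖(fderiv ℝ G z - fderiv ℝ G z') (x₀ + k - z)‖ ≤ ε * r / 8 := by
      intro k hk
      -- Pointing to a ball inside `S` keeps both `z + h` and `z' + h` in `S`, even when `z` is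
      -- close to the boundary.
      set h := s • (x₀ + k - z) with hh
      have hhn : ‖h‖ ≤ s * R' := by
        rw [hh, norm_smul, Real.norm_eq_abs, abs_of_pos hs0]
        refine mul_le_mul_of_nonneg_left ?_ hs0.le
        have h1 := hR x₀ (interior_subset hx₀)
        have h2 := hR z (hAS hz)
        have h3 := norm_sub_le (x₀ + k) z
        have h4 := norm_add_le x₀ k
        linarith
      have hzh : z + h ∈ S := hconv.add_smul_mem (hAS hz)
        (by simpa using hball' k (by linarith)) ⟨hs0.le, hs1⟩
      have hzh' : z' + h ∈ S := by
        refine hconv.add_smul_mem (hAS hz') ?_ ⟨hs0.le, hs1⟩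
        have h1 : z' + (x₀ + k - z) = x₀ + (k - (z - z')) := by abel
        rw [h1]
        exact hball' _ ((norm_sub_le _ _).trans_lt (by linarith))
      have e1 := hle z (hAS hz) hz.2 (z + h) hzh (by simpa using hhn.trans hsδ)
      have e2 := hle z' (hAS hz') hz'.2 (z' + h) hzh' (by simpa using hhn.trans hsδ)
      have e3 := hL _ hzh _ hzh'
      have e4 := hL _ (hAS hz) _ (hAS hz')
      simp only [add_sub_cancel_left, add_sub_add_right_eq_sub] at e1 e2 e3
      have e5 : (fderiv ℝ G z - fderiv ℝ G z') h = (G (z + h) - G (z' + h)) - (G z - G z') -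
          (G (z + h) - G z - fderiv ℝ G z h) + (G (z' + h) - G z' - fderiv ℝ G z' h) := by
        rw [_root_.sub_apply]; abel
      have e6 : ‖(fderiv ℝ G z - fderiv ℝ G z') h‖ ≤ s * (ε * r / 8) := by
        rw [e5]
        refine (norm_add_le _ _).trans ?_
        have e7 := norm_sub_le ((G (z + h) - G (z' + h)) - (G z - G z'))
          (G (z + h) - G z - fderiv ℝ G z h)
        have e8 := norm_sub_le (G (z + h) - G (z' + h)) (G z - G z')
        have e9 : L * ‖z - z'‖ ≤ |L| * ‖z - z'‖ :=
          mul_le_mul_of_nonneg_right (le_abs_self L) (norm_nonneg _)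
        have e10 : ε₁ * ‖h‖ ≤ s * (ε * r / 32) := by
          calc ε₁ * ‖h‖ ≤ ε₁ * (s * R') := mul_le_mul_of_nonneg_left hhn hε₁0.le
            _ = s * (ε * r / 32) := by rw [hε₁]; field_simp
        linarith
      rw [hh, map_smul, norm_smul, Real.norm_eq_abs, abs_of_pos hs0] at e6
      exact le_of_mul_le_mul_left e6 hs0
    -- The directions `x₀ + k - z` and `x₀ - z` differ by `k`, so the bounds for these two control
    -- every `k` in a shell, hence the operator norm.
    refine ContinuousLinearMap.opNorm_le_of_shell (c := (2 : ℝ)) (ε := r / 2) (by positivity) hε.le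
      (by norm_num) fun k hk1 hk2 => ?_
    have h1 := key k hk2
    have h2 := key 0 (by simpa using hr)
    have h3 : (fderiv ℝ G z - fderiv ℝ G z') k = (fderiv ℝ G z - fderiv ℝ G z') (x₀ + k - z) -
        (fderiv ℝ G z - fderiv ℝ G z') (x₀ + 0 - z) := by
      rw [← map_sub]; congr 1; abel
    rw [h3]
    refine (norm_sub_le _ _).trans ?_
    simp only [Real.norm_ofNat] at hk1
    nlinarith
  set p := extendFrom A (fderiv ℝ G) with hp
  have hlim : ∀ x ∈ S, ∃ y, Tendsto (fderiv ℝ G) (𝓝[A] x) (𝓝 y) := by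
    intro x hx
    have hne : (𝓝[A] x).NeBot := mem_closure_iff_nhdsWithin_neBot.1 (hdense hx)
    refine cauchy_map_iff_exists_tendsto.1 (Metric.cauchy_iff.2 ⟨hne.map _, fun ε hε => ?_⟩)
    obtain ⟨δ, hδ, hd⟩ := hunif (ε / 2) (by positivity)
    refine ⟨fderiv ℝ G '' (A ∩ Metric.ball x (δ / 2)), image_mem_map (inter_mem
      self_mem_nhdsWithin (nhdsWithin_le_nhds (Metric.ball_mem_nhds x (by positivity)))), ?_⟩
    rintro _ ⟨y, hy, rfl⟩ _ ⟨y', hy', rfl⟩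
    rw [dist_eq_norm]
    refine (hd y hy.1 y' hy'.1 ?_).trans_lt (by linarith)
    rw [← dist_eq_norm]
    have := dist_triangle_right y y' x
    have h1 := hy.2
    have h2 := hy'.2
    rw [Metric.mem_ball] at h1 h2
    linarith
  have hpc : ContinuousOn p S := continuousOn_extendFrom hdense hlim
  -- The first-order estimate at points of `A` has a uniform `δ`, so it survives the limit along `A`
  -- to any `x ∈ S`, boundary included, with the extended derivative `p x`.
  have hder : ∀ x ∈ S, HasFDerivWithinAt G (p x) S x := by
    intro x hx
    have hne : (𝓝[A] x).NeBot := mem_closure_iff_nhdsWithin_neBot.1 (hdense hx)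
    rw [hasFDerivWithinAt_iff_isLittleO, Asymptotics.isLittleO_iff]
    intro ε hε
    obtain ⟨δ, hδ, hle⟩ := hG.fderiv_le hε
    filter_upwards [self_mem_nhdsWithin, nhdsWithin_le_nhds (Metric.ball_mem_nhds x hδ)]
      with w hw hwx
    have hGx : Tendsto G (𝓝[A] x) (𝓝 (G x)) := by
      have : ContinuousWithinAt G S x := by
        rw [ContinuousWithinAt, tendsto_iff_norm_sub_tendsto_zero]
        refine squeeze_zero' (Eventually.of_forall fun _ => norm_nonneg _)
          (eventually_nhdsWithin_of_forall fun z hz => hL z hz x hx) ?_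
        have h1 : ContinuousAt (fun z : Z => L * ‖z - x‖) x := by fun_prop
        have h2 := h1.tendsto
        simp only [sub_self, norm_zero, mul_zero] at h2
        exact h2.mono_left nhdsWithin_le_nhds
      exact this.mono hAS
    have hid : Tendsto (fun z : Z => w - z) (𝓝[A] x) (𝓝 (w - x)) := by
      have h1 : ContinuousAt (fun z : Z => w - z) x := by fun_prop
      exact h1.tendsto.mono_left nhdsWithin_le_nhds
    have hpx : Tendsto (fderiv ℝ G) (𝓝[A] x) (𝓝 (p x)) := tendsto_extendFrom (hlim x hx)
    have hclm : Tendsto (fun z => fderiv ℝ G z (w - z)) (𝓝[A] x) (𝓝 (p x (w - x))) :=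
      (isBoundedBilinearMap_apply (𝕜 := ℝ) (E := Z) (F := F)).continuous.continuousAt.tendsto.comp
        (hpx.prodMk_nhds hid)
    refine le_of_tendsto_of_tendsto ((hGx.const_sub (G w)).sub hclm).norm (hid.norm.const_mul ε) ?_
    have hnear : ∀ᶠ z in 𝓝[A] x, ‖w - z‖ < δ :=
      hid.norm.eventually_lt_const (by rwa [Metric.mem_ball, dist_eq_norm] at hwx)
    filter_upwards [self_mem_nhdsWithin, hnear] with z hz hzδ
    exact hle z (hAS hz) hz.2 w hw hzδ.le
  have h0 : (1 : WithTop ℕ∞) = 0 + 1 := by norm_num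
  rw [h0, contDiffOn_succ_iff_fderivWithin hu]
  refine ⟨fun x hx => (hder x hx).differentiableWithinAt, by simp, ?_⟩
  rw [contDiffOn_zero]
  exact hpc.congr fun x hx => (hder x hx).fderivWithin (hu x hx)

end DifferenceQuotients

end ParamPDE

namespace ParamPDE

set_option linter.unusedSectionVars false

open Filter

/-! ### Solutions of smooth transport systems are continuously differentiable -/

/-- The difference of two difference quotients. -/
noncomputable def dq {F : Type*} [NormedAddCommGroup F] [NormedSpace ℝ F] (ρ : ℝ) (a a' a'' : F) : F :=
  (a' - a) - ρ⁻¹ • (a'' - a)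

/-- For the factors `t`, `t + s`, `t + ρ s`, the defect of the products is `t` times the defect of
the integrals plus `s` times `∫ (γ' - γ'')`. In the bound, the term with `C` gains `1 / lam` from
the exponential weight, and the term with `q` is left for Gronwall's inequality. -/
theorem norm_dq_integral_le {V : Type*} [NormedAddCommGroup V] [NormedSpace ℝ V]
    {γ γ' γ'' : ℝ → V} (hγ : ContinuousOn γ (Icc 0 1)) (hγ' : ContinuousOn γ' (Icc 0 1))
    (hγ'' : ContinuousOn γ'' (Icc 0 1)) {q : ℝ → ℝ} (hq : ContinuousOn q (Icc 0 1))
    (hq0 : ∀ τ, 0 ≤ q τ) {t s ρ α B C ε M lam : ℝ} (ht : |t| ≤ α) (hρ : 0 < ρ) (hB : 0 ≤ B)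
    (hC : 0 ≤ C) (hε : 0 ≤ ε) (hM : 0 ≤ M) (hlam : 0 < lam)
    (h1 : ∀ τ ∈ Icc (0 : ℝ) 1, ‖dq ρ (γ τ) (γ' τ) (γ'' τ)‖ ≤
      B * q τ + C * Real.exp (lam * |τ * t|) + ε)
    (h2 : ∀ τ ∈ Icc (0 : ℝ) 1, ‖γ' τ - γ'' τ‖ ≤ M) {θ : ℝ} (hθ : θ ∈ Icc (0 : ℝ) 1) :
    ‖dq ρ (t • ∫ τ in θ..1, γ τ) ((t + s) • ∫ τ in θ..1, γ' τ)
      ((t + ρ * s) • ∫ τ in θ..1, γ'' τ)‖ ≤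
      (C * Real.exp (lam * |t|) / lam + α * ε + |s| * M) + α * B * ∫ τ in θ..1, q τ := by
  have hi := fun {f : ℝ → V} (hf : ContinuousOn f (Icc 0 1)) =>
    intervalIntegrable_of_continuousOn_unit hf hθ one_mem_unit
  have e1 : dq ρ (t • ∫ τ in θ..1, γ τ) ((t + s) • ∫ τ in θ..1, γ' τ)
      ((t + ρ * s) • ∫ τ in θ..1, γ'' τ) =
      ∫ τ in θ..1, (t • dq ρ (γ τ) (γ' τ) (γ'' τ) + s • (γ' τ - γ'' τ)) := by
    unfold dq
    rw [intervalIntegral.integral_add, intervalIntegral.integral_smul,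
      intervalIntegral.integral_smul, intervalIntegral.integral_sub (hi hγ') (hi hγ''),
      intervalIntegral.integral_sub, intervalIntegral.integral_sub (hi hγ') (hi hγ),
      intervalIntegral.integral_smul, intervalIntegral.integral_sub (hi hγ'') (hi hγ)]
    · have e2 : ρ⁻¹ * (ρ * s) = s := by field_simp
      simp only [smul_sub, add_smul, smul_add, smul_smul, e2, mul_comm t ρ⁻¹]
      abel
    · exact hi (hγ'.sub hγ)
    · exact hi ((hγ''.sub hγ).const_smul _)
    · exact hi (((hγ'.sub hγ).sub ((hγ''.sub hγ).const_smul _)).const_smul _)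
    · exact hi ((hγ'.sub hγ'').const_smul _)
  rw [e1]
  have hexp : ContinuousOn (fun τ : ℝ => Real.exp (lam * |τ * t|)) (Icc 0 1) :=
    (Transport.continuous_exp_abs lam t).continuousOn
  have hg : ContinuousOn (fun τ => |t| * B * q τ + (|t| * C * Real.exp (lam * |τ * t|) +
      (α * ε + |s| * M))) (Icc 0 1) :=
    (continuousOn_const.mul hq).add ((continuousOn_const.mul hexp).add continuousOn_const)
  refine (norm_integral_le_integral_unit hθ hg fun τ hτ => ?_).trans ?_
  · have hτ' := mem_unit_of_mem hθ hτ
    refine (norm_add_le _ _).trans ?_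
    rw [norm_smul, norm_smul, Real.norm_eq_abs, Real.norm_eq_abs]
    have e2 := mul_le_mul_of_nonneg_left (h1 τ hτ') (abs_nonneg t)
    have e3 := mul_le_mul_of_nonneg_left (h2 τ hτ') (abs_nonneg s)
    have e4 := mul_le_mul_of_nonneg_right ht hε
    linarith
  · rw [integral_add_unit (f := fun τ => |t| * B * q τ)
        (g := fun τ => |t| * C * Real.exp (lam * |τ * t|) + (α * ε + |s| * M))
        (continuousOn_const.mul hq) ((continuousOn_const.mul hexp).add continuousOn_const) hθ
        one_mem_unit,
      integral_add_unit (f := fun τ => |t| * C * Real.exp (lam * |τ * t|))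
        (g := fun _ => α * ε + |s| * M) (continuousOn_const.mul hexp) continuousOn_const hθ
        one_mem_unit,
      intervalIntegral.integral_const, intervalIntegral.integral_const_mul,
      intervalIntegral.integral_const_mul]
    have hα : 0 ≤ α := (abs_nonneg t).trans ht
    have e2 := mul_le_mul_of_nonneg_left (Transport.mul_integral_exp_abs_le t hlam hθ) hC
    have e3 : 0 ≤ ∫ τ in θ..1, q τ := intervalIntegral.integral_nonneg hθ.2 fun τ _ => hq0 τ
    have e4 : |t| * B * ∫ τ in θ..1, q τ ≤ α * B * ∫ τ in θ..1, q τ :=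
      mul_le_mul_of_nonneg_right (mul_le_mul_of_nonneg_right ht hB) e3
    have e5 : (1 - θ) • (α * ε + |s| * M) ≤ α * ε + |s| * M := by
      rw [smul_eq_mul]
      exact mul_le_of_le_one_left (by positivity) (by linarith [hθ.1])
    have e6 : C * (Real.exp (lam * |t|) / lam) = C * Real.exp (lam * |t|) / lam := by ring
    linarith

namespace Transport

variable {E : Type*} [NormedAddCommGroup E] [NormedSpace ℝ E] {n : ℕ} {T : Transport E n}
  {α Λ LD LI Mc MD N : ℝ} {f g f' : ℝ × E → Fin n → ℝ}

/-- The domain of the initial values. -/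
def base (T : Transport E n) : Set E := {x | ((0 : ℝ), x) ∈ T.K}

/-- A transport system on a convex body, with data of class `C^k`. -/
structure IsSmooth (T : Transport E n) (k : ℕ) : Prop where
  b_pos : 0 < T.b
  convex : Convex ℝ T.K
  compact : IsCompact T.K
  nonempty_interior : (interior T.K).Nonempty
  base_interior : (interior T.base).Nonempty
  c : ∀ i, ContDiffOn ℝ k (T.c i) (T.K ×ˢ T.val)
  D : ∀ i, ContDiffOn ℝ k (T.D i) (T.K ×ˢ T.val)
  I : ∀ i, ContDiffOn ℝ k (fun x => T.I x i) T.base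

theorem IsSmooth.base_convex {k : ℕ} (hs : T.IsSmooth k) : Convex ℝ T.base := by
  intro x hx y hy a b ha hb hab
  have := hs.convex hx hy ha hb hab
  simpa [base] using this

theorem IsSmooth.base_compact {k : ℕ} (hs : T.IsSmooth k) : IsCompact T.base := by
  have : T.base = Prod.snd '' (T.K ∩ {z | z.1 = 0}) := by
    ext x
    constructor
    · intro hx
      exact ⟨(0, x), ⟨hx, rfl⟩, rfl⟩
    · rintro ⟨⟨t, x'⟩, ⟨hz, rfl⟩, rfl⟩
      exact hz
  rw [this]
  exact (hs.compact.inter_right (isClosed_eq continuous_fst continuous_const)).image continuous_snd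

theorem val_convex (T : Transport E n) : Convex ℝ T.val := convex_closedBall _ _

theorem val_compact (T : Transport E n) : IsCompact T.val := isCompact_closedBall _ _

theorem IsSmooth.val_interior {k : ℕ} (hs : T.IsSmooth k) : (interior T.val).Nonempty :=
  ⟨T.y₀, mem_interior_iff_mem_nhds.2 (Metric.closedBall_mem_nhds _ hs.b_pos)⟩

theorem IsSmooth.prod_convex {k : ℕ} (hs : T.IsSmooth k) : Convex ℝ (T.K ×ˢ T.val) :=
  hs.convex.prod T.val_convex

theorem IsSmooth.prod_compact {k : ℕ} (hs : T.IsSmooth k) : IsCompact (T.K ×ˢ T.val) :=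
  hs.compact.prod T.val_compact

theorem IsSmooth.prod_interior {k : ℕ} (hs : T.IsSmooth k) :
    (interior (T.K ×ˢ T.val)).Nonempty := by
  rw [interior_prod_eq]
  exact hs.nonempty_interior.prod hs.val_interior

theorem exists_pos_forall {P : Fin n → ℝ → Prop}
    (hP : ∀ i, ∃ δ > 0, ∀ δ' > 0, δ' ≤ δ → P i δ') : ∃ δ > 0, ∀ i, P i δ := by
  have h1 : ∀ᶠ δ in 𝓝[>] (0 : ℝ), ∀ i, P i δ := by
    refine eventually_all.2 fun i => ?_
    obtain ⟨δ, hδ, h⟩ := hP i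
    filter_upwards [Ioc_mem_nhdsGT hδ] with δ' hδ' using h δ' hδ'.1 hδ'.2
  obtain ⟨δ, h, hδ⟩ := (h1.and self_mem_nhdsWithin).exists
  exact ⟨δ, hδ, h⟩

theorem exists_common_bound {P : Fin n → ℝ → Prop} (hP : ∀ i, ∃ L, 0 ≤ L ∧ ∀ L', L ≤ L' → P i L') :
    ∃ L, 0 ≤ L ∧ ∀ L', L ≤ L' → ∀ i, P i L' := by
  choose L hL hP using hP
  obtain ⟨M, hM⟩ := Finite.exists_le L
  exact ⟨max M 0, le_max_right _ _, fun L' hL' i =>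
    hP i L' ((hM i).trans ((le_max_left _ _).trans hL'))⟩

theorem lipschitz_mono {Z F : Type*} [NormedAddCommGroup Z] [NormedAddCommGroup F] {S : Set Z}
    {G : Z → F} {L L' : ℝ} (h : ∀ x ∈ S, ∀ y ∈ S, ‖G x - G y‖ ≤ L * ‖x - y‖) (hL : L ≤ L') :
    ∀ x ∈ S, ∀ y ∈ S, ‖G x - G y‖ ≤ L' * ‖x - y‖ := fun x hx y hy =>
  (h x hx y hy).trans (mul_le_mul_of_nonneg_right hL (norm_nonneg _))

/-- A common Lipschitz constant of the data. -/
theorem IsSmooth.exists_lipschitz (hs : T.IsSmooth 1) : ∃ L, 0 ≤ L ∧ ∀ i,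
    (∀ x ∈ T.K ×ˢ T.val, ∀ y ∈ T.K ×ˢ T.val, ‖T.c i x - T.c i y‖ ≤ L * ‖x - y‖) ∧
    (∀ x ∈ T.K ×ˢ T.val, ∀ y ∈ T.K ×ˢ T.val, ‖T.D i x - T.D i y‖ ≤ L * ‖x - y‖) ∧
    (∀ x ∈ T.base, ∀ y ∈ T.base, ‖T.I x i - T.I y i‖ ≤ L * ‖x - y‖) := by
  obtain ⟨L, hL, h⟩ := exists_common_bound (P := fun i L =>
    (∀ x ∈ T.K ×ˢ T.val, ∀ y ∈ T.K ×ˢ T.val, ‖T.c i x - T.c i y‖ ≤ L * ‖x - y‖) ∧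
    (∀ x ∈ T.K ×ˢ T.val, ∀ y ∈ T.K ×ˢ T.val, ‖T.D i x - T.D i y‖ ≤ L * ‖x - y‖) ∧
    (∀ x ∈ T.base, ∀ y ∈ T.base, ‖T.I x i - T.I y i‖ ≤ L * ‖x - y‖)) (fun i => by
      obtain ⟨L₁, h₁, hc⟩ := exists_lipschitz_of_contDiffOn hs.prod_compact hs.prod_convex
        hs.prod_interior (hs.c i)
      obtain ⟨L₂, h₂, hD⟩ := exists_lipschitz_of_contDiffOn hs.prod_compact hs.prod_convex
        hs.prod_interior (hs.D i)
      obtain ⟨L₃, h₃, hI⟩ := exists_lipschitz_of_contDiffOn hs.base_compact hs.base_convex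
        hs.base_interior (hs.I i)
      refine ⟨L₁ + L₂ + L₃, by positivity, fun L' hL' => ⟨lipschitz_mono hc (by linarith),
        lipschitz_mono hD (by linarith), lipschitz_mono hI (by linarith)⟩⟩)
  exact ⟨L, hL, h L le_rfl⟩

/-- Uniform difference quotients of the data. -/
theorem IsSmooth.exists_three_point (hs : T.IsSmooth 1) {L : ℝ} (hL : ∀ i,
    (∀ x ∈ T.K ×ˢ T.val, ∀ y ∈ T.K ×ˢ T.val, ‖T.c i x - T.c i y‖ ≤ L * ‖x - y‖) ∧
    (∀ x ∈ T.K ×ˢ T.val, ∀ y ∈ T.K ×ˢ T.val, ‖T.D i x - T.D i y‖ ≤ L * ‖x - y‖) ∧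
    (∀ x ∈ T.base, ∀ y ∈ T.base, ‖T.I x i - T.I y i‖ ≤ L * ‖x - y‖)) {ε : ℝ} (hε : 0 < ε) :
    ∃ δ > 0, ∀ i,
      (∀ a ∈ T.K ×ˢ T.val, ∀ a' ∈ T.K ×ˢ T.val, ∀ a'' ∈ T.K ×ˢ T.val, ‖a' - a‖ ≤ δ → ∀ ρ : ℝ,
        0 < ρ → ρ ≤ 1 → ‖dq ρ (T.c i a) (T.c i a') (T.c i a'')‖ ≤
          L * ‖dq ρ a a' a''‖ + ε * ‖a' - a‖) ∧
      (∀ a ∈ T.K ×ˢ T.val, ∀ a' ∈ T.K ×ˢ T.val, ∀ a'' ∈ T.K ×ˢ T.val, ‖a' - a‖ ≤ δ → ∀ ρ : ℝ,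
        0 < ρ → ρ ≤ 1 → ‖dq ρ (T.D i a) (T.D i a') (T.D i a'')‖ ≤
          L * ‖dq ρ a a' a''‖ + ε * ‖a' - a‖) ∧
      (∀ a ∈ T.base, ∀ a' ∈ T.base, ∀ a'' ∈ T.base, ‖a' - a‖ ≤ δ → ∀ ρ : ℝ,
        0 < ρ → ρ ≤ 1 → ‖dq ρ (T.I a i) (T.I a' i) (T.I a'' i)‖ ≤
          L * ‖dq ρ a a' a''‖ + ε * ‖a' - a‖) := by
  refine exists_pos_forall fun i => ?_
  obtain ⟨δ₁, hδ₁, h₁⟩ := (uniformDQ_of_contDiffOn hs.prod_compact hs.prod_convex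
    hs.prod_interior (hs.c i)).three_point hs.prod_convex (hL i).1 hε
  obtain ⟨δ₂, hδ₂, h₂⟩ := (uniformDQ_of_contDiffOn hs.prod_compact hs.prod_convex
    hs.prod_interior (hs.D i)).three_point hs.prod_convex (hL i).2.1 hε
  obtain ⟨δ₃, hδ₃, h₃⟩ := (uniformDQ_of_contDiffOn hs.base_compact hs.base_convex
    hs.base_interior (hs.I i)).three_point hs.base_convex (hL i).2.2 hε
  refine ⟨min δ₁ (min δ₂ δ₃), by positivity, fun δ hδ hle => ⟨?_, ?_, ?_⟩⟩
  · exact fun a ha a' ha' a'' ha'' h => h₁ a ha a' ha' a'' ha'' (h.trans (hle.trans (min_le_left _ _)))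
  · exact fun a ha a' ha' a'' ha'' h => h₂ a ha a' ha' a'' ha''
      (h.trans (hle.trans ((min_le_right _ _).trans (min_le_left _ _))))
  · exact fun a ha a' ha' a'' ha'' h => h₃ a ha a' ha' a'' ha''
      (h.trans (hle.trans ((min_le_right _ _).trans (min_le_right _ _))))

/-- The difference quotients of `f` at small scales are uniform up to an error `c`, in a weighted
norm. -/
def QuasiDQ (T : Transport E n) (f : ℝ × E → Fin n → ℝ) (lam c : ℝ) : Prop :=
  ∃ δ > 0, ∀ z ∈ T.K, ∀ z' ∈ T.K, ‖z' - z‖ ≤ δ → ∀ ρ : ℝ, 0 < ρ → ρ ≤ 1 →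
    ‖dq ρ (f z) (f z') (f (z + ρ • (z' - z)))‖ ≤ c * Real.exp (lam * |z.1|) * ‖z' - z‖

theorem Admits.norm_sub_le (hf : T.Admits f N) {z z' : ℝ × E} (hz : z ∈ T.K) (hz' : z' ∈ T.K) :
    ‖f z - f z'‖ ≤ 2 * N * ‖z - z'‖ := by
  have hN := hf.nonneg
  rw [pi_norm_le_iff_of_nonneg (by positivity)]
  intro i
  have h1 : |z.1 - z'.1| ≤ ‖z - z'‖ := norm_fst_le (z - z')
  have h2 : ‖z.2 - z'.2‖ ≤ ‖z - z'‖ := norm_snd_le (z - z')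
  refine (hf.lip i z hz z' hz').trans ?_
  nlinarith

set_option maxHeartbeats 1000000 in
-- Compare the characteristics through `z`, `z'` and the intermediate point `z''`. The defect of the
-- curves satisfies a Gronwall inequality whose source contains the defect of `f` along them,
-- bounded by the hypothesis with constant `c`. Integration of the exponential weight divides that
-- contribution by `lam`, so a large `lam` returns at most `c / 2`. The other contributions are
-- small relative to the segment.
theorem exists_quasiDQ_step [CompleteSpace E] (h : T.Bounds α Λ LD LI Mc MD) (hs : T.IsSmooth 1)
    (hf : T.Admits f N) (hff : T.Integrates f f) : ∃ lam > 0, ∀ c ≥ 0, T.QuasiDQ f lam c →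
      ∀ ε > 0, T.QuasiDQ f lam (ε + c / 2) := by
  have hα := h.α_nonneg
  have hN := hf.nonneg
  have hMc := h.Mc_nonneg
  have hΛ := h.Λ_nonneg
  obtain ⟨L, hL0, hL⟩ := hs.exists_lipschitz
  set H := Λ * (1 + n * N) with hH
  have hH0 : 0 ≤ H := by positivity
  set A₀ := (1 + Mc + α * H) * Real.exp (α * H) with hA₀
  have hA₀0 : 0 ≤ A₀ := by positivity
  set A := 1 + 2 * A₀ with hA
  have hA1 : 1 ≤ A := by linarith
  set A₂ := A + 2 * N * A with hA₂
  have hA₂0 : A ≤ A₂ := by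
    have : 0 ≤ 2 * N * A := by positivity
    linarith
  set B := L * (1 + 2 * N) with hB
  have hB0 : 0 ≤ B := by positivity
  set Γ := (L + α * B) * Real.exp (α * B) + 1 with hΓ
  have hΓ0 : 1 ≤ Γ := by
    have : 0 ≤ (L + α * B) * Real.exp (α * B) := by positivity
    linarith
  -- `A` bounds the spreading of characteristics, `A₂` also that of the values along them, and `Γ`
  -- the loss in Gronwall's inequality together with the data. Their product with `L` is the total
  -- factor of `c`, halved by this choice of `lam`.
  set lam := 2 * (Γ * (L * A)) + 1 with hlam
  have hlam0 : 0 < lam := by positivity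
  refine ⟨lam, hlam0, fun c hc hQ ε hε => ?_⟩
  obtain ⟨δc, hδc, hQ⟩ := hQ
  set ε₁ := ε / (2 * (Γ * (α * A₂) + A)) with hε₁
  have hε₁0 : 0 < ε₁ := by positivity
  obtain ⟨δ₁, hδ₁, h3⟩ := hs.exists_three_point hL hε₁0
  -- The first two entries keep points on the curves, and their values, within reach of the
  -- hypothesis and of the three-point estimates for the data. The third makes the term from the
  -- time difference `|k.1|` at most `ε / 2` times the length.
  set δ := min (min (δc / A) (δ₁ / A₂)) (ε / (2 * (Γ * (L * A₂) + 1))) with hδ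
  have hA₂pos : 0 < A₂ := by linarith
  refine ⟨δ, by positivity, fun z hz z' hz' hzδ ρ hρ0 hρ1 => ?_⟩
  set k := z' - z with hk
  set z'' := z + ρ • k with hz''def
  have hz'' : z'' ∈ T.K := add_smul_mem_of_convex hs.convex hz (by simpa [hk] using hz') hρ0.le hρ1
  have hk1 : A * ‖k‖ ≤ δc := by
    have := hzδ.trans ((min_le_left _ _).trans (min_le_left _ _))
    rw [le_div_iff₀ (by positivity)] at this
    linarith
  have hk2 : A₂ * ‖k‖ ≤ δ₁ := by
    have := hzδ.trans ((min_le_left _ _).trans (min_le_right _ _))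
    rw [le_div_iff₀ (by positivity)] at this
    linarith
  have hk3 : ‖k‖ ≤ ε / (2 * (Γ * (L * A₂) + 1)) := hzδ.trans (min_le_right _ _)
  have ht' : z'.1 = z.1 + k.1 := by simp [hk]
  have ht'' : z''.1 = z.1 + ρ * k.1 := by simp [hz''def]
  have hk0 : |k.1| ≤ ‖k‖ := norm_fst_le k
  set e := Real.exp (lam * |z.1|) with he
  have he1 : 1 ≤ e := Real.one_le_exp (by positivity)
  rw [pi_norm_le_iff_of_nonneg (by positivity)]
  intro i
  have hfield := hf.isField h i
  obtain ⟨η, hη⟩ := exists_char h hf i z hz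
  obtain ⟨η', hη'⟩ := exists_char h hf i z' hz'
  obtain ⟨η'', hη''⟩ := exists_char h hf i z'' hz''
  have hpair : ∀ {a b : ℝ × E} {ζ ξ : ℝ → E}, a ∈ T.K → b ∈ T.K →
      IsChar T.K (T.field f i) a ζ → IsChar T.K (T.field f i) b ξ → ‖a - b‖ ≤ ‖k‖ →
      ∀ θ ∈ Icc (0 : ℝ) 1, ‖ζ θ - ξ θ‖ ≤ A * ‖k‖ ∧
        ‖((θ * a.1, ζ θ) : ℝ × E) - (θ * b.1, ξ θ)‖ ≤ A * ‖k‖ := by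
    intro a b ζ ξ ha hb hζ hξ hab θ hθ
    have h1 := hζ.norm_sub_le_of_lip h.time hfield ha hb hξ hθ
    have h2 : |a.1 - b.1| ≤ ‖a - b‖ := norm_fst_le (a - b)
    have h3 : ‖a.2 - b.2‖ ≤ ‖a - b‖ := norm_snd_le (a - b)
    have h4 : ‖ζ θ - ξ θ‖ ≤ A * ‖k‖ := by
      have h5 : |a.1 - b.1| + ‖a.2 - b.2‖ ≤ 2 * ‖k‖ := by linarith
      have h6 := mul_le_mul_of_nonneg_left h5 hA₀0
      have h7 : (1 + Mc + α * H) * (|a.1 - b.1| + ‖a.2 - b.2‖) * Real.exp (α * H) =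
        A₀ * (|a.1 - b.1| + ‖a.2 - b.2‖) := by rw [hA₀]; ring
      rw [h7] at h1
      have h8 := norm_nonneg k
      rw [hA]
      linarith
    refine ⟨h4, ?_⟩
    rw [Prod.norm_def]
    refine max_le ?_ h4
    simp only [Prod.fst_sub, Real.norm_eq_abs]
    rw [← mul_sub, abs_mul, abs_of_nonneg hθ.1]
    have h5 : θ * |a.1 - b.1| ≤ |a.1 - b.1| := mul_le_of_le_one_left (abs_nonneg _) hθ.2
    have h6 : ‖k‖ ≤ A * ‖k‖ := le_mul_of_one_le_left (norm_nonneg _) hA1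
    linarith
  have hpair1 := hpair hz' hz hη' hη (by rw [← hk])
  have hpair2 := hpair hz' hz'' hη' hη'' (by
    have : z' - z'' = (1 - ρ) • k := by rw [hz''def, sub_smul, one_smul, hk]; abel
    rw [this, norm_smul, Real.norm_eq_abs, abs_of_nonneg (by linarith)]
    exact mul_le_of_le_one_left (norm_nonneg _) (by linarith))
  set q : ℝ → ℝ := fun τ => ‖dq ρ (η τ) (η' τ) (η'' τ)‖ with hq
  have hqc : ContinuousOn q (Icc 0 1) :=
    ((hη'.cont.sub hη.cont).sub ((hη''.cont.sub hη.cont).const_smul _)).norm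
  have hq0 : ∀ τ, 0 ≤ q τ := fun τ => norm_nonneg _
  set C := L * (c * (A * ‖k‖)) with hC
  have hC0 : 0 ≤ C := by positivity
  have hfn : ∀ x ∈ T.K, ∀ y ∈ T.K, ‖f x - f y‖ ≤ 2 * N * ‖x - y‖ := fun x hx y hy =>
    hf.norm_sub_le hx hy
  have hargs : ∀ τ ∈ Icc (0 : ℝ) 1,
      ‖dq ρ ((τ * z.1, η τ), f (τ * z.1, η τ)) ((τ * z'.1, η' τ), f (τ * z'.1, η' τ))
        ((τ * z''.1, η'' τ), f (τ * z''.1, η'' τ))‖ ≤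
        (1 + 2 * N) * q τ + c * (A * ‖k‖) * Real.exp (lam * |τ * z.1|) := by
    intro τ hτ
    have m := hη.mem τ hτ
    have m' := hη'.mem τ hτ
    have m'' := hη''.mem τ hτ
    -- The time components have no defect: `z''` divides the segment from `z` to `z'` in the ratio
    -- `ρ`, and times at equal parameters keep this ratio.
    have h1 : ‖dq ρ ((τ * z.1, η τ) : ℝ × E) (τ * z'.1, η' τ) (τ * z''.1, η'' τ)‖ = q τ := by
      have h2 : dq ρ ((τ * z.1, η τ) : ℝ × E) (τ * z'.1, η' τ) (τ * z''.1, η'' τ) =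
          (0, dq ρ (η τ) (η' τ) (η'' τ)) := by
        unfold dq
        ext
        · simp only [Prod.fst_sub, Prod.smul_fst, smul_eq_mul, ht', ht'']
          field_simp
          ring
        · simp
      rw [h2, Prod.norm_def]
      simp [hq]
    have h2 := hQ _ m _ m' ((hpair1 τ hτ).2.trans hk1) ρ hρ0 hρ1
    have h3 : c * Real.exp (lam * |τ * z.1|) *
        ‖((τ * z'.1, η' τ) : ℝ × E) - (τ * z.1, η τ)‖ ≤
        c * (A * ‖k‖) * Real.exp (lam * |τ * z.1|) := by
      have := mul_le_mul_of_nonneg_left (hpair1 τ hτ).2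
        (mul_nonneg hc (Real.exp_pos (lam * |τ * z.1|)).le)
      linarith
    have h4 := three_point_le hs.convex hfn m m' m'' hρ0 hρ1 (h2.trans h3)
    change ‖dq ρ (f _) (f _) (f _)‖ ≤ 2 * N * ‖dq ρ _ _ _‖ + _ at h4
    rw [h1] at h4
    have h5 : dq ρ ((τ * z.1, η τ), f (τ * z.1, η τ)) ((τ * z'.1, η' τ), f (τ * z'.1, η' τ))
        ((τ * z''.1, η'' τ), f (τ * z''.1, η'' τ)) =
        (dq ρ ((τ * z.1, η τ) : ℝ × E) (τ * z'.1, η' τ) (τ * z''.1, η'' τ),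
          dq ρ (f (τ * z.1, η τ)) (f (τ * z'.1, η' τ)) (f (τ * z''.1, η'' τ))) := rfl
    rw [h5, Prod.norm_def]
    have h6 : 0 ≤ c * (A * ‖k‖) * Real.exp (lam * |τ * z.1|) := by positivity
    have h7 : 0 ≤ 2 * N * q τ := mul_nonneg (by positivity) (hq0 τ)
    refine max_le ?_ ?_
    · simp only [h1]; linarith
    · simp only; linarith [hq0 τ]
  have hmemP : ∀ {ζ : ℝ × E}, ζ ∈ T.K → (ζ, f ζ) ∈ T.K ×ˢ T.val := fun hζ => ⟨hζ, hf.maps _ hζ⟩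
  have hdist : ∀ {ζ ξ : ℝ × E}, ζ ∈ T.K → ξ ∈ T.K → ‖ζ - ξ‖ ≤ A * ‖k‖ →
      ‖((ζ, f ζ) : (ℝ × E) × (Fin n → ℝ)) - (ξ, f ξ)‖ ≤ A₂ * ‖k‖ := by
    intro ζ ξ hζ hξ hle
    rw [Prod.norm_def]
    have h1 := hfn _ hζ _ hξ
    have h2 := mul_le_mul_of_nonneg_left hle (by positivity : 0 ≤ 2 * N)
    refine max_le ?_ ?_
    · exact hle.trans (mul_le_mul_of_nonneg_right hA₂0 (norm_nonneg _))
    · refine h1.trans (h2.trans ?_)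
      rw [hA₂]
      have : 0 ≤ A * ‖k‖ := by positivity
      linarith
  have gen1 : ∀ τ ∈ Icc (0 : ℝ) 1, ∀ X : ℝ,
      (‖((τ * z'.1, η' τ), f (τ * z'.1, η' τ)) - ((τ * z.1, η τ), f (τ * z.1, η τ))‖ ≤ δ₁ →
        X ≤ L * ‖dq ρ ((τ * z.1, η τ), f (τ * z.1, η τ)) ((τ * z'.1, η' τ), f (τ * z'.1, η' τ))
        ((τ * z''.1, η'' τ), f (τ * z''.1, η'' τ))‖ +
        ε₁ * ‖((τ * z'.1, η' τ), f (τ * z'.1, η' τ)) - ((τ * z.1, η τ), f (τ * z.1, η τ))‖) →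
      X ≤ B * q τ + C * Real.exp (lam * |τ * z.1|) + ε₁ * (A₂ * ‖k‖) := by
    intro τ hτ X hX
    have h1 := hdist (hη'.mem τ hτ) (hη.mem τ hτ) (hpair1 τ hτ).2
    have h2 := hX (h1.trans hk2)
    have h3 := mul_le_mul_of_nonneg_left (hargs τ hτ) hL0
    have h4 := mul_le_mul_of_nonneg_left h1 hε₁0.le
    rw [hB, hC]
    linarith
  have gen2 : ∀ τ ∈ Icc (0 : ℝ) 1,
      L * ‖((τ * z'.1, η' τ), f (τ * z'.1, η' τ)) - ((τ * z''.1, η'' τ), f (τ * z''.1, η'' τ))‖ ≤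
        L * (A₂ * ‖k‖) := fun τ hτ =>
    mul_le_mul_of_nonneg_left (hdist (hη'.mem τ hτ) (hη''.mem τ hτ) (hpair2 τ hτ).2) hL0
  set P := C * e / lam + α * (ε₁ * (A₂ * ‖k‖)) + |k.1| * (L * (A₂ * ‖k‖)) with hP
  have hP0 : 0 ≤ P := by positivity
  have cc := continuousOn_along hfield.continuousOn hη.cont hη.mem
  have cc' := continuousOn_along hfield.continuousOn hη'.cont hη'.mem
  have cc'' := continuousOn_along hfield.continuousOn hη''.cont hη''.mem
  have dd := continuousOn_along (hf.continuousOn_rate h i) hη.cont hη.mem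
  have dd' := continuousOn_along (hf.continuousOn_rate h i) hη'.cont hη'.mem
  have dd'' := continuousOn_along (hf.continuousOn_rate h i) hη''.cont hη''.mem
  have hεA : 0 ≤ ε₁ * (A₂ * ‖k‖) := by positivity
  have hLA : 0 ≤ L * (A₂ * ‖k‖) := by positivity
  have hqle : ∀ θ ∈ Icc (0 : ℝ) 1, q θ ≤ P * Real.exp (α * B) := by
    have h1 : ∀ θ ∈ Icc (0 : ℝ) 1, q θ ≤ P + α * B * ∫ τ in θ..1, q τ := by
      intro θ hθ
      have h2 := norm_dq_integral_le cc cc' cc'' hqc hq0 (s := k.1) (h.time z hz) hρ0 hB0 hC0 hεA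
        hLA hlam0 (fun τ hτ => gen1 τ hτ _ fun hle => (h3 i).1 _ (hmemP (hη.mem τ hτ)) _
          (hmemP (hη'.mem τ hτ)) _ (hmemP (hη''.mem τ hτ)) hle ρ hρ0 hρ1)
        (fun τ hτ => ((hL i).1 _ (hmemP (hη'.mem τ hτ)) _ (hmemP (hη''.mem τ hτ))).trans
          (gen2 τ hτ)) hθ
      refine le_of_eq_of_le ?_ h2
      have h4 : dq ρ (η θ) (η' θ) (η'' θ) = -dq ρ (z.1 • ∫ τ in θ..1, T.field f i (τ * z.1, η τ))
          ((z.1 + k.1) • ∫ τ in θ..1, T.field f i (τ * z'.1, η' τ))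
          ((z.1 + ρ * k.1) • ∫ τ in θ..1, T.field f i (τ * z''.1, η'' τ)) := by
        have h5 : z'.2 = z.2 + k.2 := by simp [hk]
        have h6 : z''.2 = z.2 + ρ • k.2 := by simp [hz''def]
        rw [hη.eq θ hθ, hη'.eq θ hθ, hη''.eq θ hθ, h5, h6]
        unfold dq
        simp only [ht', ht'', smul_sub, smul_add, smul_smul, inv_mul_cancel₀ hρ0.ne', one_smul]
        abel
      simp only [hq, h4, norm_neg]
    intro θ hθ
    refine (gronwall_backward_const hqc (by positivity) h1 θ hθ).trans ?_
    refine mul_le_mul_of_nonneg_left (Real.exp_le_exp.2 ?_) hP0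
    exact mul_le_of_le_one_right (by positivity) (by linarith [hθ.1])
  have hI1 := (h3 i).2.2 (η 0) (Bounds.zero_mem hη) (η' 0) (Bounds.zero_mem hη') (η'' 0)
    (Bounds.zero_mem hη'') ((hpair1 0 zero_mem_unit).1.trans
      ((mul_le_mul_of_nonneg_right hA₂0 (norm_nonneg _)).trans hk2)) ρ hρ0 hρ1
  have hD1 := norm_dq_integral_le dd dd' dd'' hqc hq0 (s := k.1) (h.time z hz) hρ0 hB0 hC0 hεA
    hLA hlam0 (fun τ hτ => gen1 τ hτ _ fun hle => (h3 i).2.1 _ (hmemP (hη.mem τ hτ)) _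
      (hmemP (hη'.mem τ hτ)) _ (hmemP (hη''.mem τ hτ)) hle ρ hρ0 hρ1)
    (fun τ hτ => ((hL i).2.1 _ (hmemP (hη'.mem τ hτ)) _ (hmemP (hη''.mem τ hτ))).trans
      (gen2 τ hτ)) zero_mem_unit
  have hqint : ∫ τ in (0 : ℝ)..1, q τ ≤ P * Real.exp (α * B) := by
    have := integral_mono_unit zero_mem_unit hqc continuousOn_const (fun τ hτ => hqle τ hτ)
    simpa using this
  have hsplit : dq ρ (f z) (f z') (f z'') i = dq ρ (T.I (η 0) i) (T.I (η' 0) i) (T.I (η'' 0) i) +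
      dq ρ (z.1 • ∫ τ in (0 : ℝ)..1, T.rate f i (τ * z.1, η τ))
        ((z.1 + k.1) • ∫ τ in (0 : ℝ)..1, T.rate f i (τ * z'.1, η' τ))
        ((z.1 + ρ * k.1) • ∫ τ in (0 : ℝ)..1, T.rate f i (τ * z''.1, η'' τ)) := by
    simp only [dq, Pi.sub_apply, Pi.smul_apply, hff i z hz η hη, hff i z' hz' η' hη',
      hff i z'' hz'' η'' hη'', ht', ht'', smul_eq_mul]
    ring
  rw [hsplit]
  refine (norm_add_le _ _).trans ?_
  have hq00 := mul_le_mul_of_nonneg_left (hqle 0 zero_mem_unit) hL0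
  have e1 : ε₁ * ‖η' 0 - η 0‖ ≤ ε₁ * (A * ‖k‖) :=
    mul_le_mul_of_nonneg_left (hpair1 0 zero_mem_unit).1 hε₁0.le
  have e2 := mul_le_mul_of_nonneg_left hqint (by positivity : 0 ≤ α * B)
  have e3 : ‖dq ρ (T.I (η 0) i) (T.I (η' 0) i) (T.I (η'' 0) i)‖ +
      ‖dq ρ (z.1 • ∫ τ in (0 : ℝ)..1, T.rate f i (τ * z.1, η τ))
        ((z.1 + k.1) • ∫ τ in (0 : ℝ)..1, T.rate f i (τ * z'.1, η' τ))
        ((z.1 + ρ * k.1) • ∫ τ in (0 : ℝ)..1, T.rate f i (τ * z''.1, η'' τ))‖ ≤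
      Γ * P + ε₁ * (A * ‖k‖) := by
    have e4 : Γ * P = L * (P * Real.exp (α * B)) + α * B * (P * Real.exp (α * B)) + P := by
      rw [hΓ]; ring
    rw [e4]
    change _ ≤ L * q 0 + _ at hI1
    linarith
  refine e3.trans ?_
  have e5 : Γ * (C * e / lam) ≤ c / 2 * e * ‖k‖ := by
    have : Γ * (C * e / lam) = (Γ * (L * A)) * (c * e * ‖k‖) / lam := by rw [hC]; ring
    rw [this, div_le_iff₀ hlam0, hlam]
    have : 0 ≤ c * e * ‖k‖ := by positivity
    linarith
  have e6 : Γ * (α * (ε₁ * (A₂ * ‖k‖))) + ε₁ * (A * ‖k‖) = ε / 2 * ‖k‖ := by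
    have : ε₁ * (Γ * (α * A₂) + A) = ε / 2 := by rw [hε₁]; field_simp
    rw [← this]; ring
  have e7 : Γ * (|k.1| * (L * (A₂ * ‖k‖))) ≤ ε / 2 * ‖k‖ := by
    have e8 : |k.1| * (Γ * (L * A₂)) ≤ ε / 2 := by
      have e9 : ε / (2 * (Γ * (L * A₂) + 1)) * (Γ * (L * A₂) + 1) = ε / 2 := by field_simp
      rw [← e9]
      exact mul_le_mul (hk0.trans hk3) (by linarith) (by positivity) (by positivity)
    have := mul_le_mul_of_nonneg_right e8 (norm_nonneg k)
    linarith
  have e10 : ε * ‖k‖ ≤ ε * e * ‖k‖ :=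
    mul_le_mul_of_nonneg_right (le_mul_of_one_le_right hε.le he1) (norm_nonneg _)
  rw [hP]
  linarith

/-- The Lipschitz property gives the crude defect constant `4 N`. After `m` steps it has become `2 ε
+ 4 N / 2 ^ m`; both terms can be made small, and on `K` the weight is at most `exp (lam * α)`. -/
theorem uniformDQ_of_integrates [CompleteSpace E] (h : T.Bounds α Λ LD LI Mc MD)
    (hs : T.IsSmooth 1) (hf : T.Admits f N) (hff : T.Integrates f f) : UniformDQ T.K f := by
  obtain ⟨lam, hlam, hstep⟩ := exists_quasiDQ_step h hs hf hff
  have hN := hf.nonneg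
  have h0 : T.QuasiDQ f lam (4 * N) := by
    refine ⟨1, one_pos, fun z hz z' hz' _ ρ hρ0 hρ1 => ?_⟩
    have hz'' : z + ρ • (z' - z) ∈ T.K :=
      add_smul_mem_of_convex hs.convex hz (by simpa using hz') hρ0.le hρ1
    have h1 := hf.norm_sub_le hz' hz
    have h2 := hf.norm_sub_le hz'' hz
    rw [add_sub_cancel_left, norm_smul, Real.norm_eq_abs, abs_of_pos hρ0] at h2
    have h3 : ‖dq ρ (f z) (f z') (f (z + ρ • (z' - z)))‖ ≤ 4 * N * ‖z' - z‖ := by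
      refine (norm_sub_le _ _).trans ?_
      rw [norm_smul, norm_inv, Real.norm_eq_abs, abs_of_pos hρ0]
      have h4 : ρ⁻¹ * ‖f (z + ρ • (z' - z)) - f z‖ ≤ 2 * N * ‖z' - z‖ := by
        rw [inv_mul_le_iff₀ hρ0]; linarith
      linarith
    refine h3.trans (mul_le_mul_of_nonneg_right ?_ (norm_nonneg _))
    exact le_mul_of_one_le_right (by positivity) (Real.one_le_exp (by positivity))
  have hiter : ∀ ε > 0, ∀ m : ℕ, T.QuasiDQ f lam (2 * ε + 4 * N / 2 ^ m) := by
    intro ε hε m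
    induction m with
    | zero =>
      obtain ⟨δ, hδ, h1⟩ := h0
      refine ⟨δ, hδ, fun z hz z' hz' hle ρ hρ0 hρ1 => (h1 z hz z' hz' hle ρ hρ0 hρ1).trans ?_⟩
      refine mul_le_mul_of_nonneg_right (mul_le_mul_of_nonneg_right ?_ (Real.exp_pos _).le)
        (norm_nonneg _)
      simp only [pow_zero, div_one]; linarith
    | succ m ih =>
      have h1 := hstep _ (by positivity) ih ε hε
      rwa [show ε + (2 * ε + 4 * N / 2 ^ m) / 2 = 2 * ε + 4 * N / 2 ^ (m + 1) by
        rw [pow_succ]; field_simp; ring] at h1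
  intro ε hε
  set M := Real.exp (lam * α) with hM
  have hM0 : 0 < M := Real.exp_pos _
  obtain ⟨m, hm⟩ := pow_unbounded_of_one_lt (8 * N * M / ε) (one_lt_two (α := ℝ))
  obtain ⟨δ, hδ, h1⟩ := hiter (ε / (4 * M)) (by positivity) m
  refine ⟨δ, hδ, fun z hz k hk hle ρ hρ0 hρ1 => ?_⟩
  have h2 := h1 z hz (z + k) hk (by simpa using hle) ρ hρ0 hρ1
  rw [add_sub_cancel_left] at h2
  refine h2.trans (mul_le_mul_of_nonneg_right ?_ (norm_nonneg _))
  have h3 : 4 * N / 2 ^ m ≤ ε / (2 * M) := by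
    rw [div_lt_iff₀ hε] at hm
    rw [div_le_div_iff₀ (by positivity) (by positivity)]
    linarith
  have h4 : Real.exp (lam * |z.1|) ≤ M :=
    Real.exp_le_exp.2 (mul_le_mul_of_nonneg_left (h.time z hz) hlam.le)
  calc (2 * (ε / (4 * M)) + 4 * N / 2 ^ m) * Real.exp (lam * |z.1|)
      ≤ (2 * (ε / (4 * M)) + ε / (2 * M)) * M :=
        mul_le_mul (by linarith) h4 (Real.exp_pos _).le (by positivity)
    _ = ε := by field_simp; norm_num

/-- Solutions of smooth transport systems are continuously differentiable. -/
theorem contDiffOn_one_of_integrates [FiniteDimensional ℝ E] (h : T.Bounds α Λ LD LI Mc MD)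
    (hs : T.IsSmooth 1) (hf : T.Admits f N) (hff : T.Integrates f f) : ContDiffOn ℝ 1 f T.K :=
  (uniformDQ_of_integrates h hs hf hff).contDiffOn hs.compact hs.convex hs.nonempty_interior
    fun _ hx _ hy => hf.norm_sub_le hx hy

end Transport

end ParamPDE

namespace ParamPDE

set_option linter.unusedSectionVars false

open Filter

theorem tendsto_clm_apply {X Z F : Type*} [NormedAddCommGroup Z] [NormedSpace ℝ Z]
    [NormedAddCommGroup F] [NormedSpace ℝ F] {l : Filter X} {A : X → Z →L[ℝ] F} {u : X → Z}
    {A₀ : Z →L[ℝ] F} {u₀ : Z} (hA : Tendsto A l (𝓝 A₀)) (hu : Tendsto u l (𝓝 u₀)) :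
    Tendsto (fun x => A x (u x)) l (𝓝 (A₀ u₀)) :=
  (isBoundedBilinearMap_apply (𝕜 := ℝ) (E := Z) (F := F)).continuous.continuousAt.tendsto.comp
    (hA.prodMk_nhds hu)

/-! ### The transport equations for the derivatives of a solution -/

namespace Transport

variable {E : Type*} [NormedAddCommGroup E] [NormedSpace ℝ E] {n : ℕ} {T : Transport E n}
  {α Λ LD LI Mc MD N H : ℝ} {f g f' : ℝ × E → Fin n → ℝ}

theorem Integrates.initial [CompleteSpace E] (h : T.Bounds α Λ LD LI Mc MD)
    (hf : T.Admits f N) (hff : T.Integrates f f) {x : E} (hx : x ∈ T.base) :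
    f (0, x) = T.I x := by
  ext i
  obtain ⟨η, hη⟩ := exists_char h hf i (0, x) hx
  have h1 := hff i (0, x) hx η hη
  have h2 := hη.eq 0 zero_mem_unit
  simp only [zero_smul, sub_zero] at h2
  simpa [h2] using h1

/-- In the interior this is the known value of the derivative in the characteristic direction. Both
sides are continuous on `K` and the interior is dense, so it extends to the boundary. -/
theorem Integrates.fderivWithin_eq [CompleteSpace E] (h : T.Bounds α Λ LD LI Mc MD)
    (hs : T.IsSmooth 1) (hf : T.Admits f N) (hff : T.Integrates f f) (hf1 : ContDiffOn ℝ 1 f T.K)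
    {z : ℝ × E} (hz : z ∈ T.K) (i : Fin n) :
    fderivWithin ℝ f T.K z (1, T.field f i z) i = T.rate f i z := by
  have hu := uniqueDiffOn_convex hs.convex hs.nonempty_interior
  have hdf := hf1.continuousOn_fderivWithin hu le_rfl
  have hint : ∀ z ∈ interior T.K, fderivWithin ℝ f T.K z (1, T.field f i z) i = T.rate f i z := by
    intro z hz
    have hnhds := mem_interior_iff_mem_nhds.1 hz
    have hd : DifferentiableAt ℝ f z := (hf1.differentiableOn one_ne_zero z
      (interior_subset hz)).differentiableAt hnhds
    rw [fderivWithin_of_mem_nhds hnhds]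
    have h1 : HasDerivAt (fun s : ℝ => f (z + s • ((1, T.field f i z) : ℝ × E)))
        (fderiv ℝ f z (1, T.field f i z)) 0 := hd.hasFDerivAt.hasLineDerivAt _
    have h2 := hasDerivAt_pi.1 h1 i
    have hline : ContinuousAt (fun s : ℝ => (z.1 + s, z.2 + s • T.field f i z)) 0 := by fun_prop
    refine hff.eq_rate h hf (interior_subset hz) (hline.eventually_mem (by simpa using hnhds)) ?_
    refine h2.congr_of_eventuallyEq (Eventually.of_forall fun s => ?_)
    have h3 : z + s • ((1, T.field f i z) : ℝ × E) = (z.1 + s, z.2 + s • T.field f i z) := by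
      ext <;> simp
    simp only [h3]
  have hcont : ContinuousOn (fun z => fderivWithin ℝ f T.K z (1, T.field f i z) i) T.K := by
    have h1 : ContinuousOn (fun z => ((1 : ℝ), T.field f i z)) T.K :=
      continuousOn_const.prodMk (hf.isField h i).continuousOn
    exact continuousOn_pi.1 (hdf.clm_apply h1) i
  have hsub : T.K ⊆ closure (interior T.K) := by
    rw [hs.convex.closure_interior_eq_closure_of_nonempty_interior hs.nonempty_interior]
    exact subset_closure
  exact Set.EqOn.of_subset_closure (s := interior T.K) (t := T.K) hint hcont
    (hf.continuousOn_rate h i) interior_subset hsub hz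

theorem hasDerivAt_data_line {V : Type*} [NormedAddCommGroup V] [NormedSpace ℝ V]
    (hf : T.Admits f N) (hf1 : ContDiffOn ℝ 1 f T.K) {G : (ℝ × E) × (Fin n → ℝ) → V}
    (hG : ContDiffOn ℝ 1 G (T.K ×ˢ T.val)) {z : ℝ × E} (hz : z ∈ interior T.K) (k : ℝ × E) :
    HasDerivAt (fun s : ℝ => G (z + s • k, f (z + s • k)))
      (fderivWithin ℝ G (T.K ×ˢ T.val) (z, f z) (k, fderivWithin ℝ f T.K z k)) 0 := by
  have hnhds := mem_interior_iff_mem_nhds.1 hz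
  have hzK := interior_subset hz
  have h1 : HasDerivAt (fun s : ℝ => z + s • k) k 0 := by
    simpa using ((hasDerivAt_id (0 : ℝ)).smul_const k).const_add z
  have hS : ∀ᶠ s : ℝ in 𝓝 0, z + s • k ∈ T.K :=
    h1.continuousAt.eventually_mem (by simpa using hnhds)
  have h2 : HasDerivAt (fun s : ℝ => f (z + s • k)) (fderivWithin ℝ f T.K z k) 0 := by
    have hd := ((hf1.differentiableOn one_ne_zero z hzK).differentiableAt hnhds).hasFDerivAt
    rw [← fderivWithin_of_mem_nhds hnhds] at hd
    exact hd.hasLineDerivAt k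
  have h3 := (h1.prodMk h2).hasDerivWithinAt (s := {s : ℝ | z + s • k ∈ T.K})
  have h4 : HasFDerivWithinAt G (fderivWithin ℝ G (T.K ×ˢ T.val) (z, f z)) (T.K ×ˢ T.val)
      (z + (0 : ℝ) • k, f (z + (0 : ℝ) • k)) := by
    simpa using (hG.differentiableOn one_ne_zero (z, f z) ⟨hzK, hf.maps z hzK⟩).hasFDerivWithinAt
  have h6 : MapsTo (fun s : ℝ => (z + s • k, f (z + s • k))) {s : ℝ | z + s • k ∈ T.K}
    (T.K ×ˢ T.val) := fun s hs => ⟨hs, hf.maps _ hs⟩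
  have h5 := h4.comp_hasDerivWithinAt (0 : ℝ) h3 h6
  exact h5.hasDerivAt hS

/-- The rate of the derivative of the `i`-th component of `f` in the spatial direction `e`. -/
noncomputable def derivRate (T : Transport E n) (f : ℝ × E → Fin n → ℝ) (i : Fin n) (e : E)
    (z : ℝ × E) : ℝ :=
  fderivWithin ℝ (T.D i) (T.K ×ˢ T.val) (z, f z) ((0, e), fderivWithin ℝ f T.K z (0, e)) -
    fderivWithin ℝ f T.K z (0, fderivWithin ℝ (T.c i) (T.K ×ˢ T.val) (z, f z)
      ((0, e), fderivWithin ℝ f T.K z (0, e))) i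

/-- Formally this differentiates the equation in the direction `e`, which would need second
derivatives of `f`. Instead the characteristic is translated by `s e`, the equation is integrated
along the translated curve, and the difference quotient in `s` is taken. The limit uses only that
`f` and the data are `C^1`. -/
theorem fderivWithin_eq_integral [CompleteSpace E] (h : T.Bounds α Λ LD LI Mc MD)
    (hs : T.IsSmooth 1) (hf : T.Admits f N) (hff : T.Integrates f f) (hf1 : ContDiffOn ℝ 1 f T.K)
    {U : Set (ℝ × E)} (hU : T.IsCore U) {z : ℝ × E} (hz : z ∈ U) {i : Fin n} {η : ℝ → E}
    (hη : IsChar T.K (T.field f i) z η) (e : E) :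
    fderivWithin ℝ f T.K z (0, e) i = fderivWithin ℝ (fun x => T.I x i) T.base (η 0) e +
      z.1 * ∫ τ in (0 : ℝ)..1, T.derivRate f i e (τ * z.1, η τ) := by
  have hu := uniqueDiffOn_convex hs.convex hs.nonempty_interior
  have hdf := hf1.continuousOn_fderivWithin hu le_rfl
  have hUint : U ⊆ interior T.K := hU.isOpen.subset_interior_iff.2 hU.subset
  have hfield := hf.isField h i
  have hcη := continuousOn_along hfield.continuousOn hη.cont hη.mem
  set γ : ℝ → ℝ × E := fun τ => (τ * z.1, η τ) with hγdef
  have hγc : ContinuousOn γ (Icc 0 1) := (continuousOn_id.mul continuousOn_const).prodMk hη.cont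
  have hγU : ∀ τ ∈ Icc (0 : ℝ) 1, γ τ ∈ U := by
    intro θ hθ
    simp only [hγdef]
    rw [hη.eq θ hθ]
    exact mem_of_back h.inv.vel_convex h.inv.vel_closed hz (hU.back z hz) hcη
      (fun τ hτ => hfield.mem _ (hη.mem τ hτ)) hθ
  set k : ℝ × E := (0, e) with hk
  -- By compactness the whole curve has a neighbourhood in `U`, so all small translates of it remain
  -- in the domain.
  obtain ⟨δ, hδ, hthick⟩ := (isCompact_Icc.image_of_continuousOn hγc).exists_cthickening_subset_open
    hU.isOpen (by rintro _ ⟨τ, hτ, rfl⟩; exact hγU τ hτ)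
  have hnear : ∀ᶠ s : ℝ in 𝓝 0, ∀ τ ∈ Icc (0 : ℝ) 1, γ τ + s • k ∈ U := by
    have h1 : ContinuousAt (fun s : ℝ => ‖s • k‖) 0 := by fun_prop
    filter_upwards [h1.eventually_lt_const (by simpa using hδ)] with s hsδ τ hτ
    refine hthick (Metric.mem_cthickening_of_dist_le _ (γ τ) _ _ (mem_image_of_mem γ hτ) ?_)
    rw [dist_eq_norm, add_sub_cancel_left]
    exact hsδ.le
  -- The translated curve moves with the velocity at the original point. The equation at the
  -- translated point therefore gives the rate there, corrected by the spatial derivative of `f`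
  -- applied to the difference of the two velocities.
  set κ : ℝ → ℝ → ℝ := fun s τ => T.rate f i (γ τ + s • k) -
    fderivWithin ℝ f T.K (γ τ + s • k) (0, T.field f i (γ τ + s • k) - T.field f i (γ τ)) i with hκ
  have hlineK : ∀ {s : ℝ}, (∀ τ ∈ Icc (0 : ℝ) 1, γ τ + s • k ∈ U) →
      MapsTo (fun τ => γ τ + s • k) (Icc 0 1) T.K := fun hs τ hτ => hU.subset (hs τ hτ)
  have hlinec : ∀ s : ℝ, ContinuousOn (fun τ => γ τ + s • k) (Icc 0 1) := fun s =>
    hγc.add continuousOn_const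
  have hκc : ∀ s : ℝ, (∀ τ ∈ Icc (0 : ℝ) 1, γ τ + s • k ∈ U) → ContinuousOn (κ s) (Icc 0 1) := by
    intro s hsU
    have h1 := (hf.continuousOn_rate h i).comp (hlinec s) (hlineK hsU)
    have h2 := hfield.continuousOn.comp (hlinec s) (hlineK hsU)
    have h3 := hdf.comp (hlinec s) (hlineK hsU)
    have h4 : ContinuousOn (fun τ => ((0 : ℝ), T.field f i (γ τ + s • k) - T.field f i (γ τ)))
        (Icc 0 1) := continuousOn_const.prodMk (h2.sub hcη)
    exact h1.sub (continuousOn_pi.1 (h3.clm_apply h4) i)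
  have hint : ∀ s : ℝ, (∀ τ ∈ Icc (0 : ℝ) 1, γ τ + s • k ∈ U) →
      f (z + s • k) i - T.I (η 0 + s • e) i = z.1 * ∫ τ in (0 : ℝ)..1, κ s τ := by
    intro s hsU
    have hcont : ContinuousOn (fun τ => f (γ τ + s • k) i) (Icc 0 1) :=
      continuousOn_pi.1 (hf.continuousOn.comp (hlinec s) (hlineK hsU)) i
    have hd : ∀ τ ∈ Ioo (0 : ℝ) 1, HasDerivAt (fun τ => f (γ τ + s • k) i) (z.1 * κ s τ) τ := by
      intro τ hτ
      have hτ' : τ ∈ Icc (0 : ℝ) 1 := Ioo_subset_Icc_self hτ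
      have hmem := hUint (hsU τ hτ')
      have hnhds := mem_interior_iff_mem_nhds.1 hmem
      have h1 := (hη.hasDerivAt_graph hfield.continuousOn hτ).add_const (s • k)
      have h2 := ((hf1.differentiableOn one_ne_zero _
        (interior_subset hmem)).differentiableAt hnhds).hasFDerivAt
      rw [← fderivWithin_of_mem_nhds hnhds] at h2
      have h3 := hasDerivAt_pi.1 (h2.comp_hasDerivAt τ h1) i
      refine h3.congr_deriv ?_
      have h4 := hff.fderivWithin_eq h hs hf hf1 (interior_subset hmem) i
      have h5 : ((z.1, z.1 • T.field f i (γ τ)) : ℝ × E) =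
          z.1 • (((1, T.field f i (γ τ + s • k)) : ℝ × E) -
            (0, T.field f i (γ τ + s • k) - T.field f i (γ τ))) := by
        ext <;> simp
      change fderivWithin ℝ f T.K (γ τ + s • k) (z.1, z.1 • T.field f i (γ τ)) i = _
      rw [h5, map_smul, map_sub, Pi.smul_apply, Pi.sub_apply, h4, smul_eq_mul]
    have h1 := intervalIntegral.integral_eq_sub_of_hasDerivAt_of_le zero_le_one hcont hd
      (intervalIntegrable_of_continuousOn_unit (continuousOn_const.mul (hκc s hsU)) zero_mem_unit
        one_mem_unit)
    rw [intervalIntegral.integral_const_mul] at h1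
    rw [h1]
    have h2 : γ 1 = z := by simp [hγdef, hη.apply_one]
    have h3 : γ 0 + s • k = (0, η 0 + s • e) := by simp [hγdef, hk]
    have h4 : η 0 + s • e ∈ T.base := by
      have := hU.subset (hsU 0 zero_mem_unit)
      rwa [h3] at this
    rw [h2, h3, hff.initial h hf h4]
  have h0U : ∀ τ ∈ Icc (0 : ℝ) 1, γ τ + (0 : ℝ) • k ∈ U := by simpa using hγU
  -- the limit of the difference quotients on the left
  have hzint := hUint hz
  have hleft : Tendsto (fun s : ℝ => s⁻¹ • ((f (z + s • k) i - T.I (η 0 + s • e) i) -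
      (f (z + (0 : ℝ) • k) i - T.I (η 0 + (0 : ℝ) • e) i))) (𝓝[≠] 0)
      (𝓝 (fderivWithin ℝ f T.K z k i - fderivWithin ℝ (fun x => T.I x i) T.base (η 0) e)) := by
    have hnhds := mem_interior_iff_mem_nhds.1 hzint
    have h1 := ((hf1.differentiableOn one_ne_zero z
      (interior_subset hzint)).differentiableAt hnhds).hasFDerivAt
    rw [← fderivWithin_of_mem_nhds hnhds] at h1
    have h2 := hasDerivAt_pi.1 (h1.hasLineDerivAt k) i
    have hbase : T.base ∈ 𝓝 (η 0) := by
      have h3 : T.K ∈ 𝓝 ((0 : ℝ), η 0) := by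
        have := mem_interior_iff_mem_nhds.1 (hUint (hγU 0 zero_mem_unit))
        simpa [hγdef] using this
      exact (Continuous.prodMk_right (0 : ℝ)).continuousAt.preimage_mem_nhds h3
    have h4 := (((hs.I i).differentiableOn one_ne_zero (η 0)
      (mem_of_mem_nhds hbase)).differentiableAt hbase).hasFDerivAt
    rw [← fderivWithin_of_mem_nhds hbase] at h4
    have h5 := h2.sub (h4.hasLineDerivAt e)
    have h6 := hasDerivAt_iff_tendsto_slope_zero.1 h5
    simpa only [zero_add, Pi.sub_apply] using h6
  -- Dominated convergence: the Lipschitz bounds for rate and velocity and the bound `M` for the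
  -- derivative dominate the quotients. In the correction term the difference is divided by `s`, so
  -- the derivative of `f` needs only to be continuous.
  have hright : Tendsto (fun s : ℝ => z.1 * ∫ τ in (0 : ℝ)..1, s⁻¹ * (κ s τ - κ 0 τ)) (𝓝[≠] 0)
      (𝓝 (z.1 * ∫ τ in (0 : ℝ)..1, T.derivRate f i e (γ τ))) := by
    obtain ⟨M, hM⟩ := hs.compact.exists_bound_of_continuousOn hdf
    have hM0 : 0 ≤ M := (norm_nonneg _).trans (hM z (hU.subset hz))
    have hN := hf.nonneg
    have hLD := h.LD_nonneg
    have hnear' := hnear.filter_mono (nhdsWithin_le_nhds (s := {(0 : ℝ)}ᶜ))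
    have hκ0 : ∀ τ, κ 0 τ = T.rate f i (γ τ) := by
      intro τ
      simp only [hκ, zero_smul, add_zero, sub_self]
      rw [show ((0 : ℝ), (0 : E)) = 0 from rfl, map_zero]
      simp
    refine (intervalIntegral.tendsto_integral_filter_of_dominated_convergence
      (fun _ => LD * (1 + n * N) * ‖e‖ + M * (Λ * (1 + n * N) * ‖e‖)) ?_ ?_ ?_ ?_).const_mul z.1
    · filter_upwards [hnear'] with s hsU
      have h1 : ContinuousOn (fun τ => s⁻¹ * (κ s τ - κ 0 τ)) (Icc 0 1) :=
        continuousOn_const.mul ((hκc s hsU).sub (hκc 0 h0U))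
      rw [uIoc_of_le zero_le_one]
      exact (h1.mono Ioc_subset_Icc_self).aestronglyMeasurable measurableSet_Ioc
    · filter_upwards [hnear', self_mem_nhdsWithin] with s hsU hs0
      refine Eventually.of_forall fun τ hτ => ?_
      rw [uIoc_of_le zero_le_one] at hτ
      have hτ' : τ ∈ Icc (0 : ℝ) 1 := Ioc_subset_Icc_self hτ
      have m := hU.subset (hγU τ hτ')
      have m' := hU.subset (hsU τ hτ')
      have hd : |(γ τ + s • k).1 - (γ τ).1| + ‖(γ τ + s • k).2 - (γ τ).2‖ = |s| * ‖e‖ := by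
        simp [hk, norm_smul]
      have e1 := hf.rate_lip h i _ m' _ m
      have e2 := hfield.lip _ m' _ m
      rw [hd] at e1 e2
      have e3 : |fderivWithin ℝ f T.K (γ τ + s • k)
          (0, T.field f i (γ τ + s • k) - T.field f i (γ τ)) i| ≤
          M * (Λ * (1 + n * N) * (|s| * ‖e‖)) := by
        refine (norm_le_pi_norm (fderivWithin ℝ f T.K (γ τ + s • k)
          (0, T.field f i (γ τ + s • k) - T.field f i (γ τ))) i).trans
          (((fderivWithin ℝ f T.K (γ τ + s • k)).le_opNorm _).trans ?_)
        refine mul_le_mul (hM _ m') ?_ (norm_nonneg _) hM0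
        simpa [Prod.norm_def] using e2
      rw [hκ0, norm_mul, norm_inv, Real.norm_eq_abs, Real.norm_eq_abs,
        inv_mul_le_iff₀ (abs_pos.2 hs0)]
      simp only [hκ]
      rw [sub_right_comm]
      refine (abs_sub _ _).trans ?_
      rw [Real.norm_eq_abs] at e1
      linarith
    · exact intervalIntegrable_const
    · refine Eventually.of_forall fun τ hτ => ?_
      rw [uIoc_of_le zero_le_one] at hτ
      have hτ' : τ ∈ Icc (0 : ℝ) 1 := Ioc_subset_Icc_self hτ
      have m := hUint (hγU τ hτ')
      have h1 := hasDerivAt_iff_tendsto_slope_zero.1 (hasDerivAt_data_line hf hf1 (hs.D i) m k)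
      have h2 := hasDerivAt_iff_tendsto_slope_zero.1 (hasDerivAt_data_line hf hf1 (hs.c i) m k)
      simp only [zero_add, zero_smul, add_zero] at h1 h2
      have h3 : Tendsto (fun s : ℝ => fderivWithin ℝ f T.K (γ τ + s • k)) (𝓝[≠] 0)
          (𝓝 (fderivWithin ℝ f T.K (γ τ))) := by
        have h4 : ContinuousAt (fun s : ℝ => γ τ + s • k) 0 := by fun_prop
        have h5 := (hdf.continuousAt (mem_interior_iff_mem_nhds.1 m)).tendsto
        have h6 := h4.tendsto
        simp only [zero_smul, add_zero] at h6
        exact (h5.comp h6).mono_left nhdsWithin_le_nhds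
      have h4 := tendsto_clm_apply h3 ((tendsto_const_nhds (x := (0 : ℝ))).prodMk_nhds h2)
      have h5 := h1.sub (tendsto_pi_nhds.1 h4 i)
      refine h5.congr fun s => ?_
      rw [hκ0]
      simp only [hκ]
      have h6 : ((0 : ℝ), s⁻¹ • (T.c i (γ τ + s • k, f (γ τ + s • k)) - T.c i (γ τ, f (γ τ)))) =
          s⁻¹ • (((0 : ℝ), T.field f i (γ τ + s • k) - T.field f i (γ τ)) : ℝ × E) := by
        ext <;> simp [field]
      rw [h6, map_smul, Pi.smul_apply, smul_eq_mul, smul_eq_mul]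
      simp only [rate]
      ring
  have hlim := hleft.congr' (f₂ := fun s : ℝ => z.1 * ∫ τ in (0 : ℝ)..1, s⁻¹ * (κ s τ - κ 0 τ)) (by
    filter_upwards [hnear.filter_mono nhdsWithin_le_nhds] with s hsU
    rw [hint s hsU, hint 0 h0U, intervalIntegral.integral_const_mul,
      integral_sub_unit (hκc s hsU) (hκc 0 h0U) zero_mem_unit one_mem_unit, smul_eq_mul]
    ring)
  have := tendsto_nhds_unique hlim hright
  linarith

end Transport

end ParamPDE

namespace ParamPDE

set_option linter.unusedSectionVars false

open Filter

/-! ### Continuous solutions of the integral equations -/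

namespace Transport

variable {E : Type*} [NormedAddCommGroup E] [NormedSpace ℝ E] {n : ℕ} {T : Transport E n}
  {α Λ LD LI Mc MD N H : ℝ} {f g f' : ℝ × E → Fin n → ℝ}

theorem norm_le_l1 {k : ℕ} (v : Fin k → ℝ) : ‖v‖ ≤ l1 v := by
  have h0 : 0 ≤ l1 v := Finset.sum_nonneg fun _ _ => abs_nonneg _
  rw [pi_norm_le_iff_of_nonneg h0]
  exact fun i => Finset.single_le_sum (f := fun j => |v j|) (fun _ _ => abs_nonneg _)
    (Finset.mem_univ i)

theorem IsSmooth.exists_bounds (hs : T.IsSmooth 1) (hinv : BackwardInvariant T.K T.vel)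
    (hc : ∀ i, ∀ z ∈ T.K, ∀ y ∈ T.val, T.c i (z, y) ∈ T.vel) :
    ∃ α L M, T.Bounds α L L L M M := by
  obtain ⟨α, hα⟩ := hs.compact.exists_bound_of_continuousOn (f := fun z : ℝ × E => z.1)
    continuous_fst.continuousOn
  obtain ⟨L, hL0, hL⟩ := hs.exists_lipschitz
  obtain ⟨M, hM0, hM⟩ := exists_common_bound (P := fun i M =>
    (∀ x ∈ T.K ×ˢ T.val, ‖T.c i x‖ ≤ M) ∧ ∀ x ∈ T.K ×ˢ T.val, ‖T.D i x‖ ≤ M) (fun i => by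
      obtain ⟨M₁, h₁⟩ := hs.prod_compact.exists_bound_of_continuousOn (hs.c i).continuousOn
      obtain ⟨M₂, h₂⟩ := hs.prod_compact.exists_bound_of_continuousOn (hs.D i).continuousOn
      refine ⟨max 0 (max M₁ M₂), le_max_left _ _, fun M hM => ⟨fun x hx => ?_, fun x hx => ?_⟩⟩
      · exact (h₁ x hx).trans
          ((le_max_left _ _).trans ((le_max_right _ _).trans hM))
      · exact (h₂ x hx).trans
          ((le_max_right _ _).trans ((le_max_right _ _).trans hM)))
  have hdist : ∀ (z z' : ℝ × E) (y y' : Fin n → ℝ), ‖((z, y) : (ℝ × E) × (Fin n → ℝ)) - (z', y')‖ ≤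
      |z.1 - z'.1| + ‖z.2 - z'.2‖ + l1 (y - y') := by
    intro z z' y y'
    have h1 := norm_le_l1 (y - y')
    have h2 := abs_nonneg (z.1 - z'.1)
    have h3 := norm_nonneg (z.2 - z'.2)
    have h4 := (norm_nonneg _).trans h1
    rw [Prod.norm_def]
    refine max_le ?_ (by simp only [Prod.snd_sub]; linarith)
    simp only [Prod.fst_sub]
    rw [Prod.norm_def]
    refine max_le ?_ ?_
    · simp only [Prod.fst_sub, Real.norm_eq_abs]; linarith
    · simp only [Prod.snd_sub]; linarith
  refine ⟨max α 0, L, M, hinv, fun z hz => (hα z hz).trans (le_max_left _ _), le_max_right _ _,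
    hL0, hL0, hL0, hM0, hM0, hs.b_pos.le, hc, fun i z hz y hy => (hM M le_rfl i).1 _ ⟨hz, hy⟩,
    fun i z hz y hy => (hM M le_rfl i).2 _ ⟨hz, hy⟩, fun i z hz y hy z' hz' y' hy' => ?_,
    fun i z hz y hy z' hz' y' hy' => ?_, fun i x hx x' hx' => ?_⟩
  · exact ((hL i).1 _ ⟨hz, hy⟩ _ ⟨hz', hy'⟩).trans (mul_le_mul_of_nonneg_left (hdist _ _ _ _) hL0)
  · exact ((hL i).2.1 _ ⟨hz, hy⟩ _ ⟨hz', hy'⟩).trans (mul_le_mul_of_nonneg_left (hdist _ _ _ _) hL0)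
  · exact (hL i).2.2 x hx x' hx'

/-- The integral equations extend from a core to the whole domain. -/
theorem integrates_of_core [CompleteSpace E] (h : T.Bounds α Λ LD LI Mc MD)
    (hmaps : ∀ z ∈ T.K, g z ∈ T.val) (hg : ContinuousOn g T.K)
    (hD : ∀ i, ContinuousOn (T.rate g i) T.K) (hI : ∀ i, ContinuousOn (fun x => T.I x i) T.base)
    (hfield : ∀ i, IsField T.K T.vel (T.field g i) H Mc) {U : Set (ℝ × E)} (hU : T.IsCore U)
    (hcore : ∀ i, ∀ z ∈ U, ∀ η, IsChar T.K (T.field g i) z η →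
      g z i = T.I (η 0) i + z.1 * ∫ τ in (0 : ℝ)..1, T.rate g i (τ * z.1, η τ)) :
    T.Integrates g g := by
  intro i z hz η hη
  choose! ζ hζ using fun z' (hz' : z' ∈ U) => exists_isChar h.inv (hfield i) (hU.subset hz')
  have hne : (𝓝[U] z).NeBot := mem_closure_iff_nhdsWithin_neBot.1 (hU.dense hz)
  have hid : Tendsto (fun z' : ℝ × E => z') (𝓝[U] z) (𝓝 z) := tendsto_id.mono_left nhdsWithin_le_nhds
  have hcurve : ∀ τ ∈ Icc (0 : ℝ) 1, Tendsto (fun z' => ζ z' τ) (𝓝[U] z) (𝓝 (η τ)) := by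
    intro τ hτ
    rw [tendsto_iff_norm_sub_tendsto_zero]
    have h1 : Tendsto (fun z' : ℝ × E => (1 + Mc + α * H) * (|z'.1 - z.1| + ‖z'.2 - z.2‖) *
        Real.exp (α * H)) (𝓝[U] z) (𝓝 0) := by
      have h2 : ContinuousAt (fun z' : ℝ × E => (1 + Mc + α * H) * (|z'.1 - z.1| + ‖z'.2 - z.2‖) *
        Real.exp (α * H)) z := by fun_prop
      have h3 := h2.tendsto.mono_left (nhdsWithin_le_nhds (s := U))
      simpa using h3
    refine squeeze_zero' (Eventually.of_forall fun _ => norm_nonneg _) ?_ h1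
    filter_upwards [self_mem_nhdsWithin] with z' hz'
    exact (hζ z' hz').norm_sub_le_of_lip h.time (hfield i) (hU.subset hz') hz hη hτ
  have hpt : ∀ τ ∈ Icc (0 : ℝ) 1, Tendsto (fun z' => (τ * z'.1, ζ z' τ)) (𝓝[U] z)
      (𝓝[T.K] (τ * z.1, η τ)) := by
    intro τ hτ
    refine tendsto_nhdsWithin_iff.2 ⟨?_, ?_⟩
    · exact (((continuous_fst.tendsto z).comp hid).const_mul τ).prodMk_nhds (hcurve τ hτ)
    · filter_upwards [self_mem_nhdsWithin] with z' hz' using (hζ z' hz').mem τ hτ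
  have hrhs : Tendsto (fun z' : ℝ × E => T.I (ζ z' 0) i +
      z'.1 * ∫ τ in (0 : ℝ)..1, T.rate g i (τ * z'.1, ζ z' τ)) (𝓝[U] z)
      (𝓝 (T.I (η 0) i + z.1 * ∫ τ in (0 : ℝ)..1, T.rate g i (τ * z.1, η τ))) := by
    refine Tendsto.add ?_ (Tendsto.mul ?_ ?_)
    · have h1 : Tendsto (fun z' => ζ z' 0) (𝓝[U] z) (𝓝[T.base] (η 0)) := by
        refine tendsto_nhdsWithin_iff.2 ⟨hcurve 0 zero_mem_unit, ?_⟩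
        filter_upwards [self_mem_nhdsWithin] with z' hz' using Bounds.zero_mem (hζ z' hz')
      exact (hI i (η 0) (Bounds.zero_mem hη)).tendsto.comp h1
    · exact (continuous_fst.tendsto z).comp hid
    · refine intervalIntegral.tendsto_integral_filter_of_dominated_convergence (fun _ => MD)
        ?_ ?_ intervalIntegrable_const ?_
      · filter_upwards [self_mem_nhdsWithin] with z' hz'
        rw [uIoc_of_le zero_le_one]
        exact ((continuousOn_along (hD i) (hζ z' hz').cont (hζ z' hz').mem).mono
          Ioc_subset_Icc_self).aestronglyMeasurable measurableSet_Ioc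
      · filter_upwards [self_mem_nhdsWithin] with z' hz'
        refine Eventually.of_forall fun τ hτ => ?_
        rw [uIoc_of_le zero_le_one] at hτ
        have m := (hζ z' hz').mem τ (Ioc_subset_Icc_self hτ)
        exact h.D_bound i _ m _ (hmaps _ m)
      · refine Eventually.of_forall fun τ hτ => ?_
        rw [uIoc_of_le zero_le_one] at hτ
        have hτ' := Ioc_subset_Icc_self hτ
        exact (hD i _ (hη.mem τ hτ')).tendsto.comp (hpt τ hτ')
  have hlhs : Tendsto (fun z' => g z' i) (𝓝[U] z) (𝓝 (g z i)) :=
    ((continuousOn_pi.1 hg i) z hz).tendsto.mono_left (nhdsWithin_mono z hU.subset)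
  refine tendsto_nhds_unique (hlhs.congr' ?_) hrhs
  filter_upwards [self_mem_nhdsWithin] with z' hz' using hcore i z' hz' _ (hζ z' hz')

/-- Continuous solutions of the integral equations with Lipschitz velocities are Lipschitz. -/
theorem exists_admits_of_integrates [CompleteSpace E] (h : T.Bounds α Λ LD LI Mc MD)
    (hmaps : ∀ z ∈ T.K, g z ∈ T.val) (hg : ContinuousOn g T.K)
    (hD : ∀ i, ContinuousOn (T.rate g i) T.K)
    (hfield : ∀ i, IsField T.K T.vel (T.field g i) H Mc) (hgg : T.Integrates g g) :
    ∃ N, T.Admits g N := by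
  rcases n.eq_zero_or_pos with hn0 | hn
  · subst hn0
    exact ⟨0, hmaps, le_rfl, fun i => i.elim0⟩
  have hH0 : 0 ≤ H := (hfield ⟨0, hn⟩).nonneg
  have hα := h.α_nonneg
  have hMc := h.Mc_nonneg
  have hMD := h.MD_nonneg
  have hLD := h.LD_nonneg
  have hLI := h.LI_nonneg
  set A := (1 + Mc + α * H) * Real.exp (α * H) with hA
  have hA0 : 0 ≤ A := by positivity
  set C₀ := LI * A + MD + α * LD * (1 + A) with hC₀
  have hC₀0 : 0 ≤ C₀ := by positivity
  set lam := 2 * (LD * n * (1 + A)) + 1 with hlam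
  have hlam0 : 0 < lam := by positivity
  set N := 2 * C₀ * Real.exp (lam * α) with hN
  set d : ℝ × E → ℝ × E → ℝ := fun z z' => |z.1 - z'.1| + ‖z.2 - z'.2‖ with hd
  have hd0 : ∀ z z', 0 ≤ d z z' := fun z z' => by positivity
  -- Adding `ε` to the distance keeps the weight positive on the diagonal, so the boundedness of the
  -- values gives a starting constant `2 b / ε`. The improved constant `N` does not depend on `ε`,
  -- which then tends to `0`.
  have key : ∀ ε > 0, ∀ z ∈ T.K, ∀ z' ∈ T.K, ‖g z - g z'‖ ≤ N * (d z z' + ε) := by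
    intro ε hε z hz z' hz'
    have h1 := le_of_self_improving (σ := T.K × T.K) (x := fun s => ‖g s.1 - g s.2‖)
      (ω := fun s => (d s.1 s.2 + ε) * Real.exp (lam * |s.1.1.1|)) (C := C₀) (c₀ := 2 * T.b / ε)
      (fun s => mul_nonneg (add_nonneg (hd0 _ _) hε.le) (Real.exp_pos _).le) hC₀0
      (by have := h.b_nonneg; positivity) (by
        rintro ⟨⟨z, hz⟩, ⟨z', hz'⟩⟩
        simp only
        have e1 : ‖g z - g z'‖ ≤ 2 * T.b := by
          rw [← dist_eq_norm]
          have := dist_triangle_right (g z) (g z') T.y₀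
          have h1 := hmaps z hz
          have h2 := hmaps z' hz'
          rw [val, Metric.mem_closedBall] at h1 h2
          linarith
        have e2 : ε ≤ (d z z' + ε) * Real.exp (lam * |z.1|) := by
          have e3 : 1 ≤ Real.exp (lam * |z.1|) := Real.one_le_exp (by positivity)
          have := hd0 z z'
          nlinarith
        calc ‖g z - g z'‖ ≤ 2 * T.b / ε * ε := by rwa [div_mul_cancel₀ _ hε.ne']
          _ ≤ _ := mul_le_mul_of_nonneg_left e2 (by have := h.b_nonneg; positivity))
      (by
        rintro c hc hx ⟨⟨z, hz⟩, ⟨z', hz'⟩⟩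
        simp only
        set δ := d z z' with hδ
        have hδ0 := hd0 z z'
        rw [pi_norm_le_iff_of_nonneg (by positivity)]
        intro i
        obtain ⟨η, hη⟩ := exists_isChar h.inv (hfield i) hz
        obtain ⟨ζ, hζ⟩ := exists_isChar h.inv (hfield i) hz'
        have hηζ : ∀ τ ∈ Icc (0 : ℝ) 1, ‖η τ - ζ τ‖ ≤ A * δ := fun τ hτ =>
          (hη.norm_sub_le_of_lip h.time (hfield i) hz hz' hζ hτ).trans_eq (by rw [hA]; ring)
        have rη := continuousOn_along (hD i) hη.cont hη.mem
        have rζ := continuousOn_along (hD i) hζ.cont hζ.mem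
        have hdζ : ∀ τ ∈ Icc (0 : ℝ) 1, d (τ * z.1, η τ) (τ * z'.1, ζ τ) ≤ (1 + A) * δ := by
          intro τ hτ
          have e1 : |τ * z.1 - τ * z'.1| ≤ |z.1 - z'.1| := by
            rw [← mul_sub, abs_mul, abs_of_nonneg hτ.1]
            exact mul_le_of_le_one_left (abs_nonneg _) hτ.2
          have e2 : |z.1 - z'.1| ≤ δ := by simp [hδ, hd]
          have e3 := hηζ τ hτ
          change |τ * z.1 - τ * z'.1| + ‖η τ - ζ τ‖ ≤ _
          linarith
        have hrate : ∀ τ ∈ Icc (0 : ℝ) 1,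
            ‖T.rate g i (τ * z.1, η τ) - T.rate g i (τ * z'.1, ζ τ)‖ ≤
              LD * (1 + A) * δ + LD * n * (1 + A) * c * (δ + ε) * Real.exp (lam * |τ * z.1|) := by
          intro τ hτ
          have m := hη.mem τ hτ
          have m' := hζ.mem τ hτ
          have e1 := h.D_lip i _ m _ (hmaps _ m) _ m' _ (hmaps _ m')
          have e2 := hx (⟨_, m⟩, ⟨_, m'⟩)
          simp only at e2
          have e3 := hdζ τ hτ
          have e4 : l1 (g (τ * z.1, η τ) - g (τ * z'.1, ζ τ)) ≤
              n * (c * ((1 + A) * (δ + ε) * Real.exp (lam * |τ * z.1|))) := by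
            refine l1_sub_le fun j => ?_
            refine (norm_le_pi_norm (g (τ * z.1, η τ) - g (τ * z'.1, ζ τ)) j).trans (e2.trans ?_)
            refine mul_le_mul_of_nonneg_left
              (mul_le_mul_of_nonneg_right ?_ (Real.exp_pos _).le) hc
            have : 0 ≤ A * ε := by positivity
            linarith
          have e5 : |τ * z.1 - τ * z'.1| + ‖η τ - ζ τ‖ ≤ (1 + A) * δ := e3
          have e6 := mul_le_mul_of_nonneg_left (add_le_add e5 e4) hLD
          refine (e1.trans e6).trans_eq ?_
          ring
        have hint : ‖∫ τ in (0 : ℝ)..1, (T.rate g i (τ * z.1, η τ) - T.rate g i (τ * z'.1, ζ τ))‖ ≤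
            ∫ τ in (0 : ℝ)..1, (LD * (1 + A) * δ +
              LD * n * (1 + A) * c * (δ + ε) * Real.exp (lam * |τ * z.1|)) := by
          refine norm_integral_le_integral_unit zero_mem_unit ?_ hrate
          exact continuousOn_const.add
            (continuousOn_const.mul (continuous_exp_abs lam z.1).continuousOn)
        rw [integral_add_unit (f := fun _ => LD * (1 + A) * δ)
          (g := fun τ => LD * n * (1 + A) * c * (δ + ε) * Real.exp (lam * |τ * z.1|))
          continuousOn_const (continuousOn_const.mul (continuous_exp_abs lam z.1).continuousOn)
          zero_mem_unit one_mem_unit, intervalIntegral.integral_const,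
          intervalIntegral.integral_const_mul, sub_zero, one_smul,
          integral_sub_unit rη rζ zero_mem_unit one_mem_unit] at hint
        set P := ∫ τ in (0 : ℝ)..1, T.rate g i (τ * z.1, η τ)
        set P' := ∫ τ in (0 : ℝ)..1, T.rate g i (τ * z'.1, ζ τ) with hP'
        have hP'b : |P'| ≤ MD := by
          have := intervalIntegral.norm_integral_le_of_norm_le_const (a := (0 : ℝ)) (b := 1)
            (C := MD) (f := fun τ => T.rate g i (τ * z'.1, ζ τ)) (fun τ hτ => by
              rw [uIoc_of_le zero_le_one] at hτ
              have m' := hζ.mem τ (Ioc_subset_Icc_self hτ)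
              exact h.D_bound i _ m' _ (hmaps _ m'))
          simpa using this
        have e0 := h.I_lip i _ (Bounds.zero_mem hη) _ (Bounds.zero_mem hζ)
        have e1 := mul_le_mul_of_nonneg_left (hηζ 0 zero_mem_unit) hLI
        have e2 : |z.1 - z'.1| ≤ δ := by simp [hδ, hd]
        have e3 : |(z.1 - z'.1) * P'| ≤ δ * MD := by
          rw [abs_mul]
          exact mul_le_mul e2 hP'b (abs_nonneg _) hδ0
        set J := ∫ τ in (0 : ℝ)..1, Real.exp (lam * |τ * z.1|) with hJ
        have e4 := mul_integral_exp_abs_le z.1 hlam0 zero_mem_unit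
        set e := Real.exp (lam * |z.1|) with he
        have he1 : 1 ≤ e := Real.one_le_exp (by positivity)
        have e5 : |z.1 * (P - P')| ≤ α * (LD * (1 + A) * δ) + c / 2 * ((δ + ε) * e) := by
          rw [abs_mul]
          have e6 := mul_le_mul_of_nonneg_left hint (abs_nonneg z.1)
          have e7 : |z.1| * (LD * (1 + A) * δ) ≤ α * (LD * (1 + A) * δ) :=
            mul_le_mul_of_nonneg_right (h.time z hz) (by positivity)
          have e8 : |z.1| * (LD * n * (1 + A) * c * (δ + ε) * J) ≤ c / 2 * ((δ + ε) * e) := by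
            calc |z.1| * (LD * n * (1 + A) * c * (δ + ε) * J)
                = LD * n * (1 + A) * c * (δ + ε) * (|z.1| * J) := by ring
              _ ≤ LD * n * (1 + A) * c * (δ + ε) * (e / lam) :=
                mul_le_mul_of_nonneg_left e4 (by positivity)
              _ = (LD * n * (1 + A)) * (c * (δ + ε) * e) / lam := by ring
              _ ≤ c / 2 * ((δ + ε) * e) := by
                rw [div_le_iff₀ hlam0, hlam]
                have : 0 ≤ c * (δ + ε) * e := by positivity
                linarith
          rw [Real.norm_eq_abs, mul_add] at e6
          linarith
        have e9 : (g z - g z') i = (T.I (η 0) i - T.I (ζ 0) i) + (z.1 - z'.1) * P' +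
            z.1 * (P - P') := by
          rw [Pi.sub_apply, hgg i z hz η hη, hgg i z' hz' ζ hζ]
          ring
        rw [e9, Real.norm_eq_abs]
        refine (abs_add_le _ _).trans ?_
        have e10 := abs_add_le (T.I (η 0) i - T.I (ζ 0) i) ((z.1 - z'.1) * P')
        have e11 : C₀ * δ ≤ C₀ * ((δ + ε) * e) := by
          refine mul_le_mul_of_nonneg_left ?_ hC₀0
          nlinarith
        have e12 : C₀ * δ = LI * (A * δ) + δ * MD + α * (LD * (1 + A) * δ) := by rw [hC₀]; ring
        linarith) (⟨z, hz⟩, ⟨z', hz'⟩)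
    simp only at h1
    refine h1.trans ?_
    have h2 : Real.exp (lam * |z.1|) ≤ Real.exp (lam * α) :=
      Real.exp_le_exp.2 (mul_le_mul_of_nonneg_left (h.time z hz) hlam0.le)
    have h3 := mul_le_mul_of_nonneg_left h2
      (mul_nonneg (mul_nonneg zero_le_two hC₀0) (add_nonneg (hd0 z z') hε.le))
    rw [hN]
    linarith
  have hN0 : 0 ≤ N := by positivity
  refine ⟨N, hmaps, hN0, fun i z hz z' hz' => ?_⟩
  refine (norm_le_pi_norm (g z - g z') i).trans ?_
  have h1 : Tendsto (fun ε : ℝ => N * (d z z' + ε)) (𝓝[>] 0) (𝓝 (N * (d z z' + 0))) :=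
    (Continuous.tendsto (by fun_prop) (0 : ℝ)).mono_left nhdsWithin_le_nhds
  rw [add_zero] at h1
  refine ge_of_tendsto h1 ?_
  filter_upwards [self_mem_nhdsWithin] with ε hε using key ε hε z hz z' hz'

end Transport

end ParamPDE

namespace ParamPDE

set_option linter.unusedSectionVars false

open Filter

/-! ### Prolongation of a transport system to the derivatives of its solutions -/

namespace Transport

variable {E : Type*} [NormedAddCommGroup E] [NormedSpace ℝ E] [FiniteDimensional ℝ E] {n : ℕ}
  {T : Transport E n} {α Λ LD LI Mc MD N : ℝ} {f : ℝ × E → Fin n → ℝ}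

/-- The numbering of the components of a function and of its spatial partial derivatives. -/
def prolongIdx (n m : ℕ) : Fin n ⊕ Fin n × Fin m ≃ Fin (n + n * m) :=
  ((Equiv.refl _).sumCongr finProdFinEquiv).trans finSumFinEquiv

/-- The components of the function itself. -/
def lower {m : ℕ} (y : Fin (n + n * m) → ℝ) : Fin n → ℝ := fun j => y (prolongIdx n m (Sum.inl j))

/-- A function together with its spatial partial derivatives. -/
def joinVal {m : ℕ} (y : Fin n → ℝ) (p : Fin n → Fin m → ℝ) : Fin (n + n * m) → ℝ :=
  fun k => Sum.elim y (fun q => p q.1 q.2) ((prolongIdx n m).symm k)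

@[simp] theorem lower_joinVal {m : ℕ} (y : Fin n → ℝ) (p : Fin n → Fin m → ℝ) :
    lower (joinVal y p) = y := by
  ext j; simp [lower, joinVal]

@[simp] theorem joinVal_inl {m : ℕ} (y : Fin n → ℝ) (p : Fin n → Fin m → ℝ) (i : Fin n) :
    joinVal y p (prolongIdx n m (Sum.inl i)) = y i := by simp [joinVal]

@[simp] theorem joinVal_inr {m : ℕ} (y : Fin n → ℝ) (p : Fin n → Fin m → ℝ) (q : Fin n × Fin m) :
    joinVal y p (prolongIdx n m (Sum.inr q)) = p q.1 q.2 := by simp [joinVal]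

theorem contDiff_lower {m : ℕ} {k : WithTop ℕ∞} : ContDiff ℝ k (lower (n := n) (m := m)) :=
  contDiff_pi.2 fun _ => contDiff_apply _ _ _

theorem norm_lower_le {m : ℕ} (y y' : Fin (n + n * m) → ℝ) : ‖lower y - lower y'‖ ≤ ‖y - y'‖ := by
  rw [pi_norm_le_iff_of_nonneg (norm_nonneg _)]
  exact fun i => norm_le_pi_norm (y - y') _

section Definition

variable (E) in
/-- The spatial directions of differentiation, multiples of the vectors of a basis. -/
noncomputable def dir (κ : ℝ) (l : Fin (Module.finrank ℝ E)) : E := κ • Module.finBasis ℝ E l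

/-- The derivative of the argument of the coefficients. -/
noncomputable def prolongArg (κ : ℝ) (y : Fin (n + n * Module.finrank ℝ E) → ℝ)
    (l : Fin (Module.finrank ℝ E)) : (ℝ × E) × (Fin n → ℝ) :=
  ((0, dir E κ l), fun j => y (prolongIdx n _ (Sum.inr (j, l))))

/-- The system of the functions `f` and `∂ f` in the spatial directions. -/
noncomputable def prolong (T : Transport E n) (κ : ℝ) :
    Transport E (n + n * Module.finrank ℝ E) where
  K := T.K
  vel := T.vel
  y₀ := joinVal T.y₀ 0
  b := T.b
  -- The velocities do not involve the derivative components: the derivatives of `f_i` are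
  -- transported along the characteristics of `f_i` itself.
  c k p := T.c (Sum.elim id Prod.fst ((prolongIdx n _).symm k)) (p.1, lower p.2)
  D k p := Sum.elim (fun i => T.D i (p.1, lower p.2))
    (fun q => fderivWithin ℝ (T.D q.1) (T.K ×ˢ T.val) (p.1, lower p.2) (prolongArg κ p.2 q.2) -
      -- The stored derivative components carry a factor `κ`. Expanding a vector in the unscaled
      -- basis and pairing it with them gives `κ` times the derivative of `f`, which is corrected
      -- here.
      κ⁻¹ * ∑ j, (Module.finBasis ℝ E).repr
        (fderivWithin ℝ (T.c q.1) (T.K ×ˢ T.val) (p.1, lower p.2) (prolongArg κ p.2 q.2)) j *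
          p.2 (prolongIdx n _ (Sum.inr (q.1, j)))) ((prolongIdx n _).symm k)
  I x k := Sum.elim (T.I x)
    (fun q => fderivWithin ℝ (fun x => T.I x q.1) T.base x (dir E κ q.2)) ((prolongIdx n _).symm k)

/-- The function together with its spatial derivatives. -/
noncomputable def prolongFun (T : Transport E n) (κ : ℝ) (f : ℝ × E → Fin n → ℝ) (z : ℝ × E) :
    Fin (n + n * Module.finrank ℝ E) → ℝ :=
  joinVal (f z) fun i l => fderivWithin ℝ f T.K z (0, dir E κ l) i

end Definition

/-! ### Components and regularity of the prolonged system. -/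

theorem prolong_c_inl (κ : ℝ) (i : Fin n) :
    (T.prolong κ).c (prolongIdx n _ (Sum.inl i)) = fun p => T.c i (p.1, lower p.2) := by
  simp [prolong]

theorem prolong_c_inr (κ : ℝ) (q : Fin n × Fin (Module.finrank ℝ E)) :
    (T.prolong κ).c (prolongIdx n _ (Sum.inr q)) = fun p => T.c q.1 (p.1, lower p.2) := by
  simp [prolong]

theorem prolong_D_inl (κ : ℝ) (i : Fin n) :
    (T.prolong κ).D (prolongIdx n _ (Sum.inl i)) = fun p => T.D i (p.1, lower p.2) := by
  simp [prolong]

theorem prolong_D_inr (κ : ℝ) (q : Fin n × Fin (Module.finrank ℝ E)) :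
    (T.prolong κ).D (prolongIdx n _ (Sum.inr q)) = fun p =>
      fderivWithin ℝ (T.D q.1) (T.K ×ˢ T.val) (p.1, lower p.2) (prolongArg κ p.2 q.2) -
      κ⁻¹ * ∑ j, (Module.finBasis ℝ E).repr
        (fderivWithin ℝ (T.c q.1) (T.K ×ˢ T.val) (p.1, lower p.2) (prolongArg κ p.2 q.2)) j *
          p.2 (prolongIdx n _ (Sum.inr (q.1, j))) := by
  simp [prolong]

theorem prolong_I_inl (κ : ℝ) (i : Fin n) (x : E) :
    (T.prolong κ).I x (prolongIdx n _ (Sum.inl i)) = T.I x i := by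
  simp [prolong]

theorem prolong_I_inr (κ : ℝ) (q : Fin n × Fin (Module.finrank ℝ E)) (x : E) :
    (T.prolong κ).I x (prolongIdx n _ (Sum.inr q)) =
      fderivWithin ℝ (fun x => T.I x q.1) T.base x (dir E κ q.2) := by
  simp [prolong]

theorem lower_mem_val {κ : ℝ} {y : Fin (n + n * Module.finrank ℝ E) → ℝ}
    (hy : y ∈ (T.prolong κ).val) : lower y ∈ T.val := by
  have h1 : ‖y - joinVal T.y₀ 0‖ ≤ T.b := by rw [← dist_eq_norm]; exact hy
  have h2 := norm_lower_le y (joinVal T.y₀ 0)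
  rw [lower_joinVal] at h2
  rw [val, Metric.mem_closedBall, dist_eq_norm]
  exact h2.trans h1

theorem mapsTo_lower (κ : ℝ) :
    MapsTo (fun p : (ℝ × E) × (Fin (n + n * Module.finrank ℝ E) → ℝ) => (p.1, lower p.2))
      ((T.prolong κ).K ×ˢ (T.prolong κ).val) (T.K ×ˢ T.val) :=
  fun _ hp => ⟨hp.1, lower_mem_val hp.2⟩

theorem IsSmooth.mono {k k' : ℕ} (hs : T.IsSmooth k) (hk : k' ≤ k) : T.IsSmooth k' :=
  ⟨hs.b_pos, hs.convex, hs.compact, hs.nonempty_interior, hs.base_interior,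
    fun i => (hs.c i).of_le (by exact_mod_cast hk), fun i => (hs.D i).of_le (by exact_mod_cast hk),
    fun i => (hs.I i).of_le (by exact_mod_cast hk)⟩

theorem IsSmooth.prolong {k : ℕ} (hs : T.IsSmooth (k + 1)) (κ : ℝ) :
    (T.prolong κ).IsSmooth k := by
  have hproj : ContDiff ℝ k
      (fun p : (ℝ × E) × (Fin (n + n * Module.finrank ℝ E) → ℝ) => (p.1, lower p.2)) :=
    contDiff_fst.prodMk (contDiff_lower.comp contDiff_snd)
  have hle : ((k : ℕ) : WithTop ℕ∞) ≤ ((k + 1 : ℕ) : WithTop ℕ∞) := by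
    exact_mod_cast Nat.le_succ k
  have hle' : ((k : ℕ) : WithTop ℕ∞) + 1 ≤ ((k + 1 : ℕ) : WithTop ℕ∞) := by norm_cast
  have hu := uniqueDiffOn_convex hs.prod_convex hs.prod_interior
  have hu' := uniqueDiffOn_convex hs.base_convex hs.base_interior
  have harg : ∀ l, ContDiff ℝ k (fun p : (ℝ × E) × (Fin (n + n * Module.finrank ℝ E) → ℝ) =>
      prolongArg κ p.2 l) := fun l =>
    contDiff_const.prodMk (contDiff_pi.2 fun j => (contDiff_apply ℝ ℝ _).comp contDiff_snd)
  refine ⟨hs.b_pos, hs.convex, hs.compact, hs.nonempty_interior, hs.base_interior,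
    fun a => ?_, fun a => ?_, fun a => ?_⟩
  · obtain ⟨q, rfl⟩ := (prolongIdx n (Module.finrank ℝ E)).surjective a
    rcases q with i | q
    · rw [prolong_c_inl]
      exact ((hs.c i).of_le hle).comp hproj.contDiffOn (mapsTo_lower κ)
    · rw [prolong_c_inr]
      exact ((hs.c q.1).of_le hle).comp hproj.contDiffOn (mapsTo_lower κ)
  · obtain ⟨q, rfl⟩ := (prolongIdx n (Module.finrank ℝ E)).surjective a
    rcases q with i | q
    · rw [prolong_D_inl]
      exact ((hs.D i).of_le hle).comp hproj.contDiffOn (mapsTo_lower κ)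
    · rw [prolong_D_inr]
      refine ContDiffOn.sub (((hs.D q.1).fderivWithin hu hle').comp hproj.contDiffOn
        (mapsTo_lower κ) |>.clm_apply (harg q.2).contDiffOn) (contDiffOn_const.mul ?_)
      refine ContDiffOn.sum fun j _ => ContDiffOn.mul ?_ ?_
      · have h1 := ((hs.c q.1).fderivWithin hu hle').comp hproj.contDiffOn
          (mapsTo_lower κ) |>.clm_apply (harg q.2).contDiffOn
        exact (LinearMap.toContinuousLinearMap
          ((Module.finBasis ℝ E).coord j)).contDiff.comp_contDiffOn h1
      · exact ((contDiff_apply ℝ ℝ _).comp contDiff_snd).contDiffOn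
  · obtain ⟨q, rfl⟩ := (prolongIdx n (Module.finrank ℝ E)).surjective a
    rcases q with i | q
    · simp only [prolong_I_inl]
      exact (hs.I i).of_le hle
    · simp only [prolong_I_inr]
      exact ((hs.I q.1).fderivWithin hu' hle').clm_apply contDiffOn_const

theorem clm_eq_sum_dir {κ : ℝ} (hκ : κ ≠ 0) (A : ℝ × E →L[ℝ] (Fin n → ℝ)) (v : E) (i : Fin n) :
    A (0, v) i = κ⁻¹ * ∑ j, (Module.finBasis ℝ E).repr v j * A (0, dir E κ j) i := by
  have h1 : A (0, v) = A.comp (ContinuousLinearMap.inr ℝ ℝ E) v := by simp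
  have h2 : ∀ j, A (0, dir E κ j) = κ • A.comp (ContinuousLinearMap.inr ℝ ℝ E)
      (Module.finBasis ℝ E j) := fun j => by
    rw [← map_smul]
    simp only [dir, ContinuousLinearMap.coe_comp, Function.comp_apply, ContinuousLinearMap.inr_apply]
  conv_lhs => rw [h1, ← (Module.finBasis ℝ E).sum_repr v, map_sum]
  simp only [h2, map_smul, Finset.sum_apply, Pi.smul_apply, smul_eq_mul, Finset.mul_sum]
  refine Finset.sum_congr rfl fun j _ => ?_
  field_simp

theorem prolong_rate_inr {κ : ℝ} (hκ : κ ≠ 0) (q : Fin n × Fin (Module.finrank ℝ E)) (z : ℝ × E) :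
    (T.prolong κ).rate (T.prolongFun κ f) (prolongIdx n _ (Sum.inr q)) z =
      T.derivRate f q.1 (dir E κ q.2) z := by
  unfold rate derivRate
  rw [prolong_D_inr]
  have h1 : prolongArg κ (T.prolongFun κ f z) q.2 =
      ((0, dir E κ q.2), fderivWithin ℝ f T.K z (0, dir E κ q.2)) := by
    simp [prolongArg, prolongFun]
  simp only [h1]
  rw [show lower (T.prolongFun κ f z) = f z from lower_joinVal _ _,
    clm_eq_sum_dir hκ (fderivWithin ℝ f T.K z)]
  simp [prolongFun]

theorem prolong_rate_inl (κ : ℝ) (i : Fin n) (z : ℝ × E) :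
    (T.prolong κ).rate (T.prolongFun κ f) (prolongIdx n _ (Sum.inl i)) z = T.rate f i z := by
  unfold rate
  rw [prolong_D_inl]
  simp [prolongFun]

theorem prolong_field_inl (κ : ℝ) (i : Fin n) :
    (T.prolong κ).field (T.prolongFun κ f) (prolongIdx n _ (Sum.inl i)) = T.field f i := by
  ext z
  unfold field
  rw [prolong_c_inl]
  simp [prolongFun]

theorem prolong_field_inr (κ : ℝ) (q : Fin n × Fin (Module.finrank ℝ E)) :
    (T.prolong κ).field (T.prolongFun κ f) (prolongIdx n _ (Sum.inr q)) = T.field f q.1 := by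
  ext z
  unfold field
  rw [prolong_c_inr]
  simp [prolongFun]

theorem continuousOn_prolongFun (hs : T.IsSmooth 1) (hf : ContDiffOn ℝ 1 f T.K) (κ : ℝ) :
    ContinuousOn (T.prolongFun κ f) T.K := by
  have hu := uniqueDiffOn_convex hs.convex hs.nonempty_interior
  have hdf := hf.continuousOn_fderivWithin hu le_rfl
  refine continuousOn_pi.2 fun a => ?_
  obtain ⟨q, rfl⟩ := (prolongIdx n (Module.finrank ℝ E)).surjective a
  rcases q with i | q
  · simpa [prolongFun] using continuousOn_pi.1 hf.continuousOn i
  · simp only [prolongFun, joinVal_inr]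
    exact continuousOn_pi.1 (hdf.clm_apply continuousOn_const) q.1

/-- The prolonged system keeps the radius `b` of the box of values. The directions of
differentiation are shortened by a factor `κ` until the bounded derivatives fit into it. -/
theorem exists_prolongFun_mem_val (hs : T.IsSmooth 1) (hf : T.Admits f N)
    (hf1 : ContDiffOn ℝ 1 f T.K) :
    ∃ κ > 0, ∀ z ∈ T.K, T.prolongFun κ f z ∈ (T.prolong κ).val := by
  have hu := uniqueDiffOn_convex hs.convex hs.nonempty_interior
  obtain ⟨M, hM⟩ := hs.compact.exists_bound_of_continuousOn (hf1.continuousOn_fderivWithin hu le_rfl)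
  obtain ⟨R, hR⟩ := Finite.exists_le fun l => ‖Module.finBasis ℝ E l‖
  refine ⟨T.b / (1 + |M| * |R|), by have := hs.b_pos; positivity, fun z hz => ?_⟩
  have hb := hs.b_pos
  set κ := T.b / (1 + |M| * |R|) with hκ
  have hκ0 : 0 < κ := by positivity
  rw [val, Metric.mem_closedBall, dist_eq_norm]
  refine (pi_norm_le_iff_of_nonneg hb.le).2 ?_
  intro a
  obtain ⟨q, rfl⟩ := (prolongIdx n (Module.finrank ℝ E)).surjective a
  have hfz := hf.maps z hz
  rw [val, Metric.mem_closedBall, dist_eq_norm] at hfz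
  rcases q with i | q
  · simp only [Pi.sub_apply, prolongFun, joinVal_inl, prolong]
    exact (norm_le_pi_norm (f z - T.y₀) i).trans hfz
  · simp only [Pi.sub_apply, prolongFun, joinVal_inr, prolong, Pi.zero_apply, sub_zero]
    refine (norm_le_pi_norm (fderivWithin ℝ f T.K z (0, dir E κ q.2)) q.1).trans ?_
    refine ((fderivWithin ℝ f T.K z).le_opNorm _).trans ?_
    have h1 : ‖((0 : ℝ), dir E κ q.2)‖ ≤ κ * |R| := by
      rw [Prod.norm_def]
      simp only [norm_zero, dir, norm_smul, Real.norm_eq_abs, abs_of_pos hκ0]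
      exact max_le (by positivity) (mul_le_mul_of_nonneg_left ((hR q.2).trans (le_abs_self R)) hκ0.le)
    refine (mul_le_mul ((hM z hz).trans (le_abs_self M)) h1 (norm_nonneg _) (abs_nonneg _)).trans ?_
    have h2 : κ * (1 + |M| * |R|) = T.b := by rw [hκ]; field_simp
    nlinarith

/-- The spatial derivatives are of class `C^(k+1)` by assumption. The time derivative equals the
rate minus the spatial derivative in the direction of the velocity, which is of class `C^(k+1)` too;
hence so is the whole derivative. -/
theorem contDiffOn_of_prolong {k : ℕ} (h : T.Bounds α Λ LD LI Mc MD) (hs : T.IsSmooth (k + 2))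
    (hf : T.Admits f N) (hff : T.Integrates f f) (hf1 : ContDiffOn ℝ 1 f T.K) {κ : ℝ} (hκ : κ ≠ 0)
    (hF : ContDiffOn ℝ (k + 1 : ℕ) (T.prolongFun κ f) T.K) :
    ContDiffOn ℝ (k + 2 : ℕ) f T.K := by
  have hu := uniqueDiffOn_convex hs.convex hs.nonempty_interior
  have hs1 : T.IsSmooth 1 := hs.mono (by omega)
  have hle : ((k + 1 : ℕ) : WithTop ℕ∞) ≤ ((k + 2 : ℕ) : WithTop ℕ∞) := by
    exact_mod_cast Nat.le_succ (k + 1)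
  have hcomp : ∀ a, ContDiffOn ℝ (k + 1 : ℕ) (fun z => T.prolongFun κ f z a) T.K := fun a =>
    contDiffOn_pi.1 hF a
  have hfk : ContDiffOn ℝ (k + 1 : ℕ) f T.K := by
    refine contDiffOn_pi.2 fun i => ?_
    simpa [prolongFun] using hcomp (prolongIdx n _ (Sum.inl i))
  have hp : ∀ i l, ContDiffOn ℝ (k + 1 : ℕ)
      (fun z => fderivWithin ℝ f T.K z (0, dir E κ l) i) T.K := fun i l => by
    simpa [prolongFun] using hcomp (prolongIdx n _ (Sum.inr (i, l)))
  have hgraph : ContDiffOn ℝ (k + 1 : ℕ) (fun z => (z, f z)) T.K := contDiffOn_id.prodMk hfk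
  have hmaps : MapsTo (fun z => (z, f z)) T.K (T.K ×ˢ T.val) := fun z hz => ⟨hz, hf.maps z hz⟩
  have hspace : ∀ i (v : ℝ × E → E), ContDiffOn ℝ (k + 1 : ℕ) v T.K →
      ContDiffOn ℝ (k + 1 : ℕ) (fun z => fderivWithin ℝ f T.K z (0, v z) i) T.K := by
    intro i v hv
    have h1 : (fun z => fderivWithin ℝ f T.K z (0, v z) i) = fun z =>
        κ⁻¹ * ∑ j, (Module.finBasis ℝ E).repr (v z) j * fderivWithin ℝ f T.K z (0, dir E κ j) i := by
      ext z
      exact clm_eq_sum_dir hκ _ _ _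
    rw [h1]
    refine contDiffOn_const.mul (ContDiffOn.sum fun j _ => ContDiffOn.mul ?_ (hp i j))
    exact (LinearMap.toContinuousLinearMap
      ((Module.finBasis ℝ E).coord j)).contDiff.comp_contDiffOn hv
  have hcast : ((k + 2 : ℕ) : WithTop ℕ∞) = ((k + 1 : ℕ) : WithTop ℕ∞) + 1 := by norm_cast
  rw [hcast, contDiffOn_succ_iff_fderivWithin hu]
  refine ⟨hf1.differentiableOn one_ne_zero, fun htop => absurd htop (by simp), ?_⟩
  rw [contDiffOn_clm_apply]
  rintro ⟨s, v⟩
  refine contDiffOn_pi.2 fun i => ?_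
  have hfield : ContDiffOn ℝ (k + 1 : ℕ) (T.field f i) T.K := ((hs.c i).of_le hle).comp hgraph hmaps
  have hrate : ContDiffOn ℝ (k + 1 : ℕ) (T.rate f i) T.K := ((hs.D i).of_le hle).comp hgraph hmaps
  have h1 := (contDiffOn_const (c := s)).mul (hrate.sub (hspace i _ hfield)) |>.add
    (hspace i (fun _ => v) contDiffOn_const)
  refine h1.congr fun z hz => ?_
  have h2 := hff.fderivWithin_eq h hs1 hf hf1 hz i
  have h3 : ((s, v) : ℝ × E) = s • ((1, T.field f i z) - (0, T.field f i z)) + (0, v) := by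
    ext <;> simp
  conv_lhs => rw [h3, map_add, map_smul, map_sub]
  rw [Pi.add_apply, Pi.smul_apply, Pi.sub_apply, h2, smul_eq_mul]

/-- Solutions of transport systems of class `C^(k+1)` are of class `C^(k+1)`. -/
theorem contDiffOn_of_integrates (k : ℕ) : ∀ {n : ℕ} {T : Transport E n} {U : Set (ℝ × E)}
    {f : ℝ × E → Fin n → ℝ} {N : ℝ}, T.IsSmooth (k + 1) → BackwardInvariant T.K T.vel →
    (∀ i, ∀ z ∈ T.K, ∀ y ∈ T.val, T.c i (z, y) ∈ T.vel) → T.IsCore U → T.Admits f N →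
    T.Integrates f f → ContDiffOn ℝ (k + 1 : ℕ) f T.K := by
  -- The number of unknowns and the system vary in the induction: each step passes to the
  -- prolongation, which has more unknowns and data of one class less.
  induction k with
  | zero =>
    intro n T U f N hs hinv hc hU hf hff
    obtain ⟨α, L, M, h⟩ := hs.exists_bounds hinv hc
    simpa using contDiffOn_one_of_integrates h hs hf hff
  | succ k ih =>
    intro n T U f N hs hinv hc hU hf hff
    have hs1 : T.IsSmooth 1 := hs.mono (by omega)
    obtain ⟨α, L, M, h⟩ := hs1.exists_bounds hinv hc
    have hf1 := contDiffOn_one_of_integrates h hs1 hf hff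
    obtain ⟨κ, hκ, hval⟩ := exists_prolongFun_mem_val hs1 hf hf1
    have hsP : (T.prolong κ).IsSmooth (k + 1) := hs.prolong κ
    have hcP : ∀ a, ∀ z ∈ (T.prolong κ).K, ∀ y ∈ (T.prolong κ).val,
        (T.prolong κ).c a (z, y) ∈ (T.prolong κ).vel := fun a z hz y hy =>
      hc _ z hz _ (lower_mem_val hy)
    have hUP : (T.prolong κ).IsCore U := ⟨hU.isOpen, hU.subset, hU.back, hU.dense⟩
    obtain ⟨α', L', M', hP⟩ := (hsP.mono (Nat.le_add_left 1 k)).exists_bounds hinv hcP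
    have hcont : ContinuousOn (T.prolongFun κ f) (T.prolong κ).K := continuousOn_prolongFun hs1 hf1 κ
    have hgraph : ContinuousOn (fun z => (z, T.prolongFun κ f z)) (T.prolong κ).K :=
      continuousOn_id.prodMk hcont
    have hD : ∀ a, ContinuousOn ((T.prolong κ).rate (T.prolongFun κ f) a) (T.prolong κ).K :=
      fun a => (hsP.D a).continuousOn.comp hgraph fun z hz => ⟨hz, hval z hz⟩
    -- The derivatives are so far only continuous, but the velocities depend on `f` alone and are
    -- Lipschitz. The bound `max M M'` lets one constant serve both for these fields and for the
    -- bounds of the prolonged system.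
    have hfield : ∀ a, IsField (T.prolong κ).K (T.prolong κ).vel
        ((T.prolong κ).field (T.prolongFun κ f) a) (L * (1 + n * N)) (max M M') := by
      intro a
      obtain ⟨q, rfl⟩ := (prolongIdx n (Module.finrank ℝ E)).surjective a
      have hF := fun i => hf.isField h i
      rcases q with i | q
      · rw [prolong_field_inl]
        exact ⟨(hF i).mem, (hF i).nonneg, (hF i).lip,
          fun z hz => ((hF i).bound z hz).trans (le_max_left _ _)⟩
      · rw [prolong_field_inr]
        exact ⟨(hF q.1).mem, (hF q.1).nonneg, (hF q.1).lip,
          fun z hz => ((hF q.1).bound z hz).trans (le_max_left _ _)⟩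
    have hP' : (T.prolong κ).Bounds α' L' L' L' (max M M') M' :=
      ⟨hP.inv, hP.time, hP.α_nonneg, hP.Λ_nonneg, hP.LD_nonneg, hP.LI_nonneg,
        hP.Mc_nonneg.trans (le_max_right _ _), hP.MD_nonneg, hP.b_nonneg, hP.c_mem,
        fun i z hz y hy => (hP.c_bound i z hz y hy).trans (le_max_right _ _), hP.D_bound,
        hP.c_lip, hP.D_lip, hP.I_lip⟩
    -- The integral equation of the derivatives is available only in the core. Continuity extends it
    -- to `K`, after which the derivatives are seen to be Lipschitz and the induction hypothesis
    -- applies.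
    have hint : (T.prolong κ).Integrates (T.prolongFun κ f) (T.prolongFun κ f) := by
      refine integrates_of_core hP' hval hcont hD (fun a => (hsP.I a).continuousOn) hfield hUP
        fun a z hz η hη => ?_
      obtain ⟨q, rfl⟩ := (prolongIdx n (Module.finrank ℝ E)).surjective a
      rcases q with i | q
      · rw [prolong_field_inl] at hη
        simp only [prolong_rate_inl, prolong_I_inl]
        simpa [prolongFun] using hff i z (hU.subset hz) η hη
      · rw [prolong_field_inr] at hη
        simp only [prolong_rate_inr hκ.ne', prolong_I_inr]
        simpa [prolongFun] using fderivWithin_eq_integral h hs1 hf hff hf1 hU hz hη (dir E κ q.2)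
    obtain ⟨N', hadm⟩ := exists_admits_of_integrates hP' hval hcont hD hfield hint
    exact contDiffOn_of_prolong h hs hf hff hf1 hκ.ne' (ih hsP hinv hcP hUP hadm hint)

end Transport

end ParamPDE

namespace ParamPDE

set_option linter.unusedSectionVars false

open Filter

/-! ### Space-time coordinates -/

/-- The space of the variables `(x₁, …, x_{m-1}, w)` with the 1-norm. -/
abbrev Space (p d : ℕ) : Type := PiLp 1 fun _ : Fin p ⊕ Fin d => ℝ

/-- The linear change of coordinates from `(x, w)` to `(x_m, (x₁, …, x_{m-1}, w))`. -/
noncomputable def coordLin (p d : ℕ) : (Pt p × (Fin d → ℝ)) ≃ₗ[ℝ] ℝ × Space p d where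
  toFun q := (q.1.2, WithLp.toLp 1 (Sum.elim q.1.1 q.2))
  invFun z := ((fun l => z.2 (Sum.inl l), z.1), fun j => z.2 (Sum.inr j))
  map_add' q q' := by
    ext1
    · rfl
    · ext j; cases j <;> simp
  map_smul' c q := by
    ext1
    · rfl
    · ext j; cases j <;> simp
  left_inv q := by rfl
  right_inv z := by
    ext1
    · rfl
    · ext j; cases j <;> simp

/-- The continuous linear change of coordinates. -/
noncomputable def coord (p d : ℕ) : (Pt p × (Fin d → ℝ)) ≃L[ℝ] ℝ × Space p d :=
  (coordLin p d).toContinuousLinearEquiv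

theorem coord_apply {p d : ℕ} (q : Pt p × (Fin d → ℝ)) :
    coord p d q = (q.1.2, WithLp.toLp 1 (Sum.elim q.1.1 q.2)) := rfl

theorem coord_symm_apply {p d : ℕ} (z : ℝ × Space p d) :
    (coord p d).symm z = ((fun l => z.2 (Sum.inl l), z.1), fun j => z.2 (Sum.inr j)) := rfl

namespace System

variable {p n d : ℕ} (Q : System p n d)

/-- The base point of time `0`. -/
def origin : Pt p × (Fin d → ℝ) := ((0, Q.x₀.2), 0)

/-- Space-time coordinates of a point. -/
noncomputable def ofPt (q : Pt p × (Fin d → ℝ)) : ℝ × Space p d := coord p d (q - Q.origin)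

/-- The point with given space-time coordinates. -/
noncomputable def toPt (z : ℝ × Space p d) : Pt p × (Fin d → ℝ) := (coord p d).symm z + Q.origin

@[simp] theorem toPt_ofPt (q : Pt p × (Fin d → ℝ)) : Q.toPt (Q.ofPt q) = q := by
  simp [toPt, ofPt]

@[simp] theorem ofPt_toPt (z : ℝ × Space p d) : Q.ofPt (Q.toPt z) = z := by
  simp [toPt, ofPt]

theorem toPt_fst_fst (z : ℝ × Space p d) (l : Fin p) : (Q.toPt z).1.1 l = z.2 (Sum.inl l) := by
  simp [toPt, origin, coord_symm_apply]

theorem toPt_fst_snd (z : ℝ × Space p d) : (Q.toPt z).1.2 = z.1 + Q.x₀.2 := by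
  simp [toPt, origin, coord_symm_apply]

theorem toPt_snd (z : ℝ × Space p d) (j : Fin d) : (Q.toPt z).2 j = z.2 (Sum.inr j) := by
  simp [toPt, origin, coord_symm_apply]

theorem ofPt_fst (q : Pt p × (Fin d → ℝ)) : (Q.ofPt q).1 = q.1.2 - Q.x₀.2 := rfl

theorem ofPt_snd_inl (q : Pt p × (Fin d → ℝ)) (l : Fin p) :
    (Q.ofPt q).2 (Sum.inl l) = q.1.1 l := by
  simp [ofPt, origin, coord_apply]

theorem ofPt_snd_inr (q : Pt p × (Fin d → ℝ)) (j : Fin d) :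
    (Q.ofPt q).2 (Sum.inr j) = q.2 j := by
  simp [ofPt, origin, coord_apply]

/-- Space-time coordinates as a homeomorphism. -/
noncomputable def coordHomeo : (Pt p × (Fin d → ℝ)) ≃ₜ ℝ × Space p d where
  toFun := Q.ofPt
  invFun := Q.toPt
  left_inv := Q.toPt_ofPt
  right_inv := Q.ofPt_toPt
  continuous_toFun := (coord p d).continuous.comp (continuous_id.sub continuous_const)
  continuous_invFun := (coord p d).symm.continuous.add continuous_const

theorem contDiff_toPt {k : WithTop ℕ∞} : ContDiff ℝ k Q.toPt :=
  (coord p d).symm.contDiff.add contDiff_const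

theorem contDiff_ofPt {k : WithTop ℕ∞} : ContDiff ℝ k Q.ofPt :=
  (coord p d).contDiff.comp (contDiff_id.sub contDiff_const)

theorem hasFDerivAt_ofPt (q : Pt p × (Fin d → ℝ)) :
    HasFDerivAt Q.ofPt (coord p d : (Pt p × (Fin d → ℝ)) →L[ℝ] ℝ × Space p d) q :=
  (coord p d).hasFDerivAt.comp q ((hasFDerivAt_id q).sub_const _)

theorem toPt_combo (z z' : ℝ × Space p d) {a b : ℝ} (hab : a + b = 1) :
    Q.toPt (a • z + b • z') = a • Q.toPt z + b • Q.toPt z' := by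
  have h1 : Q.origin = a • Q.origin + b • Q.origin := by rw [← add_smul, hab, one_smul]
  unfold toPt
  conv_lhs => rw [h1]
  simp only [map_add, map_smul, smul_add]
  abel

theorem norm_space {p d : ℕ} (v : Space p d) :
    ‖v‖ = (∑ l, |v (Sum.inl l)|) + ∑ j, |v (Sum.inr j)| := by
  rw [PiLp.norm_eq_of_L1, Fintype.sum_sum_type]
  rfl

theorem norm_ofPt_sub (q q' : Pt p × (Fin d → ℝ)) :
    ‖(Q.ofPt q).2 - (Q.ofPt q').2‖ = l1 (q.1.1 - q'.1.1) + l1 (q.2 - q'.2) := by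
  rw [norm_space]
  simp [l1, ofPt_snd_inl, ofPt_snd_inr]

theorem abs_ofPt_sub (q q' : Pt p × (Fin d → ℝ)) :
    |(Q.ofPt q).1 - (Q.ofPt q').1| = |q.1.2 - q'.1.2| := by
  simp [ofPt_fst]

/-! ### The standard domain -/

/-- The inequalities that describe the standard domain. -/
theorem mem_S_iff {K : Constants p} {α : ℝ} (hK : ∀ l, K.mCl l ≤ K.MCl l) {x : Pt p} :
    x ∈ Q.S K α ↔ x ∈ Q.P₁ ∧ |x.2 - Q.x₀.2| ≤ α ∧ ∀ l,
      (-Q.abar + K.MCl l * (x.2 - Q.x₀.2) ≤ x.1 l - Q.x₀.1 l ∧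
        -Q.abar + K.mCl l * (x.2 - Q.x₀.2) ≤ x.1 l - Q.x₀.1 l) ∧
      (x.1 l - Q.x₀.1 l ≤ Q.abar + K.mCl l * (x.2 - Q.x₀.2) ∧
        x.1 l - Q.x₀.1 l ≤ Q.abar + K.MCl l * (x.2 - Q.x₀.2)) := by
  constructor
  · rintro (⟨h1, h2, h3, h4⟩ | ⟨h1, h2, h3, h4⟩)
    · refine ⟨h1, abs_le.2 ⟨by linarith, h3⟩, fun l => ?_⟩
      -- For either sign of the time, two of the four inequalities imply the other two, so all four
      -- may be imposed throughout.
      have h5 := mul_le_mul_of_nonneg_right (hK l) h2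
      obtain ⟨h6, h7⟩ := h4 l
      exact ⟨⟨h6, by linarith⟩, h7, by linarith⟩
    · refine ⟨h1, abs_le.2 ⟨h2, by linarith⟩, fun l => ?_⟩
      have h5 := mul_le_mul_of_nonpos_right (hK l) h3
      obtain ⟨h6, h7⟩ := h4 l
      exact ⟨⟨by linarith, h6⟩, by linarith, h7⟩
  · rintro ⟨h1, h2, h3⟩
    obtain ⟨h4, h5⟩ := abs_le.1 h2
    rcases le_total 0 (x.2 - Q.x₀.2) with h0 | h0
    · exact Or.inl ⟨h1, h0, h5, fun l => ⟨(h3 l).1.1, (h3 l).2.1⟩⟩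
    · exact Or.inr ⟨h1, h4, h0, fun l => ⟨(h3 l).1.2, (h3 l).2.2⟩⟩

theorem mem_P₁_iff {x : Pt p} (ha : 0 ≤ Q.a) :
    x ∈ Q.P₁ ↔ (∀ l, |x.1 l - Q.x₀.1 l| ≤ Q.a) ∧ |x.2 - Q.x₀.2| ≤ Q.a := by
  rw [P₁, Metric.mem_closedBall, Prod.dist_eq, max_le_iff, dist_pi_le_iff ha]
  rfl

theorem mem_V_iff {v : Fin p → ℝ} (h : 0 ≤ Q.abar) :
    v ∈ Q.V ↔ ∀ l, |v l - Q.x₀.1 l| ≤ Q.abar := by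
  rw [V, Metric.mem_closedBall, dist_pi_le_iff h]
  rfl

/-- The domain is defined as a union of two pieces, but in the description by all four inequalities
it is the intersection of a box, a slab and half-spaces. -/
theorem convex_S {K : Constants p} {α : ℝ} (hK : ∀ l, K.mCl l ≤ K.MCl l) :
    Convex ℝ (Q.S K α) := by
  intro x hx y hy a b ha hb hab
  rw [Q.mem_S_iff hK] at hx hy ⊢
  obtain ⟨x1, x2, x3⟩ := hx
  obtain ⟨y1, y2, y3⟩ := hy
  obtain rfl : b = 1 - a := by linarith
  refine ⟨convex_closedBall _ _ x1 y1 ha hb hab, ?_, fun l => ?_⟩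
  · rw [abs_le] at x2 y2 ⊢
    simp only [Prod.snd_add, Prod.smul_snd, smul_eq_mul]
    have e1 := mul_le_mul_of_nonneg_left x2.1 ha
    have e2 := mul_le_mul_of_nonneg_left y2.1 hb
    have e3 := mul_le_mul_of_nonneg_left x2.2 ha
    have e4 := mul_le_mul_of_nonneg_left y2.2 hb
    constructor <;> linarith
  · obtain ⟨⟨xa, xb⟩, xc, xd⟩ := x3 l
    obtain ⟨⟨ya, yb⟩, yc, yd⟩ := y3 l
    simp only [Prod.snd_add, Prod.smul_snd, smul_eq_mul, Prod.fst_add, Prod.smul_fst, Pi.add_apply,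
      Pi.smul_apply]
    refine ⟨⟨?_, ?_⟩, ?_, ?_⟩
    · linarith [mul_le_mul_of_nonneg_left xa ha, mul_le_mul_of_nonneg_left ya hb]
    · linarith [mul_le_mul_of_nonneg_left xb ha, mul_le_mul_of_nonneg_left yb hb]
    · linarith [mul_le_mul_of_nonneg_left xc ha, mul_le_mul_of_nonneg_left yc hb]
    · linarith [mul_le_mul_of_nonneg_left xd ha, mul_le_mul_of_nonneg_left yd hb]

theorem isCompact_S {K : Constants p} {α : ℝ} (hK : ∀ l, K.mCl l ≤ K.MCl l) :
    IsCompact (Q.S K α) := by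
  have h1 : Q.S K α = Q.P₁ ∩ ({x | |x.2 - Q.x₀.2| ≤ α} ∩ ⋂ l,
      {x | (-Q.abar + K.MCl l * (x.2 - Q.x₀.2) ≤ x.1 l - Q.x₀.1 l ∧
        -Q.abar + K.mCl l * (x.2 - Q.x₀.2) ≤ x.1 l - Q.x₀.1 l) ∧
      (x.1 l - Q.x₀.1 l ≤ Q.abar + K.mCl l * (x.2 - Q.x₀.2) ∧
        x.1 l - Q.x₀.1 l ≤ Q.abar + K.MCl l * (x.2 - Q.x₀.2))}) := by
    ext x
    rw [Q.mem_S_iff hK]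
    simp
  rw [h1]
  refine (isCompact_closedBall _ _).inter_right (IsClosed.inter ?_ (isClosed_iInter fun l => ?_))
  · exact isClosed_le (by fun_prop) continuous_const
  · have c1 : ∀ M : ℝ, IsClosed {x : Pt p | -Q.abar + M * (x.2 - Q.x₀.2) ≤ x.1 l - Q.x₀.1 l} :=
      fun M => isClosed_le (by fun_prop) (by fun_prop)
    have c2 : ∀ M : ℝ, IsClosed {x : Pt p | x.1 l - Q.x₀.1 l ≤ Q.abar + M * (x.2 - Q.x₀.2)} :=
      fun M => isClosed_le (by fun_prop) (by fun_prop)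
    exact ((c1 _).inter (c1 _)).inter ((c2 _).inter (c2 _))

theorem isDomain_S (habar : 0 < Q.abar) (ha : Q.abar ≤ Q.a) {K : Constants p} {α : ℝ}
    (hα : 0 < α) (hK : ∀ l, K.mCl l ≤ K.MCl l) : Q.IsDomain (Q.S K α) := by
  have ha0 : 0 < Q.a := habar.trans_le ha
  refine ⟨fun v hv => ?_, ?_, fun v hv => ?_⟩
  · rw [Q.mem_V_iff habar.le] at hv
    rw [Q.mem_S_iff hK, Q.mem_P₁_iff ha0.le]
    simp only [onV, sub_self, abs_zero, mul_zero, add_zero]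
    refine ⟨⟨fun l => (hv l).trans ha, ha0.le⟩, hα.le, fun l => ?_⟩
    obtain ⟨h1, h2⟩ := abs_le.1 (hv l)
    exact ⟨⟨h1, h1⟩, h2, h2⟩
  · rintro x (hx | hx) <;> exact hx.1
  · have hv' : ∀ l, |v l - Q.x₀.1 l| < Q.abar := fun l =>
      (dist_pi_lt_iff habar).1 (Metric.mem_ball.1 hv) l
    have e1 : ∀ᶠ x in 𝓝 (Q.onV v), x ∈ Q.P₁ := by
      refine Metric.closedBall_mem_nhds_of_mem ?_
      rw [Metric.mem_ball, Prod.dist_eq]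
      exact max_lt ((Metric.mem_ball.1 hv).trans_le ha) (by simpa [onV] using ha0)
    have e2 : ∀ᶠ x in 𝓝 (Q.onV v), |x.2 - Q.x₀.2| < α := by
      have h1 : ContinuousAt (fun x : Pt p => |x.2 - Q.x₀.2|) (Q.onV v) := by fun_prop
      exact h1.eventually_lt_const (by simpa [onV] using hα)
    have e3 : ∀ M : ℝ, ∀ l, ∀ᶠ x in 𝓝 (Q.onV v),
        -Q.abar + M * (x.2 - Q.x₀.2) < x.1 l - Q.x₀.1 l := by
      intro M l
      have h1 : ContinuousAt (fun x : Pt p => -Q.abar + M * (x.2 - Q.x₀.2)) (Q.onV v) := by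
        fun_prop
      have h2 : ContinuousAt (fun x : Pt p => x.1 l - Q.x₀.1 l) (Q.onV v) := by fun_prop
      refine h1.eventually_lt h2 ?_
      simpa [onV] using (abs_lt.1 (hv' l)).1
    have e4 : ∀ M : ℝ, ∀ l, ∀ᶠ x in 𝓝 (Q.onV v),
        x.1 l - Q.x₀.1 l < Q.abar + M * (x.2 - Q.x₀.2) := by
      intro M l
      have h1 : ContinuousAt (fun x : Pt p => Q.abar + M * (x.2 - Q.x₀.2)) (Q.onV v) := by
        fun_prop
      have h2 : ContinuousAt (fun x : Pt p => x.1 l - Q.x₀.1 l) (Q.onV v) := by fun_prop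
      refine h2.eventually_lt h1 ?_
      simpa [onV] using (abs_lt.1 (hv' l)).2
    filter_upwards [e1, e2, eventually_all.2 fun l => e3 (K.MCl l) l,
      eventually_all.2 fun l => e3 (K.mCl l) l, eventually_all.2 fun l => e4 (K.mCl l) l,
      eventually_all.2 fun l => e4 (K.MCl l) l] with x h1 h2 h3 h4 h5 h6
    exact (Q.mem_S_iff hK).2 ⟨h1, h2.le, fun l => ⟨⟨(h3 l).le, (h4 l).le⟩, (h5 l).le, (h6 l).le⟩⟩

/-- Moving a point of the standard domain towards the initial hyperplane, with an admissible
velocity, does not leave the standard domain. -/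
theorem back_mem_S (habar : 0 < Q.abar) (ha : Q.abar ≤ Q.a) {K : Constants p} {α : ℝ}
    (hα : 0 < α) (hK : ∀ l, K.mCl l ≤ K.MCl l) {x y : Pt p} (hx : x ∈ Q.S K α) {v : Fin p → ℝ}
    (hv : ∀ l, K.mCl l ≤ v l ∧ v l ≤ K.MCl l) {θ : ℝ} (hθ : θ ∈ Icc (0 : ℝ) 1)
    (hy : y.2 - Q.x₀.2 = θ * (x.2 - Q.x₀.2))
    (hy' : ∀ l, y.1 l = x.1 l - (1 - θ) * (x.2 - Q.x₀.2) * v l) : y ∈ Q.S K α := by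
  obtain ⟨x1, x2, x3⟩ := (Q.mem_S_iff hK).1 hx
  set t := x.2 - Q.x₀.2 with ht
  -- The sides of the domain recede with the extreme velocities, so going all the way back leads
  -- into `V`. The point `y` lies on the segment from this foot point to `x`, and convexity
  -- finishes.
  have hu : (fun l => x.1 l - t * v l) ∈ Q.V := by
    rw [Q.mem_V_iff habar.le]
    intro l
    obtain ⟨⟨h1, h2⟩, h3, h4⟩ := x3 l
    obtain ⟨h5, h6⟩ := hv l
    rw [abs_le]
    rcases le_total 0 t with h0 | h0
    · have e1 := mul_le_mul_of_nonneg_right h5 h0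
      have e2 := mul_le_mul_of_nonneg_right h6 h0
      constructor <;> linarith
    · have e1 := mul_le_mul_of_nonpos_right h5 h0
      have e2 := mul_le_mul_of_nonpos_right h6 h0
      constructor <;> linarith
  have h0 := (Q.isDomain_S habar ha hα hK).1 _ hu
  have h1 := Q.convex_S hK hx h0 hθ.1 (sub_nonneg.2 hθ.2) (by ring)
  convert h1 using 1
  ext l
  · simp only [hy', onV, Prod.fst_add, Prod.smul_fst, Pi.add_apply, Pi.smul_apply, smul_eq_mul]
    ring
  · simp only [onV, Prod.snd_add, Prod.smul_snd, smul_eq_mul]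
    linarith

end System

/-! ### The interior of the domain of a transport system -/

/-- For `θ > 0` the backward move with fixed `v` is invertible with continuous inverse, so it sends
neighbourhoods to neighbourhoods. For `θ = 0` it collapses onto the base; there it yields only an
interior point of the base, and `h0` bridges the gap. -/
theorem Transport.isCore_interior {E : Type*} [NormedAddCommGroup E] [NormedSpace ℝ E] {n : ℕ}
    {T : Transport E n} (hconv : Convex ℝ T.K) (hne : (interior T.K).Nonempty)
    (hinv : BackwardInvariant T.K T.vel)
    (h0 : ∀ x ∈ interior T.base, ((0 : ℝ), x) ∈ interior T.K) : T.IsCore (interior T.K) := by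
  refine ⟨isOpen_interior, interior_subset, fun z hz v hv θ hθ => ?_, ?_⟩
  · have hK := mem_interior_iff_mem_nhds.1 hz
    rcases eq_or_lt_of_le hθ.1 with h | h
    · subst h
      simp only [zero_mul, sub_zero, one_mul]
      refine h0 _ (mem_interior_iff_mem_nhds.2 ?_)
      have h1 : ContinuousAt (fun x : E => (z.1, x + z.1 • v)) (z.2 - z.1 • v) := by fun_prop
      have h2 : T.K ∈ 𝓝 (z.1, z.2 - z.1 • v + z.1 • v) := by simpa using hK
      filter_upwards [h1.preimage_mem_nhds h2] with x hx
      have := hinv.back _ hx v hv 0 zero_mem_unit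
      simpa [Transport.base] using this
    · rw [mem_interior_iff_mem_nhds]
      -- The inverse of the backward move with the fixed velocity `v`.
      set ψ : ℝ × E → ℝ × E := fun z' => (z'.1 / θ, z'.2 + ((1 - θ) * (z'.1 / θ)) • v) with hψ
      have h1 : ContinuousAt ψ (θ * z.1, z.2 - ((1 - θ) * z.1) • v) := by
        have : Continuous ψ := by
          simp only [hψ, div_eq_mul_inv]
          fun_prop
        exact this.continuousAt
      have h2 : ψ (θ * z.1, z.2 - ((1 - θ) * z.1) • v) = z := by
        ext
        · simp only [hψ]; field_simp
        · simp only [hψ]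
          rw [mul_div_cancel_left₀ _ h.ne']
          simp
      have h3 : T.K ∈ 𝓝 (ψ (θ * z.1, z.2 - ((1 - θ) * z.1) • v)) := by rwa [h2]
      filter_upwards [h1.preimage_mem_nhds h3] with z' hz'
      have := hinv.back _ hz' v hv θ hθ
      have h4 : (θ * (ψ z').1, (ψ z').2 - ((1 - θ) * (ψ z').1) • v) = z' := by
        ext
        · simp only [hψ]; field_simp
        · simp [hψ]
      rwa [h4] at this
  · rw [hconv.closure_interior_eq_closure_of_nonempty_interior hne]
    exact subset_closure

end ParamPDE

namespace ParamPDE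

set_option linter.unusedSectionVars false

open Filter

namespace System

variable {p n d : ℕ} (Q : System p n d)

/-! ### The transport system of the given equations -/

/-- The standing assumptions, without any regularity of the data beyond the given constants. -/
structure Setting (K : Constants p) (α : ℝ) : Prop where
  hp : 1 ≤ p
  hn : 1 ≤ n
  abar_pos : 0 < Q.abar
  abar_le : Q.abar ≤ Q.a
  b_pos : 0 < Q.b
  c_pos : 0 < Q.c
  isConstants : Q.IsConstants K
  admissible : Q.Admissible K α

theorem l1_nonneg {k : ℕ} (v : Fin k → ℝ) : 0 ≤ l1 v := Finset.sum_nonneg fun _ _ => abs_nonneg _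

@[simp] theorem l1_zero {k : ℕ} : l1 (0 : Fin k → ℝ) = 0 := by simp [l1]

/-- The equations in space-time coordinates. -/
noncomputable def transport (K : Constants p) (α : ℝ) : Transport (Space p d) n where
  K := Q.toPt ⁻¹' (Q.S K α ×ˢ Q.P₃)
  vel := {v | (∀ l, K.mCl l ≤ v (Sum.inl l) ∧ v (Sum.inl l) ≤ K.MCl l) ∧ ∀ j, v (Sum.inr j) = 0}
  y₀ := Q.y₀
  b := Q.b
  -- Parameters are space variables with velocity zero. With the 1-norm on space, the `p` velocity
  -- components have the joint Lipschitz constant `p * L_C`, the `Λ` of the transport system.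
  c i q := WithLp.toLp 1 (Sum.elim (fun l => Q.C i l ((Q.toPt q.1).1, q.2, (Q.toPt q.1).2)) 0)
  D i q := Q.D i ((Q.toPt q.1).1, q.2, (Q.toPt q.1).2)
  I x := Q.I (fun l => x (Sum.inl l), fun j => x (Sum.inr j))

/-! ### The equations form a transport system with the given constants. -/

namespace Setting

variable {Q} {K : Constants p} {α : ℝ}

theorem mem_P₁ (h : Q.Setting K α) : Q.x₀ ∈ Q.P₁ :=
  Metric.mem_closedBall_self (h.abar_pos.trans_le h.abar_le).le

theorem mem_P₂ (h : Q.Setting K α) : Q.y₀ ∈ Q.P₂ := Metric.mem_closedBall_self h.b_pos.le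

theorem mem_P₃ (h : Q.Setting K α) : Q.w₀ ∈ Q.P₃ := Metric.mem_closedBall_self h.c_pos.le

theorem center_mem (h : Q.Setting K α) : (Q.x₀, Q.y₀, Q.w₀) ∈ Q.PP₃ :=
  ⟨h.mem_P₁, h.mem_P₂, h.mem_P₃⟩

theorem mCl_le (h : Q.Setting K α) (l : Fin p) : K.mCl l ≤ K.MCl l := by
  obtain ⟨-, -, -, h4, -⟩ := h.isConstants
  obtain ⟨h5, h6⟩ := h4 ⟨0, h.hn⟩ l _ h.center_mem
  exact h5.trans h6

theorem MD_nonneg (h : Q.Setting K α) : 0 ≤ K.MD :=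
  (abs_nonneg _).trans (h.isConstants.2.1 ⟨0, h.hn⟩ _ h.center_mem)

theorem MC_nonneg (h : Q.Setting K α) : 0 ≤ K.MC :=
  (abs_nonneg _).trans (h.isConstants.2.2.1 ⟨0, h.hn⟩ ⟨0, h.hp⟩ _ h.center_mem)

/-- A second point of the box, at distance `a` from the centre. The Lipschitz constants are not
assumed nonnegative, and testing them on these two points shows that they are. -/
theorem top_mem_P₁ (h : Q.Setting K α) : (Q.x₀.1, Q.x₀.2 + Q.a) ∈ Q.P₁ := by
  have ha := (h.abar_pos.trans_le h.abar_le).le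
  rw [Q.mem_P₁_iff ha]
  simp [ha, abs_of_nonneg ha]

theorem LC_nonneg (h : Q.Setting K α) : 0 ≤ K.LC := by
  have ha := h.abar_pos.trans_le h.abar_le
  obtain ⟨-, -, -, -, h5, -⟩ := h.isConstants
  have h6 := (abs_nonneg _).trans (h5 ⟨0, h.hn⟩ ⟨0, h.hp⟩ _ h.top_mem_P₁ _ h.mem_P₂ _ h.mem_P₃
    _ h.mem_P₁ _ h.mem_P₂ _ h.mem_P₃)
  simp only [sub_self, l1_zero, zero_add, add_zero, add_sub_cancel_left, abs_of_pos ha] at h6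
  exact nonneg_of_mul_nonneg_left h6 ha

theorem LD_nonneg (h : Q.Setting K α) : 0 ≤ K.LD := by
  have ha := h.abar_pos.trans_le h.abar_le
  obtain ⟨-, -, -, -, -, h5, -⟩ := h.isConstants
  have h6 := (abs_nonneg _).trans (h5 ⟨0, h.hn⟩ _ h.top_mem_P₁ _ h.mem_P₂ _ h.mem_P₃
    _ h.mem_P₁ _ h.mem_P₂ _ h.mem_P₃)
  simp only [sub_self, l1_zero, zero_add, add_zero, add_sub_cancel_left, abs_of_pos ha] at h6
  exact nonneg_of_mul_nonneg_left h6 ha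

theorem LI_nonneg (h : Q.Setting K α) : 0 ≤ K.LI := by
  have ha := h.abar_pos
  obtain ⟨-, -, -, -, -, -, h5⟩ := h.isConstants
  have h1 : (fun l => Q.x₀.1 l + Q.abar) ∈ Q.V := by
    rw [Q.mem_V_iff ha.le]
    simp [abs_of_pos ha]
  have h2 : Q.x₀.1 ∈ Q.V := Metric.mem_closedBall_self ha.le
  have h6 := (abs_nonneg _).trans (h5 ⟨0, h.hn⟩ _ h1 _ h.mem_P₃ _ h2 _ h.mem_P₃)
  have h3 : l1 ((fun l => Q.x₀.1 l + Q.abar) - Q.x₀.1) = p * Q.abar := by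
    simp [l1, abs_of_pos ha]
  rw [sub_self, l1_zero, add_zero, h3] at h6
  have : (0 : ℝ) < p := by exact_mod_cast h.hp
  exact nonneg_of_mul_nonneg_left h6 (by positivity)

theorem isDomain (h : Q.Setting K α) : Q.IsDomain (Q.S K α) :=
  Q.isDomain_S h.abar_pos h.abar_le h.admissible.1 h.mCl_le

theorem subset_P₁ (h : Q.Setting K α) : Q.S K α ⊆ Q.P₁ := h.isDomain.2.1

theorem convex (h : Q.Setting K α) : Convex ℝ (Q.S K α ×ˢ Q.P₃) :=
  (Q.convex_S h.mCl_le).prod (convex_closedBall _ _)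

theorem isCompact (h : Q.Setting K α) : IsCompact (Q.S K α ×ˢ Q.P₃) :=
  (Q.isCompact_S h.mCl_le).prod (isCompact_closedBall _ _)

theorem isInterior_S (h : Q.Setting K α) : (interior (Q.S K α)).Nonempty :=
  ⟨_, mem_interior_iff_mem_nhds.2 (h.isDomain.2.2 _ (Metric.mem_ball_self h.abar_pos))⟩

theorem nonempty_interior (h : Q.Setting K α) : (interior (Q.S K α ×ˢ Q.P₃)).Nonempty := by
  rw [interior_prod_eq]
  refine h.isInterior_S.prod ⟨Q.w₀, ?_⟩
  exact Metric.ball_subset_interior_closedBall (Metric.mem_ball_self h.c_pos)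

theorem back (h : Q.Setting K α) : BackwardInvariant (Q.transport K α).K (Q.transport K α).vel := by
  refine ⟨h.isCompact.isClosed.preimage Q.coordHomeo.symm.continuous, ?_, ?_, ?_⟩
  · intro v hv w hw a b ha hb hab
    obtain rfl : b = 1 - a := by linarith
    refine ⟨fun l => ?_, fun j => ?_⟩
    · obtain ⟨h1, h2⟩ := hv.1 l
      obtain ⟨h3, h4⟩ := hw.1 l
      simp only [PiLp.add_apply, PiLp.smul_apply, smul_eq_mul]
      constructor
      · linarith [mul_le_mul_of_nonneg_left h1 ha, mul_le_mul_of_nonneg_left h3 hb]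
      · linarith [mul_le_mul_of_nonneg_left h2 ha, mul_le_mul_of_nonneg_left h4 hb]
    · simp [hv.2 j, hw.2 j]
  · have e : (Q.transport K α).vel = (⋂ l, ({v | K.mCl l ≤ v (Sum.inl l)} ∩
        {v | v (Sum.inl l) ≤ K.MCl l})) ∩ ⋂ j, {v | v (Sum.inr j) = 0} := by
      ext v
      simp [transport]
    have c1 : ∀ s, Continuous fun v : Space p d => v s := fun s => by fun_prop
    rw [e]
    exact (isClosed_iInter fun l => (isClosed_le continuous_const (c1 _)).inter
      (isClosed_le (c1 _) continuous_const)).inter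
      (isClosed_iInter fun j => isClosed_eq (c1 _) continuous_const)
  · rintro z ⟨hz, hz'⟩ v ⟨hv, hv'⟩ θ hθ
    refine ⟨Q.back_mem_S h.abar_pos h.abar_le h.admissible.1 h.mCl_le hz hv hθ ?_ fun l => ?_, ?_⟩
    · simp [toPt_fst_snd]
    · simp [toPt_fst_fst, toPt_fst_snd]
    · have : (Q.toPt (θ * z.1, z.2 - ((1 - θ) * z.1) • v)).2 = (Q.toPt z).2 := by
        ext j
        simp [toPt_snd, hv' j]
      rw [this]
      exact hz'

theorem mem_transport_K {z : ℝ × Space p d} :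
    z ∈ (Q.transport K α).K ↔ (Q.toPt z).1 ∈ Q.S K α ∧ (Q.toPt z).2 ∈ Q.P₃ := Iff.rfl

theorem ofPt_mem {x : Pt p} {w : Fin d → ℝ} (hx : x ∈ Q.S K α) (hw : w ∈ Q.P₃) :
    Q.ofPt (x, w) ∈ (Q.transport K α).K := by
  rw [mem_transport_K, toPt_ofPt]
  exact ⟨hx, hw⟩

theorem toPt_zero (x : Space p d) :
    Q.toPt (0, x) = (Q.onV fun l => x (Sum.inl l), fun j => x (Sum.inr j)) := by
  ext
  · simp [toPt_fst_fst, onV]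
  · simp [toPt_fst_snd, onV]
  · simp [toPt_snd]

theorem mem_V_of_onV (h : Q.Setting K α) {v : Fin p → ℝ} (hv : Q.onV v ∈ Q.S K α) : v ∈ Q.V := by
  rw [Q.mem_V_iff h.abar_pos.le]
  intro l
  have h1 := ((Q.mem_S_iff h.mCl_le).1 hv).2.2 l
  simp only [onV, sub_self, mul_zero, add_zero] at h1
  exact abs_le.2 ⟨h1.1.1, h1.2.1⟩

theorem mem_base (h : Q.Setting K α) {x : Space p d} :
    ((0 : ℝ), x) ∈ (Q.transport K α).K ↔
      (fun l => x (Sum.inl l)) ∈ Q.V ∧ (fun j => x (Sum.inr j)) ∈ Q.P₃ := by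
  rw [mem_transport_K, toPt_zero]
  exact ⟨fun h1 => ⟨h.mem_V_of_onV h1.1, h1.2⟩, fun h1 => ⟨h.isDomain.1 _ h1.1, h1.2⟩⟩

theorem norm_sub_eq (z z' : ℝ × Space p d) : |z.1 - z'.1| + ‖z.2 - z'.2‖ =
    l1 ((Q.toPt z).1.1 - (Q.toPt z').1.1) + |(Q.toPt z).1.2 - (Q.toPt z').1.2| +
      l1 ((Q.toPt z).2 - (Q.toPt z').2) := by
  have h1 := Q.norm_ofPt_sub (Q.toPt z) (Q.toPt z')
  have h2 := Q.abs_ofPt_sub (Q.toPt z) (Q.toPt z')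
  rw [ofPt_toPt, ofPt_toPt] at h1 h2
  rw [h1, h2]
  ring

theorem mem_PP₃ (h : Q.Setting K α) {z : ℝ × Space p d} (hz : z ∈ (Q.transport K α).K)
    {y : Fin n → ℝ} (hy : y ∈ (Q.transport K α).val) :
    ((Q.toPt z).1, y, (Q.toPt z).2) ∈ Q.PP₃ := ⟨h.subset_P₁ hz.1, hy, hz.2⟩

theorem c_inl (i : Fin n) (z : ℝ × Space p d) (y : Fin n → ℝ) (l : Fin p) :
    (Q.transport K α).c i (z, y) (Sum.inl l) = Q.C i l ((Q.toPt z).1, y, (Q.toPt z).2) := rfl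

theorem c_inr (i : Fin n) (z : ℝ × Space p d) (y : Fin n → ℝ) (j : Fin d) :
    (Q.transport K α).c i (z, y) (Sum.inr j) = 0 := rfl

theorem c_mem (h : Q.Setting K α) (i : Fin n) {z : ℝ × Space p d}
    (hz : z ∈ (Q.transport K α).K) {y : Fin n → ℝ} (hy : y ∈ (Q.transport K α).val) :
    (Q.transport K α).c i (z, y) ∈ (Q.transport K α).vel :=
  ⟨fun l => h.isConstants.2.2.2.1 i l _ (h.mem_PP₃ hz hy), fun j => c_inr i z y j⟩

theorem c_bound (h : Q.Setting K α) (i : Fin n) {z : ℝ × Space p d}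
    (hz : z ∈ (Q.transport K α).K) {y : Fin n → ℝ} (hy : y ∈ (Q.transport K α).val) :
    ‖(Q.transport K α).c i (z, y)‖ ≤ p * K.MC := by
  rw [norm_space]
  simp only [c_inl, c_inr, abs_zero, Finset.sum_const_zero, add_zero]
  refine (Finset.sum_le_sum fun l _ => h.isConstants.2.2.1 i l _ (h.mem_PP₃ hz hy)).trans ?_
  simp

theorem c_lip (h : Q.Setting K α) (i : Fin n) {z z' : ℝ × Space p d}
    (hz : z ∈ (Q.transport K α).K) {y y' : Fin n → ℝ} (hy : y ∈ (Q.transport K α).val)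
    (hz' : z' ∈ (Q.transport K α).K) (hy' : y' ∈ (Q.transport K α).val) :
    ‖(Q.transport K α).c i (z, y) - (Q.transport K α).c i (z', y')‖ ≤
      p * K.LC * (|z.1 - z'.1| + ‖z.2 - z'.2‖ + l1 (y - y')) := by
  have m := h.mem_PP₃ hz hy
  have m' := h.mem_PP₃ hz' hy'
  rw [norm_sub_eq (Q := Q), norm_space]
  simp only [PiLp.sub_apply, c_inl, c_inr, sub_self, abs_zero, Finset.sum_const_zero, add_zero]
  refine (Finset.sum_le_sum fun l _ => h.isConstants.2.2.2.2.1 i l _ m.1 _ m.2.1 _ m.2.2 _ m'.1 _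
    m'.2.1 _ m'.2.2).trans (le_of_eq ?_)
  simp only [Finset.sum_const, Finset.card_univ, Fintype.card_fin, nsmul_eq_mul]
  ring

theorem D_lip (h : Q.Setting K α) (i : Fin n) {z z' : ℝ × Space p d}
    (hz : z ∈ (Q.transport K α).K) {y y' : Fin n → ℝ} (hy : y ∈ (Q.transport K α).val)
    (hz' : z' ∈ (Q.transport K α).K) (hy' : y' ∈ (Q.transport K α).val) :
    |(Q.transport K α).D i (z, y) - (Q.transport K α).D i (z', y')| ≤
      K.LD * (|z.1 - z'.1| + ‖z.2 - z'.2‖ + l1 (y - y')) := by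
  have m := h.mem_PP₃ hz hy
  have m' := h.mem_PP₃ hz' hy'
  rw [norm_sub_eq (Q := Q)]
  refine (h.isConstants.2.2.2.2.2.1 i _ m.1 _ m.2.1 _ m.2.2 _ m'.1 _
    m'.2.1 _ m'.2.2).trans (le_of_eq ?_)
  ring

theorem I_lip (h : Q.Setting K α) (i : Fin n) {x x' : Space p d}
    (hx : ((0 : ℝ), x) ∈ (Q.transport K α).K) (hx' : ((0 : ℝ), x') ∈ (Q.transport K α).K) :
    |(Q.transport K α).I x i - (Q.transport K α).I x' i| ≤ K.LI * ‖x - x'‖ := by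
  rw [h.mem_base] at hx hx'
  refine (h.isConstants.2.2.2.2.2.2 i _ hx.1 _ hx.2 _ hx'.1 _ hx'.2).trans (le_of_eq ?_)
  rw [norm_space]
  rfl

theorem bounds (h : Q.Setting K α) :
    (Q.transport K α).Bounds α (p * K.LC) K.LD K.LI (p * K.MC) K.MD where
  inv := h.back
  time z hz := by
    have := ((Q.mem_S_iff h.mCl_le).1 (mem_transport_K.1 hz).1).2.1
    simpa [toPt_fst_snd] using this
  α_nonneg := h.admissible.1.le
  Λ_nonneg := mul_nonneg p.cast_nonneg h.LC_nonneg
  LD_nonneg := h.LD_nonneg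
  LI_nonneg := h.LI_nonneg
  Mc_nonneg := mul_nonneg p.cast_nonneg h.MC_nonneg
  MD_nonneg := h.MD_nonneg
  b_nonneg := h.b_pos.le
  c_mem i _ hz _ hy := h.c_mem i hz hy
  c_bound i _ hz _ hy := h.c_bound i hz hy
  D_bound i _ hz _ hy := h.isConstants.2.1 i _ (h.mem_PP₃ hz hy)
  c_lip i _ hz _ hy _ hz' _ hy' := h.c_lip i hz hy hz' hy'
  D_lip i _ hz _ hy _ hz' _ hy' := h.D_lip i hz hy hz' hy'
  I_lip i _ hx _ hx' := h.I_lip i hx hx'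

theorem interior_transport_K :
    interior (Q.transport K α).K = Q.toPt ⁻¹' (interior (Q.S K α) ×ˢ interior Q.P₃) := by
  rw [← interior_prod_eq]
  exact (Q.coordHomeo.symm.preimage_interior _).symm

theorem convex_transport_K (h : Q.Setting K α) : Convex ℝ (Q.transport K α).K := by
  intro z hz z' hz' a b ha hb hab
  change Q.toPt _ ∈ Q.S K α ×ˢ Q.P₃
  rw [Q.toPt_combo _ _ hab]
  exact h.convex hz hz' ha hb hab

theorem isCompact_transport_K (h : Q.Setting K α) : IsCompact (Q.transport K α).K :=
  Q.coordHomeo.symm.isCompact_preimage.2 h.isCompact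

theorem nonempty_interior_transport_K (h : Q.Setting K α) :
    (interior (Q.transport K α).K).Nonempty := by
  obtain ⟨q, hq⟩ := h.nonempty_interior
  refine ⟨Q.ofPt q, ?_⟩
  rw [interior_transport_K, mem_preimage, toPt_ofPt, ← interior_prod_eq]
  exact hq

/-- In the base the interior is that of `V × P₃`, and over the open box of `V` the standard domain
contains full neighbourhoods. -/
theorem isCore (h : Q.Setting K α) : (Q.transport K α).IsCore (interior (Q.transport K α).K) := by
  refine Transport.isCore_interior h.convex_transport_K h.nonempty_interior_transport_K h.back
    fun x hx => ?_
  have hcont : Continuous fun q : (Fin p → ℝ) × (Fin d → ℝ) =>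
      (WithLp.toLp 1 (Sum.elim q.1 q.2) : Space p d) := by
    refine (PiLp.continuous_toLp 1 _).comp (continuous_pi fun s => ?_)
    cases s <;> simp only [Sum.elim_inl, Sum.elim_inr] <;> fun_prop
  have h1 : ((fun l => x (Sum.inl l), fun j => x (Sum.inr j)) : (Fin p → ℝ) × (Fin d → ℝ)) ∈
      interior (Q.V ×ˢ Q.P₃) := by
    have hx' : (WithLp.toLp 1 (Sum.elim (fun l => x (Sum.inl l)) (fun j => x (Sum.inr j))) :
        Space p d) = x := by
      ext s; cases s <;> rfl
    have h2 := mem_interior_iff_mem_nhds.1 hx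
    rw [← hx'] at h2
    rw [mem_interior_iff_mem_nhds]
    filter_upwards [hcont.continuousAt.preimage_mem_nhds
      (x := ((fun l => x (Sum.inl l), fun j => x (Sum.inr j)))) h2] with q hq
    exact h.mem_base.1 hq
  rw [interior_prod_eq, V, interior_closedBall _ h.abar_pos.ne'] at h1
  rw [interior_transport_K, mem_preimage, toPt_zero]
  exact ⟨mem_interior_iff_mem_nhds.2 (h.isDomain.2.2 _ h1.1), h1.2⟩

end Setting

end System

end ParamPDE

namespace ParamPDE

set_option linter.unusedSectionVars false

open Filter

namespace System

variable {p n d : ℕ} {Q : System p n d} {K : Constants p} {α : ℝ}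

/-! ### The equations along lines -/

/-- The left side of the `i`-th equation is the derivative of `y_i` in the direction `(C_i, 1)`. -/
theorem eqnAt_iff {x : Pt p} {w : Fin d → ℝ} {y : Fin n → ℝ} {A : Pt p →L[ℝ] (Fin n → ℝ)} :
    Q.EqnAt x w y A ↔ ∀ i, A ((fun l => Q.C i l (x, y, w)), 1) i = Q.D i (x, y, w) := by
  refine forall_congr' fun i => ?_
  have h1 : (((fun l => Q.C i l (x, y, w)), 1) : Pt p) =
      (∑ l, Q.C i l (x, y, w) • ((Pi.single l 1, 0) : Pt p)) + (0, 1) := by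
    ext l
    · simp [Prod.fst_sum, Finset.sum_apply, Pi.single_apply]
    · simp [Prod.snd_sum]
  rw [h1, map_add, map_sum, Pi.add_apply, Finset.sum_apply]
  simp only [map_smul, Pi.smul_apply, smul_eq_mul]

theorem coord_c (i : Fin n) (z : ℝ × Space p d) (y : Fin n → ℝ) :
    coord p d (((fun l => Q.C i l ((Q.toPt z).1, y, (Q.toPt z).2)), 1), 0) =
      (1, (Q.transport K α).c i (z, y)) := rfl

theorem toPt_line (i : Fin n) (z : ℝ × Space p d) (y : Fin n → ℝ) (s : ℝ) :
    Q.toPt (z.1 + s, z.2 + s • (Q.transport K α).c i (z, y)) =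
      ((Q.toPt z).1 + s • ((fun l => Q.C i l ((Q.toPt z).1, y, (Q.toPt z).2)), (1 : ℝ)),
        (Q.toPt z).2) := by
  ext l
  · simp [toPt_fst_fst, Setting.c_inl]
  · simp [toPt_fst_snd]; ring
  · simp [toPt_snd, Setting.c_inr]

namespace Setting

/-- A solution of the transport system solves the equations, for every fixed parameter. -/
theorem eqnAt_of_integrates (h : Q.Setting K α) {f : ℝ × Space p d → Fin n → ℝ} {N : ℝ}
    (hf : (Q.transport K α).Admits f N) (hff : (Q.transport K α).Integrates f f) {x : Pt p}
    (hx : x ∈ interior (Q.S K α)) {w : Fin d → ℝ} (hw : w ∈ Q.P₃) {A : Pt p →L[ℝ] (Fin n → ℝ)}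
    (hA : HasFDerivAt (fun x' => f (Q.ofPt (x', w))) A x) :
    Q.EqnAt x w (f (Q.ofPt (x, w))) A := by
  rw [eqnAt_iff]
  intro i
  set z := Q.ofPt (x, w) with hz
  have hzt : Q.toPt z = (x, w) := Q.toPt_ofPt _
  set v : Pt p := ((fun l => Q.C i l (x, f z, w)), 1) with hv
  have hline : ∀ s : ℝ, Q.toPt (z.1 + s, z.2 + s • (Q.transport K α).field f i z) =
      (x + s • v, w) := by
    intro s
    have := toPt_line (K := K) (α := α) (Q := Q) i z (f z) s
    rwa [hzt] at this
  have hγ : HasDerivAt (fun s : ℝ => x + s • v) v 0 := by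
    simpa using ((hasDerivAt_id (0 : ℝ)).smul_const v).const_add x
  have hrate : (Q.transport K α).rate f i z = Q.D i (x, f z, w) := by
    change Q.D i ((Q.toPt z).1, f z, (Q.toPt z).2) = _
    rw [hzt]
  rw [← hrate]
  refine Transport.Integrates.eq_rate h.bounds hf hff (ofPt_mem (interior_subset hx) hw) ?_ ?_
  -- The line does not move `w`, so `x` has to be interior, but `w` may lie on the boundary of `P₃`.
  · have h1 : ∀ᶠ s : ℝ in 𝓝 0, x + s • v ∈ Q.S K α := by
      refine hγ.continuousAt.preimage_mem_nhds ?_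
      simpa using mem_interior_iff_mem_nhds.1 hx
    filter_upwards [h1] with s hs
    rw [mem_transport_K]
    erw [hline]
    exact ⟨hs, hw⟩
  · have h2 : HasFDerivAt (fun x' => f (Q.ofPt (x', w))) A (x + (0 : ℝ) • v) := by simpa using hA
    have h3 := (hasDerivAt_pi.1 (h2.comp_hasDerivAt (0 : ℝ) hγ)) i
    refine h3.congr_of_eventuallyEq (Eventually.of_forall fun s => ?_)
    simp only [Function.comp]
    rw [← hline, ofPt_toPt]

theorem dist_toPt_le (z z' : ℝ × Space p d) :
    dist (Q.toPt z) (Q.toPt z') ≤ |z.1 - z'.1| + ‖z.2 - z'.2‖ := by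
  rw [norm_sub_eq (Q := Q), Prod.dist_eq, Prod.dist_eq, dist_eq_norm, dist_eq_norm, dist_eq_norm]
  have h1 := Transport.norm_le_l1 ((Q.toPt z).1.1 - (Q.toPt z').1.1)
  have h2 := Transport.norm_le_l1 ((Q.toPt z).2 - (Q.toPt z').2)
  have h3 := l1_nonneg ((Q.toPt z).1.1 - (Q.toPt z').1.1)
  have h4 := l1_nonneg ((Q.toPt z).2 - (Q.toPt z').2)
  have h5 := abs_nonneg ((Q.toPt z).1.2 - (Q.toPt z').1.2)
  rw [Real.norm_eq_abs]
  refine max_le (max_le ?_ ?_) ?_ <;> linarith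

/-- Every solution of the equations is a solution of the transport system. -/
theorem integrates_of_isLipschitzSolution (h : Q.Setting K α)
    {g : Pt p × (Fin d → ℝ) → Fin n → ℝ} (hg : Q.IsLipschitzSolution (Q.S K α) g) :
    ∃ N, (Q.transport K α).Admits (g ∘ Q.toPt) N ∧
      (Q.transport K α).Integrates (g ∘ Q.toPt) (g ∘ Q.toPt) := by
  obtain ⟨⟨L, hL⟩, hmaps, hinit, hpde⟩ := hg
  have hadm : (Q.transport K α).Admits (g ∘ Q.toPt) L := by
    refine ⟨fun z hz => hmaps hz, L.2, fun i z hz z' hz' => ?_⟩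
    have h1 := hL.dist_le_mul _ hz _ hz'
    have h2 : |g (Q.toPt z) i - g (Q.toPt z') i| ≤ dist (g (Q.toPt z)) (g (Q.toPt z')) :=
      dist_le_pi_dist (g (Q.toPt z)) (g (Q.toPt z')) i
    exact h2.trans (h1.trans (mul_le_mul_of_nonneg_left (dist_toPt_le z z') L.2))
  refine ⟨L, hadm, Transport.integrates_of_hasDerivAt h.bounds hadm h.isCore (fun x hx => ?_)
    fun i z hz => Transport.hasDerivAt_of_fderiv h.bounds hadm isOpen_interior interior_subset
      (fun z hz hd i => ?_) i hz⟩
  · have hx' := h.mem_base.1 hx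
    simp only [Function.comp]
    rw [toPt_zero]
    exact hinit _ hx'.1 _ hx'.2
  · have hz' : Q.toPt z ∈ interior (Q.S K α ×ˢ Q.P₃) := by
      rw [interior_transport_K] at hz
      rw [interior_prod_eq]
      exact hz
    have hgd : HasFDerivAt g ((fderiv ℝ (g ∘ Q.toPt) z).comp
        (coord p d : (Pt p × (Fin d → ℝ)) →L[ℝ] ℝ × Space p d)) (Q.toPt z) := by
      have h1 : HasFDerivAt (g ∘ Q.toPt) (fderiv ℝ (g ∘ Q.toPt) z) (Q.ofPt (Q.toPt z)) := by
        rw [ofPt_toPt]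
        exact hd.hasFDerivAt
      have h2 := h1.comp (Q.toPt z) (Q.hasFDerivAt_ofPt (Q.toPt z))
      have h3 : (g ∘ Q.toPt) ∘ Q.ofPt = g := by
        ext q : 1
        simp
      rwa [h3] at h2
    have h4 := (eqnAt_iff.1 (hpde _ hz' hgd.differentiableAt)) i
    rw [hgd.fderiv] at h4
    exact h4

/-- Two Lipschitz solutions agree. -/
theorem eqOn (h : Q.Setting K α) {f g : Pt p × (Fin d → ℝ) → Fin n → ℝ}
    (hf : Q.IsLipschitzSolution (Q.S K α) f) (hg : Q.IsLipschitzSolution (Q.S K α) g) :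
    EqOn f g (Q.S K α ×ˢ Q.P₃) := by
  obtain ⟨N, hf1, hf2⟩ := h.integrates_of_isLipschitzSolution hf
  obtain ⟨N', hg1, hg2⟩ := h.integrates_of_isLipschitzSolution hg
  have hmono : ∀ {k : ℝ × Space p d → Fin n → ℝ} {M M' : ℝ}, M ≤ M' →
      (Q.transport K α).Admits k M → (Q.transport K α).Admits k M' := fun hM hk =>
    ⟨hk.maps, hk.nonneg.trans hM, fun i z hz z' hz' =>
      (hk.lip i z hz z' hz').trans (mul_le_mul_of_nonneg_right hM (by positivity))⟩
  have key := Transport.eqOn_of_integrates h.bounds (hmono (le_max_left N N') hf1)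
    (hmono (le_max_right N N') hg1) hf2 hg2
  rintro ⟨x, w⟩ ⟨hx, hw⟩
  simpa using key (ofPt_mem hx hw)

/-- The solution of the transport system. -/
theorem exists_integrates (h : Q.Setting K α) : ∃ f N,
    (Q.transport K α).Admits f N ∧ (Q.transport K α).Integrates f f ∧
      Q.HasLipschitzConstants K α (Q.S K α) (f ∘ Q.ofPt) := by
  obtain ⟨hα, hsmall, -, hMI, -⟩ := h.admissible
  have hn0 : (0 : ℝ) < n := by exact_mod_cast h.hn
  -- With `Λ = p * L_C`, the smallness condition of the profile is the locality condition of
  -- admissibility, since `1 + n L_I = n (L_I + 1/n)`. The same identity turns the bound of the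
  -- profile into `L_f`.
  obtain ⟨L, e, hL⟩ := exists_isLipschitzProfile h.hn hα.le h.bounds.Λ_nonneg h.LD_nonneg
    h.LI_nonneg (c₁ := K.c₁ n) rfl rfl (by
      refine lt_of_eq_of_lt ?_ hsmall
      field_simp
      ring)
  have hLf : ((1 + n * K.LI) * Real.exp (K.c₁ n * α) / (1 - p * K.LC * (1 + n * K.LI) *
      (α * Real.exp (step (K.c₁ n) * K.c₁ n * α))) - 1) / n = K.Lf n α := by
    have e1 : n * p * K.LC * α * (K.LI + 1 / n) * Real.exp (step (K.c₁ n) * K.c₁ n * α) =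
        p * K.LC * (1 + n * K.LI) * (α * Real.exp (step (K.c₁ n) * K.c₁ n * α)) := by
      field_simp
      ring
    rw [Constants.Lf, e1]
    have e2 : K.LI + 1 / n = (1 + n * K.LI) / n := by
      field_simp
      ring
    rw [e2]
    ring
  rw [hLf] at hL
  have hLf0 : 0 ≤ K.Lf n α := (hL.nonneg 0 ⟨le_rfl, hα.le⟩).trans (hL.le 0 ⟨le_rfl, hα.le⟩)
  obtain ⟨f, hf, hff⟩ := Transport.exists_solution h.bounds (fun i x hx => by
    have hx' := h.mem_base.1 hx
    have h1 := h.isConstants.1 (_, _) ⟨hx'.1, hx'.2⟩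
    have h2 := (norm_le_pi_norm _ i).trans h1
    exact h2.trans (by change K.MI ≤ Q.b - _; linarith)) hL
  refine ⟨f, _, hf.admits hLf0, hff, fun i x hx w hw x' hx' w' hw' hxx => ?_,
    fun i x hx w hw x' hx' w' hw' => ?_⟩
  · have h1 := hf.lip i _ (ofPt_mem hx hw) _ (ofPt_mem hx' hw')
    rw [Q.abs_ofPt_sub, Q.norm_ofPt_sub] at h1
    simp only [hxx, sub_self, abs_zero, mul_zero, add_zero] at h1
    exact h1
  · have h1 := hf.lip i _ (ofPt_mem hx hw) _ (ofPt_mem hx' hw')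
    rw [Q.abs_ofPt_sub, Q.norm_ofPt_sub] at h1
    have h2 : K.Lf n α ≤ K.LUfs n α := le_max_left _ _
    have h3 : K.MD + K.Lf n α * (p * K.MC) ≤ K.LUfs n α := by
      rw [← mul_assoc]
      exact le_max_right _ _
    have h4 := mul_le_mul_of_nonneg_right h2 (l1_nonneg (x.1 - x'.1))
    have h5 := mul_le_mul_of_nonneg_right h2 (l1_nonneg (w - w'))
    have h6 := mul_le_mul_of_nonneg_right h3 (abs_nonneg (x.2 - x'.2))
    simp only [Function.comp] at h1 ⊢
    linarith

/-! ### From integral solutions to solutions of the equations. -/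

variable {f : ℝ × Space p d → Fin n → ℝ} {N : ℝ}

theorem initial (h : Q.Setting K α) (hf : (Q.transport K α).Admits f N)
    (hff : (Q.transport K α).Integrates f f) {v : Fin p → ℝ} (hv : v ∈ Q.V) {w : Fin d → ℝ}
    (hw : w ∈ Q.P₃) : f (Q.ofPt (Q.onV v, w)) = Q.I (v, w) := by
  have h1 : Q.ofPt (Q.onV v, w) = (0, WithLp.toLp 1 (Sum.elim v w)) := by
    apply Q.coordHomeo.symm.injective
    change Q.toPt _ = Q.toPt _
    rw [toPt_ofPt, toPt_zero]
    rfl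
  rw [h1]
  exact hff.initial h.bounds hf (h.mem_base.2 ⟨hv, hw⟩)

theorem lipschitzOnWith (hf : (Q.transport K α).Admits f N) :
    ∃ L, LipschitzOnWith L (f ∘ Q.ofPt) (Q.S K α ×ˢ Q.P₃) := by
  have hN := hf.nonneg
  refine ⟨Real.toNNReal (2 * N * ‖(coord p d : (Pt p × (Fin d → ℝ)) →L[ℝ] ℝ × Space p d)‖),
    LipschitzOnWith.of_dist_le_mul fun q hq q' hq' => ?_⟩
  rw [Real.coe_toNNReal _ (by positivity), dist_eq_norm, dist_eq_norm]
  refine (hf.norm_sub_le (ofPt_mem hq.1 hq.2) (ofPt_mem hq'.1 hq'.2)).trans ?_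
  rw [mul_assoc _ _ ‖q - q'‖]
  refine mul_le_mul_of_nonneg_left ?_ (by positivity)
  have : Q.ofPt q - Q.ofPt q' =
      (coord p d : (Pt p × (Fin d → ℝ)) →L[ℝ] ℝ × Space p d) (q - q') := by
    simp [ofPt]
  rw [this]
  exact ContinuousLinearMap.le_opNorm _ _

theorem isLipschitzSolutionAt (h : Q.Setting K α) (hf : (Q.transport K α).Admits f N)
    (hff : (Q.transport K α).Integrates f f) {w : Fin d → ℝ} (hw : w ∈ Q.P₃) :
    Q.IsLipschitzSolutionAt w (Q.S K α) (fun x => (f ∘ Q.ofPt) (x, w)) := by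
  obtain ⟨L, hL⟩ := lipschitzOnWith hf
  refine ⟨⟨L, LipschitzOnWith.of_dist_le_mul fun x hx x' hx' => ?_⟩,
    fun x hx => hf.maps _ (ofPt_mem hx hw), fun v hv => h.initial hf hff hv hw,
    fun x hx hd => h.eqnAt_of_integrates hf hff hx hw hd.hasFDerivAt⟩
  simpa [Prod.dist_eq] using hL.dist_le_mul (x, w) ⟨hx, hw⟩ (x', w) ⟨hx', hw⟩

theorem isLipschitzSolution (h : Q.Setting K α) (hf : (Q.transport K α).Admits f N)
    (hff : (Q.transport K α).Integrates f f) :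
    Q.IsLipschitzSolution (Q.S K α) (f ∘ Q.ofPt) := by
  refine ⟨lipschitzOnWith hf, fun q hq => hf.maps _ (ofPt_mem hq.1 hq.2),
    fun v hv w hw => h.initial hf hff hv hw, fun ⟨x, w⟩ hz hd => ?_⟩
  rw [interior_prod_eq] at hz
  exact h.eqnAt_of_integrates hf hff hz.1 (interior_subset hz.2)
    (HasFDerivAt.comp (g := f ∘ Q.ofPt) (f := fun x' => (x', w)) x hd.hasFDerivAt
      (hasFDerivAt_prodMk_left x w))

end Setting

/-! ### Fixed parameters -/

/-- The system with a fixed parameter. -/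
def freeze (Q : System p n d) (w : Fin d → ℝ) : System p n 0 where
  x₀ := Q.x₀
  y₀ := Q.y₀
  w₀ := 0
  a := Q.a
  abar := Q.abar
  b := Q.b
  c := Q.c
  C i l z := Q.C i l (z.1, z.2.1, w)
  D i z := Q.D i (z.1, z.2.1, w)
  I u := Q.I (u.1, w)

/-- With `d = 0` the parameter box is a single point, and the same constants remain valid because
the parameter terms vanish. Uniqueness for one `w` follows in this way; joint uniqueness for the
original system would not suffice, as a solution for a single `w` need not come from a joint one. -/
theorem Setting.freeze (h : Q.Setting K α) {w : Fin d → ℝ} (hw : w ∈ Q.P₃) :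
    (Q.freeze w).Setting K α := by
  refine ⟨h.hp, h.hn, h.abar_pos, h.abar_le, h.b_pos, h.c_pos, ?_, h.admissible⟩
  obtain ⟨k1, k2, k3, k4, k5, k6, k7⟩ := h.isConstants
  refine ⟨fun u hu => k1 _ ⟨hu.1, hw⟩, fun i z hz => k2 i _ ⟨hz.1, hz.2.1, hw⟩,
    fun i l z hz => k3 i l _ ⟨hz.1, hz.2.1, hw⟩, fun i l z hz => k4 i l _ ⟨hz.1, hz.2.1, hw⟩,
    fun i l x hx y hy w1 hw1 x' hx' y' hy' w2 hw2 => ?_,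
    fun i x hx y hy w1 hw1 x' hx' y' hy' w2 hw2 => ?_, fun i v hv w1 hw1 v' hv' w2 hw2 => ?_⟩
  · have := k5 i l x hx y hy w hw x' hx' y' hy' w hw
    rw [sub_self, l1_zero] at this
    rw [Subsingleton.elim w1 w2, sub_self, l1_zero]
    exact this
  · have := k6 i x hx y hy w hw x' hx' y' hy' w hw
    rw [sub_self, l1_zero] at this
    rw [Subsingleton.elim w1 w2, sub_self, l1_zero]
    exact this
  · have := k7 i v hv w hw v' hv' w hw
    rw [sub_self, l1_zero] at this
    rw [Subsingleton.elim w1 w2, sub_self, l1_zero]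
    exact this

theorem IsLipschitzSolutionAt.freeze {w : Fin d → ℝ} {g : Pt p → Fin n → ℝ}
    (hg : Q.IsLipschitzSolutionAt w (Q.S K α) g) :
    (Q.freeze w).IsLipschitzSolution ((Q.freeze w).S K α) (fun z => g z.1) := by
  obtain ⟨⟨L, hL⟩, hmaps, hinit, hpde⟩ := hg
  refine ⟨⟨L, LipschitzOnWith.of_dist_le_mul fun z hz z' hz' => ?_⟩, fun z hz => hmaps hz.1,
    fun v hv _ _ => hinit v hv, fun ⟨x, u⟩ hz hd => ?_⟩
  · exact (hL.dist_le_mul _ hz.1 _ hz'.1).trans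
      (mul_le_mul_of_nonneg_left (le_max_left _ _) L.2)
  · rw [interior_prod_eq] at hz
    have h1 : HasFDerivAt g _ x := HasFDerivAt.comp (g := fun z : Pt p × (Fin 0 → ℝ) => g z.1)
      (f := fun x' => (x', u)) x hd.hasFDerivAt (hasFDerivAt_prodMk_left x u)
    have h2 := hpde x hz.1 h1.differentiableAt
    rw [h1.fderiv] at h2
    exact h2

/-- Two Lipschitz solutions for the same parameter agree. -/
theorem Setting.eqOn_at (h : Q.Setting K α) {w : Fin d → ℝ} (hw : w ∈ Q.P₃)
    {f g : Pt p → Fin n → ℝ} (hf : Q.IsLipschitzSolutionAt w (Q.S K α) f)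
    (hg : Q.IsLipschitzSolutionAt w (Q.S K α) g) : EqOn f g (Q.S K α) := by
  intro x hx
  exact (h.freeze hw).eqOn hf.freeze hg.freeze (x := (x, 0)) ⟨hx, (h.freeze hw).mem_P₃⟩

end System

end ParamPDE

namespace ParamPDE

set_option linter.unusedSectionVars false

open Filter

namespace System

variable {p n d : ℕ} {Q : System p n d} {K : Constants p} {α : ℝ}

/-! ### Data of class `C^r` -/

namespace Setting

theorem isSmooth (h : Q.Setting K α) {r : ℕ} (hQ : Q.ContDiffData r) :
    (Q.transport K α).IsSmooth r := by
  obtain ⟨hC, hD, hI⟩ := hQ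
  have hz : ContDiff ℝ r fun q : (ℝ × Space p d) × (Fin n → ℝ) =>
      ((Q.toPt q.1).1, q.2, (Q.toPt q.1).2) :=
    (Q.contDiff_toPt.comp contDiff_fst).fst.prodMk
      (contDiff_snd.prodMk (Q.contDiff_toPt.comp contDiff_fst).snd)
  have hzm : MapsTo (fun q : (ℝ × Space p d) × (Fin n → ℝ) =>
      ((Q.toPt q.1).1, q.2, (Q.toPt q.1).2))
      ((Q.transport K α).K ×ˢ (Q.transport K α).val) Q.PP₃ := fun q hq =>
    h.mem_PP₃ hq.1 hq.2
  refine ⟨h.b_pos, h.convex_transport_K, h.isCompact_transport_K,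
    h.nonempty_interior_transport_K, ?_, fun i => ?_, fun i => ?_, fun i => ?_⟩
  · have hcont : Continuous fun x : Space p d =>
        ((fun l => x (Sum.inl l), fun j => x (Sum.inr j)) : (Fin p → ℝ) × (Fin d → ℝ)) := by
      fun_prop
    refine ⟨WithLp.toLp 1 (Sum.elim Q.x₀.1 Q.w₀), mem_interior_iff_mem_nhds.2 ?_⟩
    have h1 : Q.V ×ˢ Q.P₃ ∈ 𝓝 (Q.x₀.1, Q.w₀) :=
      prod_mem_nhds (Metric.closedBall_mem_nhds _ h.abar_pos)
        (Metric.closedBall_mem_nhds _ h.c_pos)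
    filter_upwards [hcont.continuousAt.preimage_mem_nhds
      (x := WithLp.toLp 1 (Sum.elim Q.x₀.1 Q.w₀)) h1] with x hx
    exact h.mem_base.2 hx
  · have h1 : ContDiffOn ℝ r (fun q : (ℝ × Space p d) × (Fin n → ℝ) =>
        fun l => Q.C i l ((Q.toPt q.1).1, q.2, (Q.toPt q.1).2))
        ((Q.transport K α).K ×ˢ (Q.transport K α).val) :=
      contDiffOn_pi.2 fun l => (hC i l).comp hz.contDiffOn hzm
    exact ((coord p d).contDiff.comp_contDiffOn
      ((h1.prodMk (contDiffOn_const (c := (1 : ℝ)))).prodMk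
        (contDiffOn_const (c := (0 : Fin d → ℝ))))).snd
  · exact (hD i).comp hz.contDiffOn hzm
  · have h1 : ContDiff ℝ r fun x : Space p d =>
        ((fun l => x (Sum.inl l), fun j => x (Sum.inr j)) : (Fin p → ℝ) × (Fin d → ℝ)) :=
      (contDiff_pi.2 fun l => by fun_prop).prodMk (contDiff_pi.2 fun j => by fun_prop)
    exact contDiffOn_pi.1 (hI.comp h1.contDiffOn fun x hx => h.mem_base.1 hx) i

theorem uniqueDiffOn_S (h : Q.Setting K α) : UniqueDiffOn ℝ (Q.S K α) :=
  uniqueDiffOn_convex (Q.convex_S h.mCl_le) h.isInterior_S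

variable {f : ℝ × Space p d → Fin n → ℝ} {N : ℝ}

theorem contDiffOn (h : Q.Setting K α) {r : ℕ} (hr : 1 ≤ r) (hQ : Q.ContDiffData r)
    (hf : (Q.transport K α).Admits f N) (hff : (Q.transport K α).Integrates f f) :
    ContDiffOn ℝ r f (Q.transport K α).K := by
  obtain ⟨k, rfl⟩ := Nat.exists_eq_add_of_le' hr
  exact Transport.contDiffOn_of_integrates k (h.isSmooth hQ) h.back (fun i z hz y hy => h.c_mem i hz hy)
    h.isCore hf hff

/-- The velocity `(1, c)` has no parameter component. So the derivative of `f` along it, known up to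
the boundary of the space-time domain, is the derivative within the `x`-domain at fixed `w`. -/
theorem eqnAt_fderivWithin (h : Q.Setting K α) {r : ℕ} (hr : 1 ≤ r) (hQ : Q.ContDiffData r)
    (hf : (Q.transport K α).Admits f N) (hff : (Q.transport K α).Integrates f f) {x : Pt p}
    (hx : x ∈ Q.S K α) {w : Fin d → ℝ} (hw : w ∈ Q.P₃) :
    Q.EqnAt x w ((f ∘ Q.ofPt) (x, w))
      (fderivWithin ℝ (fun x' => (f ∘ Q.ofPt) (x', w)) (Q.S K α) x) := by
  have hf1 : ContDiffOn ℝ 1 f (Q.transport K α).K :=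
    (h.contDiffOn hr hQ hf hff).of_le (by exact_mod_cast hr)
  have hd : HasFDerivWithinAt f (fderivWithin ℝ f (Q.transport K α).K (Q.ofPt (x, w)))
      (Q.transport K α).K (Q.ofPt (x, w)) :=
    (hf1.differentiableOn one_ne_zero _ (ofPt_mem hx hw)).hasFDerivWithinAt
  have h1 : HasFDerivAt (fun x' => Q.ofPt (x', w)) _ x :=
    HasFDerivAt.comp (g := Q.ofPt) (f := fun x' => (x', w)) x (Q.hasFDerivAt_ofPt (x, w))
      (hasFDerivAt_prodMk_left x w)
  have h2 := HasFDerivWithinAt.comp (g := f) (f := fun x' => Q.ofPt (x', w)) x hd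
    (h1.hasFDerivWithinAt (s := Q.S K α)) fun x' hx' => ofPt_mem hx' hw
  have h3 := h2.fderivWithin (h.uniqueDiffOn_S x hx)
  rw [eqnAt_iff]
  intro i
  have h4 := hff.fderivWithin_eq h.bounds ((h.isSmooth hQ).mono hr) hf hf1 (ofPt_mem hx hw) i
  have h5 : fderivWithin ℝ (fun x' => (f ∘ Q.ofPt) (x', w)) (Q.S K α) x = _ := h3
  rw [h5]
  have h6 : (Q.transport K α).rate f i (Q.ofPt (x, w)) =
      Q.D i (x, (f ∘ Q.ofPt) (x, w), w) := by
    change Q.D i ((Q.toPt (Q.ofPt (x, w))).1, f _, (Q.toPt (Q.ofPt (x, w))).2) = _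
    rw [toPt_ofPt]
    rfl
  rw [← h6, ← h4]
  have h7 := coord_c (Q := Q) (K := K) (α := α) i (Q.ofPt (x, w)) (f (Q.ofPt (x, w)))
  rw [toPt_ofPt] at h7
  change _ = fderivWithin ℝ f (Q.transport K α).K (Q.ofPt (x, w))
    (1, (Q.transport K α).c i (Q.ofPt (x, w), f (Q.ofPt (x, w)))) i
  rw [← h7]
  rfl

theorem isContDiffSolution (h : Q.Setting K α) {r : ℕ} (hr : 1 ≤ r) (hQ : Q.ContDiffData r)
    (hf : (Q.transport K α).Admits f N) (hff : (Q.transport K α).Integrates f f) :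
    Q.IsContDiffSolution r (Q.S K α) (f ∘ Q.ofPt) :=
  ⟨(h.contDiffOn hr hQ hf hff).comp Q.contDiff_ofPt.contDiffOn fun _ hq => ofPt_mem hq.1 hq.2,
    fun _ hq => hf.maps _ (ofPt_mem hq.1 hq.2), fun _ hv _ hw => h.initial hf hff hv hw,
    fun _ hx _ hw => h.eqnAt_fderivWithin hr hQ hf hff hx hw⟩

theorem isContDiffSolutionAt {r : ℕ} {f : Pt p × (Fin d → ℝ) → Fin n → ℝ}
    (hf : Q.IsContDiffSolution r (Q.S K α) f) {w : Fin d → ℝ} (hw : w ∈ Q.P₃) :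
    Q.IsContDiffSolutionAt r w (Q.S K α) (fun x => f (x, w)) :=
  ⟨hf.1.comp (contDiff_prodMk_left w).contDiffOn fun _ hx => ⟨hx, hw⟩,
    fun _ hx => hf.2.1 ⟨hx, hw⟩, fun v hv => hf.2.2.1 v hv w hw, fun x hx => hf.2.2.2 x hx w hw⟩

end Setting

/-! ### Solutions of class `C^r` as Lipschitz solutions. -/

theorem lipschitzOnWith_of_contDiffOn {E F : Type*} [NormedAddCommGroup E] [NormedSpace ℝ E]
    [NormedAddCommGroup F] [NormedSpace ℝ F] {S : Set E} (hS : IsCompact S) (hconv : Convex ℝ S)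
    (hint : (interior S).Nonempty) {G : E → F} {r : ℕ} (hr : 1 ≤ r) (hG : ContDiffOn ℝ r G S) :
    ∃ L, LipschitzOnWith L G S := by
  obtain ⟨L, hL, h⟩ := exists_lipschitz_of_contDiffOn hS hconv hint
    (hG.of_le (by exact_mod_cast hr : (1 : WithTop ℕ∞) ≤ r))
  refine ⟨L.toNNReal, LipschitzOnWith.of_dist_le_mul fun x hx y hy => ?_⟩
  rw [Real.coe_toNNReal _ hL, dist_eq_norm, dist_eq_norm]
  exact h x hx y hy

/-- On a compact convex body a `C^r` function is Lipschitz, so uniqueness among `C^r` solutions is a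
special case of uniqueness among Lipschitz solutions. -/
theorem Setting.isLipschitzSolution_of_contDiff (h : Q.Setting K α) {r : ℕ} (hr : 1 ≤ r)
    {g : Pt p × (Fin d → ℝ) → Fin n → ℝ} (hg : Q.IsContDiffSolution r (Q.S K α) g) :
    Q.IsLipschitzSolution (Q.S K α) g := by
  refine ⟨lipschitzOnWith_of_contDiffOn h.isCompact h.convex h.nonempty_interior hr hg.1, hg.2.1,
    hg.2.2.1, fun ⟨x, w⟩ hz hd => ?_⟩
  rw [interior_prod_eq] at hz
  have h1 := hg.2.2.2 x (interior_subset hz.1) w (interior_subset hz.2)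
  rw [fderivWithin_of_mem_nhds (mem_interior_iff_mem_nhds.1 hz.1)] at h1
  have h2 : HasFDerivAt (fun x' => g (x', w)) _ x := HasFDerivAt.comp (g := g)
    (f := fun x' => (x', w)) x hd.hasFDerivAt (hasFDerivAt_prodMk_left x w)
  rw [h2.fderiv] at h1
  exact h1

theorem Setting.isLipschitzSolutionAt_of_contDiff (h : Q.Setting K α) {r : ℕ} (hr : 1 ≤ r)
    {w : Fin d → ℝ} {g : Pt p → Fin n → ℝ} (hg : Q.IsContDiffSolutionAt r w (Q.S K α) g) :
    Q.IsLipschitzSolutionAt w (Q.S K α) g := by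
  refine ⟨lipschitzOnWith_of_contDiffOn (Q.isCompact_S h.mCl_le) (Q.convex_S h.mCl_le)
    h.isInterior_S hr hg.1, hg.2.1, hg.2.2.1, fun x hx _ => ?_⟩
  have h1 := hg.2.2.2 x (interior_subset hx)
  rwa [fderivWithin_of_mem_nhds (mem_interior_iff_mem_nhds.1 hx)] at h1

/-! ### Existence of the constants -/

theorem ContDiffData.lipschitzData {r : ℕ} (hr : 1 ≤ r) (habar : 0 < Q.abar)
    (ha : Q.abar ≤ Q.a) (hb : 0 < Q.b) (hc : 0 < Q.c) (hQ : Q.ContDiffData r) :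
    Q.LipschitzData := by
  have hint : ∀ {E : Type} [NormedAddCommGroup E] (x : E) {s : ℝ}, 0 < s →
      (interior (Metric.closedBall x s)).Nonempty := fun x s hs =>
    ⟨x, Metric.ball_subset_interior_closedBall (Metric.mem_ball_self hs)⟩
  have h1 : IsCompact Q.PP₃ := (isCompact_closedBall _ _).prod
    ((isCompact_closedBall _ _).prod (isCompact_closedBall _ _))
  have h2 : Convex ℝ Q.PP₃ := (convex_closedBall _ _).prod
    ((convex_closedBall _ _).prod (convex_closedBall _ _))
  have h3 : (interior Q.PP₃).Nonempty := by
    rw [PP₃, interior_prod_eq, interior_prod_eq]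
    exact (hint _ (habar.trans_le ha)).prod ((hint _ hb).prod (hint _ hc))
  have h4 : (interior (Q.V ×ˢ Q.P₃)).Nonempty := by
    rw [interior_prod_eq]
    exact (hint _ habar).prod (hint _ hc)
  exact ⟨fun i l => lipschitzOnWith_of_contDiffOn h1 h2 h3 hr (hQ.1 i l),
    fun i => lipschitzOnWith_of_contDiffOn h1 h2 h3 hr (hQ.2.1 i),
    lipschitzOnWith_of_contDiffOn ((isCompact_closedBall _ _).prod (isCompact_closedBall _ _))
      ((convex_closedBall _ _).prod (convex_closedBall _ _)) h4 hr hQ.2.2⟩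

theorem dist_triple_le (x x' : Pt p) (y y' : Fin n → ℝ) (w w' : Fin d → ℝ) :
    dist (x, y, w) (x', y', w') ≤ l1 (x.1 - x'.1) + |x.2 - x'.2| + l1 (y - y') + l1 (w - w') := by
  rw [Prod.dist_eq, Prod.dist_eq, Prod.dist_eq, dist_eq_norm, dist_eq_norm, dist_eq_norm,
    dist_eq_norm, Real.norm_eq_abs]
  have h1 := Transport.norm_le_l1 (x.1 - x'.1)
  have h2 := Transport.norm_le_l1 (y - y')
  have h3 := Transport.norm_le_l1 (w - w')
  have h4 := abs_nonneg (x.2 - x'.2)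
  have h5 := norm_nonneg (x.1 - x'.1)
  have h6 := norm_nonneg (y - y')
  have h7 := norm_nonneg (w - w')
  refine max_le (max_le ?_ ?_) (max_le ?_ ?_) <;> (simp only; linarith)

/-- Finitely many functions that are bounded, or Lipschitz, have a common constant. -/
theorem exists_common {ι : Type*} [Finite ι] {P : ι → ℝ → Prop}
    (hP : ∀ i, ∀ M M', M ≤ M' → P i M → P i M') (h : ∀ i, ∃ M, P i M) : ∃ M, 0 ≤ M ∧ ∀ i, P i M := by
  choose M hM using h
  obtain ⟨B, hB⟩ := (Set.finite_range M).bddAbove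
  exact ⟨max B 0, le_max_right _ _, fun i =>
    hP i _ _ ((hB (mem_range_self i)).trans (le_max_left _ _)) (hM i)⟩

/-- Everything comes from compactness and the finite number of coefficients. `M_I` is taken as the
attained maximum, so the pointwise strict bound gives `M_I < b`, which leaves room for a positive
height. -/
theorem exists_isConstants (habar : 0 < Q.abar) (hc : 0 < Q.c)
    (hI : ∀ u ∈ Q.V ×ˢ Q.P₃, ‖Q.I u - Q.y₀‖ < Q.b) (hQ : Q.LipschitzData) :
    ∃ K, Q.IsConstants K ∧ K.MI < Q.b := by
  obtain ⟨hC, hD, LI, hLI⟩ := hQ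
  have hcomp : IsCompact Q.PP₃ := (isCompact_closedBall _ _).prod
    ((isCompact_closedBall _ _).prod (isCompact_closedBall _ _))
  have hbound : ∀ {F : Pt p × (Fin n → ℝ) × (Fin d → ℝ) → ℝ}, (∃ L, LipschitzOnWith L F Q.PP₃) →
      ∃ M, ∀ z ∈ Q.PP₃, |F z| ≤ M := fun ⟨_, hL⟩ =>
    hcomp.exists_bound_of_continuousOn hL.continuousOn
  have hlip : ∀ {F : Pt p × (Fin n → ℝ) × (Fin d → ℝ) → ℝ}, (∃ L, LipschitzOnWith L F Q.PP₃) →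
      ∃ M : ℝ, ∀ x ∈ Q.P₁, ∀ y ∈ Q.P₂, ∀ w ∈ Q.P₃, ∀ x' ∈ Q.P₁, ∀ y' ∈ Q.P₂, ∀ w' ∈ Q.P₃,
        |F (x, y, w) - F (x', y', w')| ≤
          M * (l1 (x.1 - x'.1) + |x.2 - x'.2| + l1 (y - y') + l1 (w - w')) :=
    fun ⟨L, hL⟩ => ⟨L, fun x hx y hy w hw x' hx' y' hy' w' hw' =>
      (hL.dist_le_mul (x, y, w) ⟨hx, hy, hw⟩ (x', y', w') ⟨hx', hy', hw'⟩).trans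
        (mul_le_mul_of_nonneg_left (dist_triple_le _ _ _ _ _ _) L.2)⟩
  have hnn : ∀ (x x' : Pt p) (y y' : Fin n → ℝ) (w w' : Fin d → ℝ),
      0 ≤ l1 (x.1 - x'.1) + |x.2 - x'.2| + l1 (y - y') + l1 (w - w') := fun x x' y y' w w' =>
    dist_nonneg.trans (dist_triple_le x x' y y' w w')
  obtain ⟨MD, -, hMD⟩ := exists_common (fun i M M' hM h z hz => (h z hz).trans hM)
    fun i => hbound (hD i)
  obtain ⟨MC, -, hMC⟩ := exists_common (ι := Fin n × Fin p)
    (fun i M M' hM h z hz => (h z hz).trans hM) fun i => hbound (hC i.1 i.2)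
  obtain ⟨LD, -, hLD⟩ := exists_common (fun i M M' hM h x hx y hy w hw x' hx' y' hy' w' hw' =>
    (h x hx y hy w hw x' hx' y' hy' w' hw').trans
      (mul_le_mul_of_nonneg_right hM (hnn _ _ _ _ _ _))) fun i => hlip (hD i)
  obtain ⟨LC, -, hLC⟩ := exists_common (ι := Fin n × Fin p)
    (fun i M M' hM h x hx y hy w hw x' hx' y' hy' w' hw' =>
    (h x hx y hy w hw x' hx' y' hy' w' hw').trans
      (mul_le_mul_of_nonneg_right hM (hnn _ _ _ _ _ _))) fun i => hlip (hC i.1 i.2)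
  have hVP : IsCompact (Q.V ×ˢ Q.P₃) := (isCompact_closedBall _ _).prod (isCompact_closedBall _ _)
  obtain ⟨u, hu, hmax⟩ := hVP.exists_isMaxOn
    ⟨(Q.x₀.1, Q.w₀), Metric.mem_closedBall_self habar.le, Metric.mem_closedBall_self hc.le⟩
    (hLI.continuousOn.sub continuousOn_const).norm
  refine ⟨⟨‖Q.I u - Q.y₀‖, MD, MC, fun _ => -MC, fun _ => MC, LC, LD, LI⟩,
    ⟨fun u' hu' => hmax hu', hMD, fun i l => hMC (i, l),
      fun i l z hz => abs_le.1 (hMC (i, l) z hz), fun i l => hLC (i, l), hLD,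
      fun i v hv w hw v' hv' w' hw' => ?_⟩, hI u hu⟩
  have h1 := hLI.dist_le_mul (v, w) ⟨hv, hw⟩ (v', w') ⟨hv', hw'⟩
  refine (dist_le_pi_dist (Q.I (v, w)) (Q.I (v', w')) i).trans (h1.trans ?_)
  refine mul_le_mul_of_nonneg_left ?_ LI.2
  rw [Prod.dist_eq, dist_eq_norm, dist_eq_norm]
  have h2 := Transport.norm_le_l1 (v - v')
  have h3 := Transport.norm_le_l1 (w - w')
  have h4 := norm_nonneg (v - v')
  have h5 := norm_nonneg (w - w')
  refine max_le ?_ ?_ <;> (simp only; linarith)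

/-- Apart from `α > 0`, each condition depends continuously on `α` and holds strictly at `α = 0`. -/
theorem exists_admissible (habar : 0 < Q.abar) (ha : Q.abar ≤ Q.a) (hK : K.MI < Q.b) :
    ∃ α, Q.Admissible K α := by
  have hlt : ∀ {φ : ℝ → ℝ} {B : ℝ}, Continuous φ → φ 0 < B → ∀ᶠ α in 𝓝[>] (0 : ℝ), φ α < B :=
    fun hφ h0 => (hφ.continuousAt.eventually_lt_const h0).filter_mono nhdsWithin_le_nhds
  have h1 : ∀ᶠ α in 𝓝[>] (0 : ℝ),
      α * (Real.exp (step (K.c₁ n) * K.c₁ n * α) * n * p * K.LC * (K.LI + 1 / n)) < 1 :=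
    hlt (by fun_prop) (by simp)
  have h2 : ∀ᶠ α in 𝓝[>] (0 : ℝ), α < Q.a := hlt continuous_id (habar.trans_le ha)
  have h3 : ∀ᶠ α in 𝓝[>] (0 : ℝ), α * K.MD < Q.b - K.MI :=
    hlt (by fun_prop) (by simpa using hK)
  have h4 : ∀ᶠ α in 𝓝[>] (0 : ℝ), ∀ l, K.MCl l * α - K.mCl l * α < 2 * Q.abar :=
    eventually_all.2 fun l => hlt (by fun_prop) (by simpa using habar)
  obtain ⟨α, e1, e2, e3, e4, e5⟩ :=
    (h1.and (h2.and (h3.and (h4.and self_mem_nhdsWithin)))).exists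
  exact ⟨α, e5, e1, e2.le, e3.le, fun l => by linarith [e4 l]⟩

end System

end ParamPDE

/-! ### The main theorem. -/

theorem mainTheorem2 {p n d : ℕ} (hp : 1 ≤ p) (hn : 1 ≤ n) (Q : ParamPDE.System p n d)
    (habar : 0 < Q.abar) (ha : Q.abar ≤ Q.a) (hc : 0 < Q.c)
    (hI : ∀ u ∈ Q.V ×ˢ Q.P₃, ‖Q.I u - Q.y₀‖ < Q.b) :
    -- Lipschitz data
    (Q.LipschitzData →
      (∃ K α, Q.IsConstants K ∧ Q.Admissible K α) ∧
      ∀ K α, Q.IsConstants K → Q.Admissible K α →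
        Q.IsDomain (Q.S K α) ∧
        ∃ f : ParamPDE.Pt p × (Fin d → ℝ) → Fin n → ℝ,
          Q.IsLipschitzSolution (Q.S K α) f ∧
          (∀ g, Q.IsLipschitzSolution (Q.S K α) g → EqOn g f (Q.S K α ×ˢ Q.P₃)) ∧
          (∀ w ∈ Q.P₃,
            Q.IsLipschitzSolutionAt w (Q.S K α) (fun x => f (x, w)) ∧
            ∀ g, Q.IsLipschitzSolutionAt w (Q.S K α) g →
              EqOn g (fun x => f (x, w)) (Q.S K α)) ∧
          Q.HasLipschitzConstants K α (Q.S K α) f) ∧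
    -- data of class `C^r`
    (∀ r : ℕ, 1 ≤ r → Q.ContDiffData r →
      (∃ K α, Q.IsConstants K ∧ Q.Admissible K α) ∧
      ∀ K α, Q.IsConstants K → Q.Admissible K α →
        Q.IsDomain (Q.S K α) ∧
        ∃ f : ParamPDE.Pt p × (Fin d → ℝ) → Fin n → ℝ,
          Q.IsContDiffSolution r (Q.S K α) f ∧
          (∀ g, Q.IsContDiffSolution r (Q.S K α) g → EqOn g f (Q.S K α ×ˢ Q.P₃)) ∧
          (∀ w ∈ Q.P₃,
            Q.IsContDiffSolutionAt r w (Q.S K α) (fun x => f (x, w)) ∧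
            ∀ g, Q.IsContDiffSolutionAt r w (Q.S K α) g →
              EqOn g (fun x => f (x, w)) (Q.S K α)) ∧
          Q.HasLipschitzConstants K α (Q.S K α) f) := by
  -- Positivity of `b` follows from the strict bound on the initial datum at the centre of `V × P₃`.
  have hb : 0 < Q.b := (norm_nonneg _).trans_lt (hI (Q.x₀.1, Q.w₀)
    ⟨Metric.mem_closedBall_self habar.le, Metric.mem_closedBall_self hc.le⟩)
  have hconst : Q.LipschitzData → ∃ K α, Q.IsConstants K ∧ Q.Admissible K α := fun hQ => by
    obtain ⟨K, hK, hMI⟩ := ParamPDE.System.exists_isConstants habar hc hI hQ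
    obtain ⟨α, hα⟩ := ParamPDE.System.exists_admissible habar ha hMI
    exact ⟨K, α, hK, hα⟩
  have hset : ∀ K α, Q.IsConstants K → Q.Admissible K α → Q.Setting K α := fun K α hK hα =>
    ⟨hp, hn, habar, ha, hb, hc, hK, hα⟩
  refine ⟨fun hQ => ⟨hconst hQ, fun K α hK hα => ?_⟩, fun r hr hQ =>
    ⟨hconst (hQ.lipschitzData hr habar ha hb hc), fun K α hK hα => ?_⟩⟩
  · have h := hset K α hK hα
    obtain ⟨f, N, hf, hff, hL⟩ := h.exists_integrates
    exact ⟨h.isDomain, f ∘ Q.ofPt, h.isLipschitzSolution hf hff,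
      fun g hg => h.eqOn hg (h.isLipschitzSolution hf hff), fun w hw =>
      ⟨h.isLipschitzSolutionAt hf hff hw, fun g hg =>
        h.eqOn_at hw hg (h.isLipschitzSolutionAt hf hff hw)⟩, hL⟩
  · have h := hset K α hK hα
    obtain ⟨f, N, hf, hff, hL⟩ := h.exists_integrates
    have hsol := h.isContDiffSolution hr hQ hf hff
    exact ⟨h.isDomain, f ∘ Q.ofPt, hsol,
      fun g hg => h.eqOn (h.isLipschitzSolution_of_contDiff hr hg)
        (h.isLipschitzSolution hf hff), fun w hw =>
      ⟨ParamPDE.System.Setting.isContDiffSolutionAt hsol hw, fun g hg =>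
        h.eqOn_at hw (h.isLipschitzSolutionAt_of_contDiff hr hg)
          (h.isLipschitzSolutionAt hf hff hw)⟩, hL⟩
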